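/- **Setting.** Let $N\ge 2$ and let $M,L,L_1,n$ be positive integers. Let $A=(A_1,\dots,A_L)$, $A_ku=\sum_{j=1}^M\sum_{\alpha}a^j_{\alpha,k}D^\alpha u^j$, be a system of linear differential operators of finite order with constant complex coefficients, acting on $\mathbb C^M$-valued functions on open subsets of $\mathbb R^N$. For $i=1,\dots,n$ let $B^i=(B^i_1,\dots,B^i_{L_1})$ be a boundary operator $$B^i_ku=\sum_{l=1}^N\sum_{j=1}^M\sum_{\alpha}\nu_l\,b^{i,j}_{\alpha,l,k}D^\alpha u^j+\sum_{j=1}^M\sum_{\alpha}b^{i,j}_{\alpha,0,k}D^\alpha u^j$$ of finite order with constant complex coefficients, where $\nu$ is a unit normal. "$Au=0$ in $D$" means that $u$ is continuous in the open set $D$ and that $Au=0$ in the sense of distributions in $D$. For a hyperplane $\Pi$ with unit normal $\nu$, let $T_\Pi$ be the reflection in $\Pi$, $H^+_\Pi$ the open half-space bounded by $\Pi$ with exterior normal $\nu$, and $H^-_\Pi$ the opposite open half-space. If $v$ solves $Av=0$ on one side of $\Pi$ near a point $x\in\Pi$, then "$B^iv=0$ at $x$" means that $B^iv$, computed with the constant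 normal to $\Pi$ exterior to that side, tends to $0$ at $x$ from that side. **Assumptions.** (A.1) If $Au=0$ in an open set $D$, then all partial derivatives $D^\alpha u^j$ appearing in $A$ and in $B^1,\dots,B^n$ exist and are continuous in $D$. (A.2) If $Au=0$ in an open connected set $D$ and $u=0$ in a nonempty open subset of $D$, then $u=0$ in $D$. (A.3) For each $i$ and each hyperplane $\Pi$ with unit normal $\nu$ there is an operator $\tilde T=\tilde T^i_{\Pi,\nu}$ on $\mathbb C^M$-valued functions, compatible with restriction to open subsets, such that, whenever $D^+\subset H^+_\Pi$ is open and $Au^+=0$ in $D^+$, the function $u^-=\tilde T(u^+\circ T_\Pi)$ satisfies $Au^-=0$ in $T_\Pi(D^+)$, and the following hold. - (a) If $x\in\Pi$, $r>0$, $B_r(x)\cap H^+_\Pi\subset D^+$ and $B^iu^+=0$ on $B_r(x)\cap\Pi$, then $B^iu^-=0$ on $B_r(x)\cap\Pi$, and the function equal to $u^\pm$ in $B_r(x)\cap H^\pm_\Pi$ extends to a solution of $Au=0$ in $B_r(x)$. - (b) If $x\in\Pi$, $r>0$, $Au=0$ in $B_r(x)$ and $u=\tilde T(u\circ T_\Pi)$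 in $B_r(x)\cap H^-_\Pi$, then $B^iu=0$ on $B_r(x)\cap\Pi$, for both orientations of the normal. - (c$_1$) If $\Pi_1$ is a hyperplane with unit normal $\nu_1$, $x\in\Pi_1$, $r>0$, $B_r(x)\cap H^+_{\Pi_1}\subset D^+$, and $B^ju^+=0$ on $B_r(x)\cap\Pi_1$ from the side $H^+_{\Pi_1}$ for some $j\in\{1,\dots,n\}$, then $B^ju^-=0$ on $T_\Pi(B_r(x)\cap\Pi_1)$ from the side $T_\Pi(H^+_{\Pi_1})$. **Scatterer and boundary condition.** Let $\Sigma\subset\mathbb R^N$ be a polyhedral scatterer: a bounded closed set with connected complement $G=\mathbb R^N\setminus\Sigma$, whose boundary is the union of finitely many cells, a cell being the closure of an open subset of a hyperplane. Let $Au=0$ in $G$. Suppose that for every cell $C$, contained in a hyperplane $\Pi$, and every unit normal $\nu$ of $\Pi$ there is $i\in\{1,\dots,n\}$ such that $B^iu=0$, from the side $H^+_\Pi$, at every point $x$ of the interior of $C$ relative to $\Pi$ for which $B_r(x)\cap H^+_\Pi\subset G$ for some $r>0$. A point $x\in G$ is a *flat point* for $u$ if there are a hyperplane $\Pi\ni x$,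 an index $i$ and $r>0$ with $B_r(x)\subset G$ and $B^iu=0$ on $\Pi\cap B_r(x)$ (for some choice of the unit normal). A hyperplane $\Pi$ is a *reflection hyperplane* for $u$ if, for some $i$ and some $R>0$, $\Pi\setminus\overline{B_R(0)}\subset G$ and $B^iu=0$ on $\Pi\setminus\overline{B_R(0)}$ (for both choices of the unit normal). **Theorem.** 1. If $u$ admits a flat point $x\in G$, then there exists a reflection hyperplane for $u$. 2. Assume moreover that $\Sigma$ is a nonempty polyhedral obstacle, that is, $\Sigma\neq\emptyset$ coincides with the closure of its interior. Let $\Sigma'$ be a finite union of (closed, bounded, $N$-dimensional) polyhedra with $\Sigma'\setminus\Sigma\ne\emptyset$, and let $\tilde G$ be the unbounded connected component of $\mathbb R^N\setminus(\Sigma\cup\Sigma')$. If every $x\in\partial\tilde G\cap G$ is a flat point for $u$, then there exist $N$ reflection hyperplanes for $u$ whose normals $\nu_1,\dots,\nu_N$ are linearly independent. -/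

import Mathlib

open Set Filter Topology MeasureTheory
open scoped ContDiff

noncomputable section

namespace PolyScat

/-- Euclidean space `ℝ^N`. -/
abbrev Eu (N : ℕ) : Type := EuclideanSpace ℝ (Fin N)

/-! ### Hyperplanes, half-spaces, reflections

A hyperplane `Π` is given by one of its points `p` and a unit normal `ν`. -/

/-- The hyperplane through `p` orthogonal to `ν`. -/
def hyperplane {N : ℕ} (p ν : Eu N) : Set (Eu N) := {x | inner ℝ (x - p) ν = 0}

/-- The open half-space `H⁺` bounded by `hyperplane p ν` for which `ν` is the exterior normal.
The opposite half-space `H⁻` is `halfSpace p (-ν)`. -/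
def halfSpace {N : ℕ} (p ν : Eu N) : Set (Eu N) := {x | inner ℝ (x - p) ν < 0}

/-- The reflection in `hyperplane p ν`, for a unit vector `ν`. -/
def hrefl {N : ℕ} (p ν : Eu N) (x : Eu N) : Eu N := x - (2 * inner ℝ (x - p) ν) • ν

/-! ### Partial derivatives and operators with constant coefficients -/

/-- Iterated partial derivatives along the coordinate directions in a list. -/
def pderivList {N : ℕ} : List (Fin N) → (Eu N → ℂ) → Eu N → ℂ
  | [], f => f
  | i :: l, f => fun x => lineDeriv ℝ (pderivList l f) x (EuclideanSpace.single i (1 : ℝ))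

/-- All the successive partial derivatives along the list exist at every point of `D`. -/
def HasPderivList {N : ℕ} (D : Set (Eu N)) : List (Fin N) → (Eu N → ℂ) → Prop
  | [], _ => True
  | i :: l, f => HasPderivList D l f ∧
      ∀ x ∈ D, LineDifferentiableAt ℝ (pderivList l f) x (EuclideanSpace.single i (1 : ℝ))

/-- The coordinate directions of a multi-index `α`, each `i` repeated `α i` times. -/
def dirs {N : ℕ} (α : Fin N →₀ ℕ) : List (Fin N) :=
  (List.finRange N).flatMap fun i => List.replicate (α i) i

/-- The partial derivative `D^α f`. -/
def pderiv {N : ℕ} (α : Fin N →₀ ℕ) (f : Eu N → ℂ) : Eu N → ℂ := pderivList (dirs α) f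

/-- `D^α f` exists and is continuous in `D`. -/
def HasContPderiv {N : ℕ} (D : Set (Eu N)) (α : Fin N →₀ ℕ) (f : Eu N → ℂ) : Prop :=
  HasPderivList D (dirs α) f ∧ ContinuousOn (pderiv α f) D

/-- The scalar operator `∑ c_α D^α` with constant complex coefficients `c_α`. A polynomial is used
to record the finitely many coefficients; the multi-indices that appear are its support. -/
def diffOp {N : ℕ} (P : MvPolynomial (Fin N) ℂ) (f : Eu N → ℂ) (x : Eu N) : ℂ :=
  ∑ α ∈ P.support, P.coeff α * pderiv α f x

/-- The formal transpose `∑ (-1)^|α| c_α D^α` of `diffOp P`. -/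
def diffOpT {N : ℕ} (P : MvPolynomial (Fin N) ℂ) (φ : Eu N → ℂ) (x : Eu N) : ℂ :=
  ∑ α ∈ P.support, (-1 : ℂ) ^ α.degree * P.coeff α * pderiv α φ x

/-- A system `A = (A_1, …, A_L)` acting on `ℂ^M`-valued functions:
`A_k u = ∑_j A k j (D) u^j`. -/
abbrev DiffSystem (N M L : ℕ) : Type := Fin L → Fin M → MvPolynomial (Fin N) ℂ

/-- `A u = 0` in the open set `D`: `u` is continuous in `D` and each equation `A_k u = 0` holds in
the sense of distributions in `D`. The values of `u` outside `D` play no role. -/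
def IsSol {N M L : ℕ} (A : DiffSystem N M L) (D : Set (Eu N)) (u : Eu N → Fin M → ℂ) : Prop :=
  ContinuousOn u D ∧
    ∀ (k : Fin L) (φ : Eu N → ℂ), ContDiff ℝ ∞ φ → HasCompactSupport φ → tsupport φ ⊆ D →
      ∫ x, ∑ j, u x j * diffOpT (A k j) φ x = 0

/-- A boundary operator `B = (B_1, …, B_{L₁})`, with
`B_k u = ∑_i ∑_j ν_i (lin k i j)(D) u^j + ∑_j (const k j)(D) u^j`. -/
structure BdryOp (N M L₁ : ℕ) where
  /-- coefficients multiplied by the components of the normal -/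
  lin : Fin L₁ → Fin N → Fin M → MvPolynomial (Fin N) ℂ
  /-- coefficients that do not involve the normal -/
  const : Fin L₁ → Fin M → MvPolynomial (Fin N) ℂ

/-- The value at `x` of the component `B_k u`, for the normal `ν`. -/
def BdryOp.eval {N M L₁ : ℕ} (B : BdryOp N M L₁) (ν : Eu N) (u : Eu N → Fin M → ℂ)
    (k : Fin L₁) (x : Eu N) : ℂ :=
  (∑ i, ∑ j, ((ν i : ℝ) : ℂ) * diffOp (B.lin k i j) (fun y => u y j) x) +
    ∑ j, diffOp (B.const k j) (fun y => u y j) x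

/-- `B u = 0` at `x` for the normal `ν`, where `u` is a solution around `x`. -/
def BdryOp.ZeroAt {N M L₁ : ℕ} (B : BdryOp N M L₁) (ν : Eu N) (u : Eu N → Fin M → ℂ)
    (x : Eu N) : Prop :=
  ∀ k, B.eval ν u k x = 0

/-- `B u = 0` at the point `x` of a hyperplane with normal `ν`, where `u` is a solution on the side
of the hyperplane that has `ν` as exterior normal: `B u`, computed with the exterior normal `ν`,
has boundary value `0` at `x` from that side. -/
def BdryOp.ZeroFrom {N M L₁ : ℕ} (B : BdryOp N M L₁) (ν : Eu N) (u : Eu N → Fin M → ℂ)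
    (x : Eu N) : Prop :=
  ∀ k, Tendsto (B.eval ν u k) (𝓝[halfSpace x ν] x) (𝓝 0)

/-! ### The standing assumption -/

/-- `T` is a reflection operator for the boundary condition `B i`, the hyperplane through `p` and
its unit normal `ν`. Operators act on functions defined on open sets, compatibly with restriction;
as functions are total here, this is the field `loc`. For `u` on an open subset of `H⁺` the
reflected function is `u⁻ = T (u ∘ hrefl p ν)`. -/
structure IsReflOp {N M L L₁ n : ℕ} (A : DiffSystem N M L) (B : Fin n → BdryOp N M L₁)
    (i : Fin n) (p ν : Eu N) (T : (Eu N → Fin M → ℂ) → (Eu N → Fin M → ℂ)) : Prop where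
  loc : ∀ (U : Set (Eu N)), IsOpen U → ∀ v w : Eu N → Fin M → ℂ,
    EqOn v w U → EqOn (T v) (T w) U
  sol : ∀ (D : Set (Eu N)), IsOpen D → D ⊆ halfSpace p ν → ∀ u : Eu N → Fin M → ℂ, IsSol A D u →
    IsSol A (hrefl p ν '' D) (T (u ∘ hrefl p ν))
  /-- if `B i u⁺ = 0` on a piece of the hyperplane, then `B i u⁻ = 0` there, and `u⁺`, `u⁻`
  together form a solution across it -/
  extend : ∀ (D : Set (Eu N)), IsOpen D → D ⊆ halfSpace p ν → ∀ u : Eu N → Fin M → ℂ, IsSol A D u →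
    ∀ x ∈ hyperplane p ν, ∀ r > 0, Metric.ball x r ∩ halfSpace p ν ⊆ D →
      (∀ y ∈ Metric.ball x r ∩ hyperplane p ν, (B i).ZeroFrom ν u y) →
      (∀ y ∈ Metric.ball x r ∩ hyperplane p ν, (B i).ZeroFrom (-ν) (T (u ∘ hrefl p ν)) y) ∧
      ∃ w : Eu N → Fin M → ℂ, IsSol A (Metric.ball x r) w ∧
        EqOn w u (Metric.ball x r ∩ halfSpace p ν) ∧
        EqOn w (T (u ∘ hrefl p ν)) (Metric.ball x r ∩ halfSpace p (-ν))
  /-- a solution that is symmetric across the hyperplane satisfies `B i u = 0` on it, for either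
  orientation of the normal -/
  zero : ∀ x ∈ hyperplane p ν, ∀ r > 0, ∀ u : Eu N → Fin M → ℂ, IsSol A (Metric.ball x r) u →
    EqOn u (T (u ∘ hrefl p ν)) (Metric.ball x r ∩ halfSpace p (-ν)) →
    ∀ y ∈ Metric.ball x r ∩ hyperplane p ν, (B i).ZeroAt ν u y ∧ (B i).ZeroAt (-ν) u y
  /-- every boundary condition `B j u⁺ = 0` on a piece of any hyperplane `Π₁` is carried over to
  `u⁻` on the reflected piece; `hrefl 0 ν ν₁` is the reflected normal -/
  carry : ∀ (D : Set (Eu N)), IsOpen D → D ⊆ halfSpace p ν → ∀ u : Eu N → Fin M → ℂ, IsSol A D u →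
    ∀ x ν₁ : Eu N, ‖ν₁‖ = 1 → ∀ r > 0, Metric.ball x r ∩ halfSpace x ν₁ ⊆ D → ∀ j : Fin n,
      (∀ y ∈ Metric.ball x r ∩ hyperplane x ν₁, (B j).ZeroFrom ν₁ u y) →
      ∀ y ∈ Metric.ball x r ∩ hyperplane x ν₁,
        (B j).ZeroFrom (hrefl 0 ν ν₁) (T (u ∘ hrefl p ν)) (hrefl p ν y)

/-- The standing assumption on the system `A` and the boundary conditions `B 1, …, B n`:
regularity, unique continuation, and a reflection principle for each boundary condition. -/
structure Admissible {N M L L₁ n : ℕ} (A : DiffSystem N M L) (B : Fin n → BdryOp N M L₁) :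
    Prop where
  /-- all partial derivatives that appear in `A` and in the `B i` are continuous -/
  regular : ∀ (D : Set (Eu N)), IsOpen D → ∀ u : Eu N → Fin M → ℂ, IsSol A D u →
    (∀ k j, ∀ α ∈ (A k j).support, HasContPderiv D α fun y => u y j) ∧
    (∀ i k l j, ∀ α ∈ ((B i).lin k l j).support, HasContPderiv D α fun y => u y j) ∧
    (∀ i k j, ∀ α ∈ ((B i).const k j).support, HasContPderiv D α fun y => u y j)
  /-- unique continuation -/
  unique : ∀ (D : Set (Eu N)), IsOpen D → IsConnected D → ∀ u : Eu N → Fin M → ℂ, IsSol A D u →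
    ∀ D' ⊆ D, IsOpen D' → D'.Nonempty → (∀ x ∈ D', u x = 0) → ∀ x ∈ D, u x = 0
  reflection : ∀ (i : Fin n) (p ν : Eu N), ‖ν‖ = 1 → ∃ T, IsReflOp A B i p ν T

/-! ### Scatterers, cells, polyhedra -/

/-- A scatterer: a bounded closed set with connected complement. -/
structure IsScatterer {N : ℕ} (S : Set (Eu N)) : Prop where
  bounded : Bornology.IsBounded S
  closed : IsClosed S
  connected : IsConnected Sᶜ

/-- A scatterer that is the closure of its interior. -/
def IsObstacle {N : ℕ} (S : Set (Eu N)) : Prop := IsScatterer S ∧ S = closure (interior S)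

/-- A cell: the closure of an open subset `V ∩ Π` of a hyperplane `Π`. -/
structure Cell (N : ℕ) where
  /-- a point of the hyperplane -/
  point : Eu N
  /-- a unit normal of the hyperplane -/
  normal : Eu N
  norm_normal : ‖normal‖ = 1
  /-- an open set of the space whose trace on the hyperplane is the open subset -/
  V : Set (Eu N)
  isOpen_V : IsOpen V

/-- The hyperplane of a cell. -/
def Cell.plane {N : ℕ} (C : Cell N) : Set (Eu N) := hyperplane C.point C.normal

/-- The cell as a set of points. -/
def Cell.carrier {N : ℕ} (C : Cell N) : Set (Eu N) := closure (C.V ∩ C.plane)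

/-- The interior of a cell relative to its hyperplane. -/
def Cell.relInterior {N : ℕ} (C : Cell N) : Set (Eu N) :=
  {x ∈ C.plane | ∃ ρ > 0, Metric.ball x ρ ∩ C.plane ⊆ C.carrier}

/-- The finite family of cells `C` decomposes the boundary of `S`. -/
def IsBoundaryDecomposition {N m : ℕ} (S : Set (Eu N)) (C : Fin m → Cell N) : Prop :=
  frontier S = ⋃ a, (C a).carrier

/-- The mixed boundary condition for `u`, on the flat parts of the boundary of `S` that are given
by the cells `C`: to each cell, and each orientation `ν` of its normal, there belongs an `i` such
that `B i u = 0` at each point of the interior of the cell that is reached from the exterior `Sᶜ` on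
the side which has `ν` as exterior normal. -/
def MixedBC {N M L₁ n m : ℕ} (B : Fin n → BdryOp N M L₁) (S : Set (Eu N)) (C : Fin m → Cell N)
    (u : Eu N → Fin M → ℂ) : Prop :=
  ∀ (a : Fin m) (ν : Eu N), (ν = (C a).normal ∨ ν = -(C a).normal) →
    ∃ i : Fin n, ∀ x ∈ (C a).relInterior,
      (∃ r > 0, Metric.ball x r ∩ halfSpace x ν ⊆ Sᶜ) → (B i).ZeroFrom ν u x

/-- `S` is a finite union of (bounded, closed, `N`-dimensional) polyhedra. Any such polyhedron is a
finite union of convex ones, so convex ones suffice. -/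
def IsFiniteUnionOfPolyhedra {N : ℕ} (S : Set (Eu N)) : Prop :=
  ∃ (m : ℕ) (F : Fin m → Finset (Eu N)),
    (∀ a, (interior (convexHull ℝ (F a : Set (Eu N)))).Nonempty) ∧
    S = ⋃ a, convexHull ℝ (F a : Set (Eu N))

/-- `U` is an unbounded connected component of `W`. -/
def IsUnboundedComponent {N : ℕ} (W U : Set (Eu N)) : Prop :=
  (∃ x ∈ W, U = connectedComponentIn W x) ∧ ¬ Bornology.IsBounded U

/-! ### Flat points and reflection hyperplanes -/

/-- `x ∈ G` is a flat point for `u`: some `B i u` vanishes on a hyperplane through `x`, near `x`. -/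
def IsFlatPoint {N M L₁ n : ℕ} (B : Fin n → BdryOp N M L₁) (G : Set (Eu N))
    (u : Eu N → Fin M → ℂ) (x : Eu N) : Prop :=
  x ∈ G ∧ ∃ (ν : Eu N) (i : Fin n), ‖ν‖ = 1 ∧ ∃ r > 0, Metric.ball x r ⊆ G ∧
    ∀ y ∈ Metric.ball x r ∩ hyperplane x ν, (B i).ZeroAt ν u y

/-- The hyperplane through `p` with unit normal `ν` is a reflection hyperplane for the solution `u`
in `G`: some `B i u` vanishes, for either orientation of the normal, on the part of the hyperplane
outside a ball; this part lies in `G`. -/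
def IsReflectionHyperplane {N M L₁ n : ℕ} (B : Fin n → BdryOp N M L₁) (G : Set (Eu N))
    (u : Eu N → Fin M → ℂ) (p ν : Eu N) : Prop :=
  ‖ν‖ = 1 ∧ ∃ (i : Fin n), ∃ R > 0, ∀ y ∈ hyperplane p ν \ Metric.closedBall 0 R,
    y ∈ G ∧ (B i).ZeroAt ν u y ∧ (B i).ZeroAt (-ν) u y

end PolyScat

end

open PolyScat

/-!
The proof follows solutions along reflections. Let `G = Sᶜ`, let `x ∈ G` be a flat point with flat
hyperplane `Π`, and let `E` be the component, adjacent to `x`, of the points on one side of `Π` that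
lie in `G` together with their mirror images (`IsMirrorDomain`). By the reflection principle and
unique continuation, `u` is symmetric in the hull formed by `E`, its mirror image and the part of
`Π` between them (`exists_isReflOp_eqOn`). Hence the boundary condition holds on all of this part of
`Π`, and `Π` is a reflection hyperplane as soon as `E` is unbounded
(`isReflectionHyperplane_of_not_subset`). Moreover, the boundary points of the hull in `G` are
mirror images of points of `∂S`, and those that come from regular points of a cell are again flat
(`exists_flatAt_of_mem_frontier`). The irregular points form a finite union of closed sets, each
nowhere dense in a hyperplane, and such a union does not separate connected open sets
(`isPreconnected_diff_iUnion`).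

For the first part, follow a path in `G` from a flat point to a point far away, and consider the last
place on it near which there are flat points. If no reflection hyperplane existed, the hull at such
a flat point would be bounded, by a bound that depends only on `S`; it contains a ball of fixed size,
and the rest of the path leaves it, near a flat point further on
(`exists_isReflectionHyperplane`). The argument works in every unbounded connected open subset
of `G`.

For the second part, suppose that the normals do not span, so that all reflection hyperplanes are
parallel to some unit vector `e`. Then a flat hyperplane at a point from which a ray in direction `e`
escapes to infinity is a reflection hyperplane, because a generic ray leaves a bounded hull through
a face transversal to `e` (`FlatAt.isReflectionHyperplane_of_ray`). Applied to mirror images of the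
highest points of `S` in direction `e`, this shows that the shadow of `S` along `e` is symmetric in
every reflection hyperplane (`exists_hrefl_add_smul_mem`). As `S` is locally a cone, the shadow has
finitely many extreme points; the reflections permute them, so there are only finitely many
reflection hyperplanes (`finite_hyperplanes`). They are permuted by each of the reflections
(`hrefl_mem_reflUnion`). Remove them from `G`: the unbounded components that remain contain no flat
points, by the first part, so each of them is contained in the closure of every hull that comes from
a reflection hyperplane. Their union, `outerRegion`, is thus symmetric, and, as it can be continued
across the hyperplanes, it is dense in `G` (`compl_subset_closure_outerRegion`). Having no flat
points it lies in the unbounded component of the complement of `S ∪ S'`, which contradicts that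
`S' \ S` has interior points.
-/

namespace PolyScat

variable {N : ℕ}

/-! ### Reflections and half-spaces -/

lemma hrefl_eq (p ν x : Eu N) : hrefl p ν x = x - (2 * inner ℝ (x - p) ν) • ν := rfl

lemma mem_hyperplane {p ν x : Eu N} : x ∈ hyperplane p ν ↔ inner ℝ (x - p) ν = 0 := Iff.rfl

lemma mem_halfSpace {p ν x : Eu N} : x ∈ halfSpace p ν ↔ inner ℝ (x - p) ν < 0 := Iff.rfl

lemma mem_halfSpace_neg {p ν x : Eu N} : x ∈ halfSpace p (-ν) ↔ 0 < inner ℝ (x - p) ν := by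
  rw [mem_halfSpace, inner_neg_right, neg_lt_zero]

lemma self_mem_hyperplane (p ν : Eu N) : p ∈ hyperplane p ν := by
  simp [mem_hyperplane]

lemma hyperplane_neg (p ν : Eu N) : hyperplane p (-ν) = hyperplane p ν := by
  ext x; simp [mem_hyperplane]

lemma inner_sub_eq_of_mem {p ν q : Eu N} (hq : q ∈ hyperplane p ν) (x : Eu N) :
    (inner ℝ (x - q) ν : ℝ) = inner ℝ (x - p) ν := by
  have h : (inner ℝ (q - p) ν : ℝ) = 0 := hq
  rw [← sub_add_sub_cancel x q p, inner_add_left, h, add_zero]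

lemma hyperplane_eq_of_mem {p ν q : Eu N} (hq : q ∈ hyperplane p ν) :
    hyperplane q ν = hyperplane p ν := by
  ext x; rw [mem_hyperplane, mem_hyperplane, inner_sub_eq_of_mem hq]

lemma halfSpace_eq_of_mem {p ν q : Eu N} (hq : q ∈ hyperplane p ν) :
    halfSpace q ν = halfSpace p ν := by
  ext x; rw [mem_halfSpace, mem_halfSpace, inner_sub_eq_of_mem hq]

lemma hrefl_eq_of_mem {p ν q : Eu N} (hq : q ∈ hyperplane p ν) : hrefl q ν = hrefl p ν := by
  funext x; rw [hrefl_eq, hrefl_eq, inner_sub_eq_of_mem hq]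

lemma hrefl_neg (p ν : Eu N) : hrefl p (-ν) = hrefl p ν := by
  funext x; simp [hrefl_eq]

lemma hrefl_of_mem {p ν x : Eu N} (hx : x ∈ hyperplane p ν) : hrefl p ν x = x := by
  have h : (inner ℝ (x - p) ν : ℝ) = 0 := hx
  simp [hrefl_eq, h]

lemma hrefl_self (p ν : Eu N) : hrefl p ν p = p := hrefl_of_mem (self_mem_hyperplane p ν)

lemma hrefl_sub_hrefl (p ν x y : Eu N) : hrefl p ν x - hrefl p ν y = hrefl 0 ν (x - y) := by
  simp only [hrefl_eq, sub_zero, inner_sub_left]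
  module

lemma hrefl_zero_smul (ν v : Eu N) (t : ℝ) : hrefl 0 ν (t • v) = t • hrefl 0 ν v := by
  simp only [hrefl_eq, sub_zero, inner_smul_left]
  simp only [conj_trivial]
  module

lemma hrefl_zero_neg (ν v : Eu N) : hrefl 0 ν (-v) = -hrefl 0 ν v := by
  have := hrefl_zero_smul ν v (-1)
  simpa using this

lemma hrefl_add (p ν x v : Eu N) : hrefl p ν (x + v) = hrefl p ν x + hrefl 0 ν v := by
  have := hrefl_sub_hrefl p ν (x + v) x
  rw [add_sub_cancel_left] at this
  rw [← this]; abel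

lemma hrefl_zero_of_inner_eq_zero {ν v : Eu N} (h : (inner ℝ v ν : ℝ) = 0) : hrefl 0 ν v = v := by
  simp [hrefl_eq, h]

@[fun_prop]
lemma continuous_hrefl (p ν : Eu N) : Continuous (hrefl p ν) := by
  unfold hrefl; fun_prop

section Unit

variable {p ν : Eu N} (hν : ‖ν‖ = 1)
include hν

lemma inner_hrefl_sub (x : Eu N) :
    (inner ℝ (hrefl p ν x - p) ν : ℝ) = -inner ℝ (x - p) ν := by
  have h : (inner ℝ ν ν : ℝ) = 1 := by rw [real_inner_self_eq_norm_sq, hν]; norm_num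
  rw [hrefl_eq, sub_right_comm, inner_sub_left, inner_smul_left, h]
  simp only [conj_trivial]; ring

lemma hrefl_hrefl (x : Eu N) : hrefl p ν (hrefl p ν x) = x := by
  rw [hrefl_eq p ν (hrefl p ν x), inner_hrefl_sub hν, hrefl_eq]
  module

lemma hrefl_image (D : Set (Eu N)) : hrefl p ν '' D = hrefl p ν ⁻¹' D := by
  ext x
  exact ⟨fun ⟨y, hy, h⟩ => by rwa [mem_preimage, ← h, hrefl_hrefl hν],
    fun hx => ⟨_, hx, hrefl_hrefl hν x⟩⟩

lemma inner_hrefl_zero (v w : Eu N) :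
    (inner ℝ (hrefl 0 ν v) (hrefl 0 ν w) : ℝ) = inner ℝ v w := by
  have h : (inner ℝ ν ν : ℝ) = 1 := by rw [real_inner_self_eq_norm_sq, hν]; norm_num
  simp only [hrefl_eq, sub_zero, inner_sub_left, inner_sub_right, inner_smul_left,
    inner_smul_right, h, conj_trivial]
  rw [real_inner_comm w ν]
  ring

lemma norm_hrefl_zero (v : Eu N) : ‖hrefl 0 ν v‖ = ‖v‖ := by
  rw [@norm_eq_sqrt_real_inner (Eu N), @norm_eq_sqrt_real_inner (Eu N), inner_hrefl_zero hν]

lemma dist_hrefl (x y : Eu N) : dist (hrefl p ν x) (hrefl p ν y) = dist x y := by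
  rw [dist_eq_norm, dist_eq_norm, hrefl_sub_hrefl, norm_hrefl_zero hν]

lemma hrefl_mem_ball {x z : Eu N} {r : ℝ} :
    hrefl p ν z ∈ Metric.ball (hrefl p ν x) r ↔ z ∈ Metric.ball x r := by
  rw [Metric.mem_ball, Metric.mem_ball, dist_hrefl hν]

lemma hrefl_mem_halfSpace {x : Eu N} : hrefl p ν x ∈ halfSpace p ν ↔ x ∈ halfSpace p (-ν) := by
  rw [mem_halfSpace, mem_halfSpace_neg, inner_hrefl_sub hν, neg_lt_zero]

lemma hrefl_mem_halfSpace_neg {x : Eu N} :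
    hrefl p ν x ∈ halfSpace p (-ν) ↔ x ∈ halfSpace p ν := by
  rw [mem_halfSpace_neg, mem_halfSpace, inner_hrefl_sub hν, neg_pos]

lemma hrefl_mem_hyperplane {x : Eu N} : hrefl p ν x ∈ hyperplane p ν ↔ x ∈ hyperplane p ν := by
  rw [mem_hyperplane, mem_hyperplane, inner_hrefl_sub hν, neg_eq_zero]

lemma hrefl_mem_hyperplane_hrefl {x z σ : Eu N} :
    hrefl p ν z ∈ hyperplane (hrefl p ν x) (hrefl 0 ν σ) ↔ z ∈ hyperplane x σ := by
  rw [mem_hyperplane, mem_hyperplane, hrefl_sub_hrefl, inner_hrefl_zero hν]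

lemma hrefl_mem_halfSpace_hrefl {x z σ : Eu N} :
    hrefl p ν z ∈ halfSpace (hrefl p ν x) (hrefl 0 ν σ) ↔ z ∈ halfSpace x σ := by
  rw [mem_halfSpace, mem_halfSpace, hrefl_sub_hrefl, inner_hrefl_zero hν]

/-- The reflection as a homeomorphism. -/
noncomputable def hreflHomeo : Eu N ≃ₜ Eu N where
  toFun := hrefl p ν
  invFun := hrefl p ν
  left_inv := hrefl_hrefl hν
  right_inv := hrefl_hrefl hν
  continuous_toFun := continuous_hrefl p ν
  continuous_invFun := continuous_hrefl p ν

lemma hrefl_preimage_closure (D : Set (Eu N)) :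
    hrefl p ν ⁻¹' closure D = closure (hrefl p ν ⁻¹' D) :=
  (hreflHomeo hν).preimage_closure D

lemma hrefl_preimage_frontier (D : Set (Eu N)) :
    hrefl p ν ⁻¹' frontier D = frontier (hrefl p ν ⁻¹' D) :=
  (hreflHomeo hν).preimage_frontier D

lemma isPreconnected_hrefl_preimage {D : Set (Eu N)} (hD : IsPreconnected D) :
    IsPreconnected (hrefl p ν ⁻¹' D) := by
  rw [← hrefl_image hν]; exact hD.image _ (continuous_hrefl p ν).continuousOn

end Unit

lemma isOpen_halfSpace (p ν : Eu N) : IsOpen (halfSpace p ν) :=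
  isOpen_lt (by fun_prop) continuous_const

lemma isClosed_hyperplane (p ν : Eu N) : IsClosed (hyperplane p ν) :=
  isClosed_eq (by fun_prop) continuous_const

lemma convex_halfSpace (p ν : Eu N) : Convex ℝ (halfSpace p ν) := by
  intro x hx y hy a b ha hb hab
  rw [mem_halfSpace] at *
  have h : a • x + b • y - p = a • (x - p) + b • (y - p) := by
    have : p = (a + b) • p := by rw [hab, one_smul]
    nth_rewrite 1 [this]
    module
  rw [h, inner_add_left, inner_smul_left, inner_smul_left]
  simp only [conj_trivial]
  rcases ha.eq_or_lt with rfl | ha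
  · have : b = 1 := by linarith
    subst this; linarith
  · nlinarith [mul_pos_of_neg_of_neg hx (neg_lt_zero.mpr ha), mul_nonneg hb (neg_nonneg.mpr hy.le)]

lemma mem_trichotomy (p ν x : Eu N) :
    x ∈ halfSpace p ν ∨ x ∈ hyperplane p ν ∨ x ∈ halfSpace p (-ν) := by
  rw [mem_halfSpace_neg]; exact lt_trichotomy (inner ℝ (x - p) ν : ℝ) 0

/-- Points of a hyperplane are limits of points of either of its half-spaces. -/
lemma mem_closure_inter_halfSpace {p ν x : Eu N} (hν : ‖ν‖ = 1) (hx : x ∈ hyperplane p ν)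
    {U : Set (Eu N)} (hU : IsOpen U) (hxU : x ∈ U) : x ∈ closure (U ∩ halfSpace p ν) := by
  have h1 : (inner ℝ ν ν : ℝ) = 1 := by rw [real_inner_self_eq_norm_sq, hν]; norm_num
  have hx' : (inner ℝ (x - p) ν : ℝ) = 0 := hx
  have hc : Tendsto (fun t : ℝ => x - t • ν) (𝓝[>] 0) (𝓝 x) := by
    have : Continuous fun t : ℝ => x - t • ν := by fun_prop
    have := this.tendsto 0
    simp only [zero_smul, sub_zero] at this
    exact this.mono_left nhdsWithin_le_nhds
  refine mem_closure_of_tendsto hc ?_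
  filter_upwards [hc (hU.mem_nhds hxU), self_mem_nhdsWithin] with t ht1 ht2
  refine ⟨ht1, ?_⟩
  rw [mem_halfSpace, sub_right_comm, inner_sub_left, hx', inner_smul_left, h1]
  simpa using ht2

lemma closure_halfSpace_subset {p ν x : Eu N} (hx : x ∈ closure (halfSpace p ν)) :
    x ∈ halfSpace p ν ∨ x ∈ hyperplane p ν := by
  have hcl : IsClosed {x : Eu N | (inner ℝ (x - p) ν : ℝ) ≤ 0} :=
    isClosed_le (by fun_prop) continuous_const
  have hsub : halfSpace p ν ⊆ {x : Eu N | (inner ℝ (x - p) ν : ℝ) ≤ 0} := fun y hy =>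
    (mem_halfSpace.1 hy).le
  have : (inner ℝ (x - p) ν : ℝ) ≤ 0 := closure_minimal hsub hcl hx
  exact lt_or_eq_of_le this

lemma nhdsWithin_halfSpace_neBot {ν : Eu N} (hν : ‖ν‖ = 1) (x : Eu N) :
    (𝓝[halfSpace x ν] x).NeBot := by
  rw [← mem_closure_iff_nhdsWithin_neBot]
  have := mem_closure_inter_halfSpace hν (self_mem_hyperplane x ν) isOpen_univ (mem_univ x)
  rwa [univ_inter] at this

end PolyScat

namespace PolyScat

variable {N M L L₁ n : ℕ}

/-! ### Locality and continuity of the differential operators -/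

lemma pderivList_congr {l : List (Fin N)} {f g : Eu N → ℂ} {x : Eu N} (h : f =ᶠ[𝓝 x] g) :
    pderivList l f =ᶠ[𝓝 x] pderivList l g := by
  induction l with
  | nil => exact h
  | cons i l ih =>
    filter_upwards [ih.eventuallyEq_nhds] with y hy
    exact hy.lineDeriv_eq

lemma diffOp_congr {P : MvPolynomial (Fin N) ℂ} {f g : Eu N → ℂ} {x : Eu N} (h : f =ᶠ[𝓝 x] g) :
    diffOp P f x = diffOp P g x :=
  Finset.sum_congr rfl fun α _ => by
    rw [pderiv, pderiv, (pderivList_congr h).eq_of_nhds]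

lemma BdryOp.eval_congr (B : BdryOp N M L₁) (ν : Eu N) {u v : Eu N → Fin M → ℂ} {U : Set (Eu N)}
    (hU : IsOpen U) (h : EqOn u v U) (k : Fin L₁) {x : Eu N} (hx : x ∈ U) :
    B.eval ν u k x = B.eval ν v k x := by
  have hj : ∀ j, (fun y => u y j) =ᶠ[𝓝 x] fun y => v y j := fun j => by
    filter_upwards [hU.mem_nhds hx] with y hy
    rw [h hy]
  unfold BdryOp.eval
  simp only [diffOp_congr (hj _)]

lemma continuousOn_diffOp {D : Set (Eu N)} {P : MvPolynomial (Fin N) ℂ} {f : Eu N → ℂ}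
    (h : ∀ α ∈ P.support, HasContPderiv D α f) : ContinuousOn (diffOp P f) D :=
  continuousOn_finsetSum _ fun α hα => continuousOn_const.mul (h α hα).2

section Solutions

variable {A : DiffSystem N M L} {B : Fin n → BdryOp N M L₁}

lemma Admissible.continuousOn_eval (hAB : Admissible A B) {D : Set (Eu N)} (hD : IsOpen D)
    {u : Eu N → Fin M → ℂ} (hu : IsSol A D u) (i : Fin n) (ν : Eu N) (k : Fin L₁) :
    ContinuousOn ((B i).eval ν u k) D := by
  obtain ⟨-, h1, h2⟩ := hAB.regular D hD u hu
  refine ContinuousOn.add ?_ ?_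
  · exact continuousOn_finsetSum _ fun l _ => continuousOn_finsetSum _ fun j _ =>
      continuousOn_const.mul (continuousOn_diffOp (h1 i k l j))
  · exact continuousOn_finsetSum _ fun j _ => continuousOn_diffOp (h2 i k j)

lemma Admissible.zeroFrom_of_zeroAt (hAB : Admissible A B) {D : Set (Eu N)} (hD : IsOpen D)
    {u : Eu N → Fin M → ℂ} (hu : IsSol A D u) {i : Fin n} {ν x : Eu N} (hx : x ∈ D)
    (h : (B i).ZeroAt ν u x) : (B i).ZeroFrom ν u x := fun k => by
  have := (hAB.continuousOn_eval hD hu i ν k).continuousAt (hD.mem_nhds hx)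
  rw [← h k]
  exact this.tendsto.mono_left nhdsWithin_le_nhds

/-- At an interior point a one-sided boundary condition is a pointwise one. Only the values on the
side from which the limit is taken matter, so they may be those of another function `v`. -/
lemma Admissible.zeroAt_of_zeroFrom (hAB : Admissible A B) {D : Set (Eu N)} (hD : IsOpen D)
    {u v : Eu N → Fin M → ℂ} (hu : IsSol A D u) {i : Fin n} {ν x : Eu N} (hν : ‖ν‖ = 1)
    (hx : x ∈ D) {U : Set (Eu N)} (hU : IsOpen U) {r : ℝ} (hr : 0 < r)
    (hrU : Metric.ball x r ∩ halfSpace x ν ⊆ U) (hv : EqOn v u U)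
    (h : (B i).ZeroFrom ν v x) : (B i).ZeroAt ν u x := fun k => by
  have := nhdsWithin_halfSpace_neBot hν x
  have h1 := ((hAB.continuousOn_eval hD hu i ν k).continuousAt (hD.mem_nhds hx)).tendsto.mono_left
    (nhdsWithin_le_nhds (s := halfSpace x ν))
  refine tendsto_nhds_unique (h1.congr' ?_) (h k)
  filter_upwards [self_mem_nhdsWithin, mem_nhdsWithin_of_mem_nhds (Metric.ball_mem_nhds x hr)]
    with y hy1 hy2
  exact ((B i).eval_congr ν hU hv k (hrU ⟨hy2, hy1⟩)).symm

/-! ### Solutions: restriction, differences, unique continuation -/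

lemma IsSol.mono {D D' : Set (Eu N)} {u : Eu N → Fin M → ℂ} (hu : IsSol A D u) (h : D' ⊆ D) :
    IsSol A D' u :=
  ⟨hu.1.mono h, fun k φ h1 h2 h3 => hu.2 k φ h1 h2 (h3.trans h)⟩

lemma contDiff_pderivList {φ : Eu N → ℂ} (hφ : ContDiff ℝ ∞ φ) (l : List (Fin N)) :
    ContDiff ℝ ∞ (pderivList l φ) := by
  induction l with
  | nil => exact hφ
  | cons i l ih =>
    have : pderivList (i :: l) φ =
        fun x => fderiv ℝ (pderivList l φ) x (EuclideanSpace.single i (1 : ℝ)) := by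
      funext x
      exact ((ih.differentiable (by simp)) x).lineDeriv_eq_fderiv
    rw [this]
    exact (ih.fderiv_right (m := ∞) (by simp)).clm_apply contDiff_const

lemma continuous_diffOpT {φ : Eu N → ℂ} (hφ : ContDiff ℝ ∞ φ) (P : MvPolynomial (Fin N) ℂ) :
    Continuous (diffOpT P φ) :=
  continuous_finsetSum _ fun _ _ => continuous_const.mul (contDiff_pderivList hφ _).continuous

lemma diffOpT_eq_zero {φ : Eu N → ℂ} {x : Eu N} (hx : x ∉ tsupport φ)
    (P : MvPolynomial (Fin N) ℂ) : diffOpT P φ x = 0 := by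
  have h : φ =ᶠ[𝓝 x] fun _ => 0 := notMem_tsupport_iff_eventuallyEq.1 hx
  have h0 : ∀ l : List (Fin N), pderivList l (fun _ : Eu N => (0 : ℂ)) = fun _ => 0 := by
    intro l
    induction l with
    | nil => rfl
    | cons i l ih =>
      funext y
      simp only [pderivList, ih]
      simp [lineDeriv]
  refine Finset.sum_eq_zero fun α _ => ?_
  rw [pderiv, (pderivList_congr h).eq_of_nhds, h0, mul_zero]

lemma integrable_pairing {D : Set (Eu N)} {u : Eu N → Fin M → ℂ} (hu : ContinuousOn u D)
    {φ : Eu N → ℂ} (hφ : ContDiff ℝ ∞ φ) (hc : HasCompactSupport φ) (hs : tsupport φ ⊆ D)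
    (P : Fin M → MvPolynomial (Fin N) ℂ) :
    Integrable (fun x => ∑ j, u x j * diffOpT (P j) φ x) := by
  refine integrable_finsetSum _ fun j _ => ?_
  have h1 : IntegrableOn (fun x => u x j * diffOpT (P j) φ x) (tsupport φ) :=
    ContinuousOn.integrableOn_compact hc
      ((((continuous_apply j).comp_continuousOn hu).mono hs).mul
        (continuous_diffOpT hφ _).continuousOn)
  refine (integrableOn_iff_integrable_of_support_subset fun x hx => ?_).1 h1
  by_contra hx'
  exact hx (by simp [diffOpT_eq_zero hx'])

lemma IsSol.sub {D : Set (Eu N)} {u v : Eu N → Fin M → ℂ} (hu : IsSol A D u) (hv : IsSol A D v) :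
    IsSol A D (fun x => u x - v x) := by
  refine ⟨hu.1.sub hv.1, fun k φ h1 h2 h3 => ?_⟩
  have := integral_sub (integrable_pairing hu.1 h1 h2 h3 (A k))
    (integrable_pairing hv.1 h1 h2 h3 (A k))
  rw [hu.2 k φ h1 h2 h3, hv.2 k φ h1 h2 h3, sub_zero] at this
  rw [← this]
  congr 1
  funext x
  rw [← Finset.sum_sub_distrib]
  refine Finset.sum_congr rfl fun j _ => ?_
  rw [← sub_mul]
  rfl

lemma Admissible.eqOn_of_eqOn (hAB : Admissible A B) {D D' : Set (Eu N)} (hD : IsOpen D)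
    (hDc : IsPreconnected D) {u v : Eu N → Fin M → ℂ} (hu : IsSol A D u) (hv : IsSol A D v)
    (hsub : D' ⊆ D) (hD' : IsOpen D') (hne : D'.Nonempty) (h : EqOn u v D') : EqOn u v D := by
  intro x hx
  have := hAB.unique D hD ⟨hne.mono hsub, hDc⟩ _ (hu.sub hv) D' hsub hD' hne
    (fun y hy => sub_eq_zero.2 (h hy)) x hx
  exact sub_eq_zero.1 this

end Solutions

end PolyScat

namespace PolyScat

variable {N : ℕ}

/-! ### Thin subsets of hyperplanes -/

/-- `K` is a closed subset of the hyperplane through `p` with unit normal `ν`, nowhere dense in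
that hyperplane. -/
structure IsThin (p ν : Eu N) (K : Set (Eu N)) : Prop where
  norm : ‖ν‖ = 1
  closed : IsClosed K
  sub : K ⊆ hyperplane p ν
  thin : ∀ y ∈ hyperplane p ν, ∀ U, IsOpen U → y ∈ U → ∃ z ∈ U ∩ hyperplane p ν, z ∉ K

lemma add_smul_mem_hyperplane {p ν x v : Eu N} (hx : x ∈ hyperplane p ν)
    (hv : (inner ℝ v ν : ℝ) = 0) (t : ℝ) : x + t • v ∈ hyperplane p ν := by
  rw [mem_hyperplane] at *
  rw [add_sub_right_comm, inner_add_left, inner_smul_left, hx, hv]; simp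

lemma isThin_inter {p ν q μ : Eu N} (hν : ‖ν‖ = 1) (h : ¬ hyperplane p ν ⊆ hyperplane q μ) :
    IsThin p ν (hyperplane p ν ∩ hyperplane q μ) := by
  refine ⟨hν, (isClosed_hyperplane p ν).inter (isClosed_hyperplane q μ), inter_subset_left, ?_⟩
  intro y hy U hU hyU
  obtain ⟨w, hw1, hw2⟩ := not_subset.1 h
  by_cases hyq : y ∈ hyperplane q μ
  · have hwy : (inner ℝ (w - y) ν : ℝ) = 0 := by
      rw [inner_sub_eq_of_mem hy]; exact hw1
    have hwy2 : (inner ℝ (w - y) μ : ℝ) ≠ 0 := by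
      rw [inner_sub_eq_of_mem hyq]; exact hw2
    have hc : Tendsto (fun t : ℝ => y + t • (w - y)) (𝓝[≠] 0) (𝓝 y) := by
      have : Continuous fun t : ℝ => y + t • (w - y) := by fun_prop
      have := this.tendsto 0
      simp only [zero_smul, add_zero] at this
      exact this.mono_left nhdsWithin_le_nhds
    obtain ⟨t, ht1, ht2⟩ := ((hc.eventually (hU.mem_nhds hyU)).and self_mem_nhdsWithin).exists
    refine ⟨y + t • (w - y), ⟨ht1, add_smul_mem_hyperplane hy hwy t⟩, fun hh => ?_⟩
    have h3 : (inner ℝ (y + t • (w - y) - q) μ : ℝ) = 0 := hh.2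
    rw [← inner_sub_eq_of_mem hyq, add_sub_cancel_left, inner_smul_left] at h3
    rcases mul_eq_zero.1 h3 with h4 | h4
    · exact ht2 (by simpa using h4)
    · exact hwy2 h4
  · exact ⟨y, ⟨hyU, hy⟩, fun hh => hyq hh.2⟩

lemma dense_compl_hyperplane {p ν : Eu N} (hν : ‖ν‖ = 1) : Dense (hyperplane p ν)ᶜ := by
  intro x
  by_cases hx : x ∈ hyperplane p ν
  · have := mem_closure_inter_halfSpace hν hx isOpen_univ (mem_univ x)
    refine closure_mono (fun y hy => ?_) this
    exact fun h => (mem_halfSpace.1 hy.2).ne h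
  · exact subset_closure hx

/-- The lines in a given direction that meet a thin set are exceptional. -/
lemma IsThin.exists_exceptional {p ν : Eu N} {K : Set (Eu N)} (hK : IsThin p ν K) (e : Eu N) :
    ∃ Z : Set (Eu N), IsClosed Z ∧ Dense Zᶜ ∧ ∀ x ∉ Z, ∀ t : ℝ, x + t • e ∉ K := by
  by_cases he : (inner ℝ e ν : ℝ) = 0
  · refine ⟨hyperplane p ν, isClosed_hyperplane p ν, dense_compl_hyperplane hK.norm, ?_⟩
    intro x hx t ht
    have := add_smul_mem_hyperplane (hK.sub ht) he (-t)
    rw [neg_smul, add_neg_cancel_right] at this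
    exact hx this
  · -- the parameter at which the line through `x` crosses the hyperplane
    set τ : Eu N → ℝ := fun x => -(inner ℝ (x - p) ν) / inner ℝ e ν with hτ
    have hτc : Continuous τ := by fun_prop
    have key : ∀ x t, x + t • e ∈ hyperplane p ν ↔ t = τ x := by
      intro x t
      rw [mem_hyperplane, add_sub_right_comm, inner_add_left, inner_smul_left, hτ, eq_div_iff he]
      simp only [conj_trivial]
      constructor <;> intro h <;> linarith
    refine ⟨(fun x => x + τ x • e) ⁻¹' K, hK.closed.preimage (by fun_prop), ?_, ?_⟩
    · intro x
      rw [mem_closure_iff]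
      intro U hU hxU
      obtain ⟨z, ⟨hz1, hz2⟩, hz3⟩ := hK.thin _ ((key x _).2 rfl) ((fun y => y - τ x • e) ⁻¹' U)
        (hU.preimage (by fun_prop)) (by simpa using hxU)
      refine ⟨z - τ x • e, hz1, ?_⟩
      have : τ x = τ (z - τ x • e) := (key _ _).1 (by simpa using hz2)
      rw [mem_compl_iff, mem_preimage, ← this]
      simpa using hz3
    · intro x hx t ht
      have := (key x t).1 (hK.sub ht)
      subst this
      exact hx ht

lemma IsThin.dense_compl {p ν : Eu N} {K : Set (Eu N)} (hK : IsThin p ν K) : Dense Kᶜ :=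
  (dense_compl_hyperplane hK.norm).mono (compl_subset_compl.2 hK.sub)

lemma dense_compl_iUnion {ι : Type*} [Finite ι] {K : ι → Set (Eu N)} (hc : ∀ i, IsClosed (K i))
    (hd : ∀ i, Dense (K i)ᶜ) : Dense (⋃ i, K i)ᶜ := by
  rw [compl_iUnion]
  exact dense_iInter_of_isOpen (fun i => (hc i).isOpen_compl) hd

/-! ### Thin sets do not separate -/

lemma subset_of_disjoint_frontier {X : Type*} [TopologicalSpace X] {s t : Set X}
    (hs : IsPreconnected s) (h : ∀ x ∈ s, x ∉ frontier t) (hne : (s ∩ t).Nonempty) : s ⊆ t := by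
  have hcov : s ⊆ interior t ∪ (closure t)ᶜ := fun x hx => by
    by_cases hxt : x ∈ closure t
    · exact Or.inl (by_contra fun h' => h x hx ⟨hxt, h'⟩)
    · exact Or.inr hxt
  intro x hx
  rcases hcov hx with h' | h'
  · exact interior_subset h'
  · obtain ⟨y, hy, hyt⟩ := hne
    have hy' : y ∈ interior t :=
      (hcov hy).resolve_right fun hn => hn (subset_closure hyt)
    obtain ⟨w, -, hw1, hw2⟩ := hs _ _ isOpen_interior isClosed_closure.isOpen_compl hcov
      ⟨y, hy, hy'⟩ ⟨x, hx, h'⟩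
    exact absurd (interior_subset_closure hw1) hw2

lemma IsThin.ball_subset_closure {p ν : Eu N} {K : Set (Eu N)} (hK : IsThin p ν K) {E : Set (Eu N)}
    (hE : IsOpen E) {z : Eu N} {r : ℝ} (hfr : frontier E ∩ Metric.ball z r ⊆ K)
    (hne : (Metric.ball z r ∩ E).Nonempty) : Metric.ball z r ⊆ closure E := by
  set V := Metric.ball z r
  have hV : IsOpen V := Metric.isOpen_ball
  have hKp := hK.sub
  have side : ∀ μ, (∀ y ∈ halfSpace p μ, y ∉ hyperplane p ν) → ((V ∩ halfSpace p μ) ∩ E).Nonempty →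
      V ∩ halfSpace p μ ⊆ E := by
    intro μ hμ h
    refine subset_of_disjoint_frontier
      (((convex_ball z r).inter (convex_halfSpace p μ)).isPreconnected) (fun y hy hy' => ?_) h
    exact hμ y hy.2 (hKp (hfr ⟨hy', hy.1⟩))
  have h1 : ∀ y ∈ halfSpace p ν, y ∉ hyperplane p ν := fun y hy h => (mem_halfSpace.1 hy).ne h
  have h2 : ∀ y ∈ halfSpace p (-ν), y ∉ hyperplane p ν := fun y hy h =>
    (mem_halfSpace_neg.1 hy).ne' h
  have hνn : ‖-ν‖ = 1 := by rw [norm_neg, hK.norm]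
  by_cases hVp : (V ∩ hyperplane p ν).Nonempty
  · obtain ⟨q₀, hq₀V, hq₀⟩ := hVp
    obtain ⟨q, ⟨hqV, hq⟩, hqK⟩ := hK.thin q₀ hq₀ V hV hq₀V
    have hqn : q ∈ hyperplane p (-ν) := by rwa [hyperplane_neg]
    have hqf : q ∉ frontier E := fun h => hqK (hfr ⟨h, hqV⟩)
    have both : V ∩ halfSpace p ν ⊆ E ∨ V ∩ halfSpace p (-ν) ⊆ E := by
      obtain ⟨w, hwV, hwE⟩ := hne
      rcases mem_trichotomy p ν w with hw | hw | hw
      · exact Or.inl (side ν h1 ⟨w, ⟨hwV, hw⟩, hwE⟩)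
      · have := mem_closure_inter_halfSpace hK.norm hw (hV.inter hE) ⟨hwV, hwE⟩
        obtain ⟨w', hw'⟩ := closure_nonempty_iff.1 ⟨w, this⟩
        exact Or.inl (side ν h1 ⟨w', ⟨hw'.1.1, hw'.2⟩, hw'.1.2⟩)
      · exact Or.inr (side (-ν) h2 ⟨w, ⟨hwV, hw⟩, hwE⟩)
    have hqE : q ∈ E := by
      have hqc : q ∈ closure E := by
        rcases both with h | h
        · exact closure_mono h (mem_closure_inter_halfSpace hK.norm hq hV hqV)
        · exact closure_mono h (mem_closure_inter_halfSpace hνn hqn hV hqV)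
      by_contra hqE
      exact hqf ⟨hqc, fun h => hqE (interior_subset h)⟩
    have hp : V ∩ halfSpace p ν ⊆ E := by
      obtain ⟨w', hw'⟩ := closure_nonempty_iff.1
        ⟨q, mem_closure_inter_halfSpace hK.norm hq (hV.inter hE) ⟨hqV, hqE⟩⟩
      exact side ν h1 ⟨w', ⟨hw'.1.1, hw'.2⟩, hw'.1.2⟩
    have hm : V ∩ halfSpace p (-ν) ⊆ E := by
      obtain ⟨w', hw'⟩ := closure_nonempty_iff.1
        ⟨q, mem_closure_inter_halfSpace hνn hqn (hV.inter hE) ⟨hqV, hqE⟩⟩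
      exact side (-ν) h2 ⟨w', ⟨hw'.1.1, hw'.2⟩, hw'.1.2⟩
    intro y hy
    rcases mem_trichotomy p ν y with h | h | h
    · exact subset_closure (hp ⟨hy, h⟩)
    · exact closure_mono hp (mem_closure_inter_halfSpace hK.norm h hV hy)
    · exact subset_closure (hm ⟨hy, h⟩)
  · refine (subset_of_disjoint_frontier (convex_ball z r).isPreconnected
      (fun y hy hy' => hVp ⟨y, hy, hKp (hfr ⟨hy', hy⟩)⟩) hne).trans subset_closure

lemma IsThin.isPreconnected_diff {p ν : Eu N} {K : Set (Eu N)} (hK : IsThin p ν K) {U : Set (Eu N)}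
    (hU : IsOpen U) (hUc : IsPreconnected U) : IsPreconnected (U \ K) := by
  intro v w hv hw hcov ⟨a, haU, hav⟩ ⟨b, hbU, hbw⟩
  by_contra hcon
  have hUK : IsOpen (U \ K) := hU.sdiff hK.closed
  set E := (U \ K) ∩ v
  have hE : IsOpen E := hUK.inter hv
  have hdisj : ∀ x ∈ U \ K, x ∈ w → x ∉ closure E := fun x hx hxw hxc => by
    obtain ⟨y, hy1, hy2⟩ := mem_closure_iff.1 hxc _ (hUK.inter hw) ⟨hx, hxw⟩
    exact hcon ⟨y, hy1.1, hy2.2, hy1.2⟩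
  have hfr : frontier E ∩ U ⊆ K := by
    rintro x ⟨hx, hxU⟩
    by_contra hxK
    rcases hcov ⟨hxU, hxK⟩ with h | h
    · exact hx.2 (by rw [hE.interior_eq]; exact ⟨⟨hxU, hxK⟩, h⟩)
    · exact hdisj x ⟨hxU, hxK⟩ h hx.1
  have hsub : U ⊆ interior (closure E) := by
    refine hUc.subset_of_closure_inter_subset isOpen_interior
      ⟨a, haU.1, (interior_maximal subset_closure hE) ⟨haU, hav⟩⟩ ?_
    rintro x ⟨hx, hxU⟩
    have hxE : x ∈ closure E := (closure_minimal interior_subset isClosed_closure) hx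
    obtain ⟨r, hr, hrU⟩ := Metric.isOpen_iff.1 hU x hxU
    obtain ⟨y, hy1, hy2⟩ := mem_closure_iff.1 hxE _ Metric.isOpen_ball (Metric.mem_ball_self hr)
    refine mem_interior.2 ⟨_, hK.ball_subset_closure hE (z := x) (r := r) ?_ ⟨y, hy1, hy2⟩,
      Metric.isOpen_ball, Metric.mem_ball_self hr⟩
    exact fun y hy => hfr ⟨hy.1, hrU hy.2⟩
  exact hdisj b hbU hbw (interior_subset (hsub hbU.1))

/-- Removing finitely many thin sets from a connected open set leaves it connected. -/
lemma isPreconnected_diff_iUnion {ι : Type*} [Finite ι] {p ν : ι → Eu N} {K : ι → Set (Eu N)}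
    (hK : ∀ i, IsThin (p i) (ν i) (K i)) {U : Set (Eu N)} (hU : IsOpen U)
    (hUc : IsPreconnected U) : IsPreconnected (U \ ⋃ i, K i) := by
  classical
  have := Fintype.ofFinite ι
  have h : ∀ s : Finset ι, IsOpen (U \ ⋃ i ∈ s, K i) ∧ IsPreconnected (U \ ⋃ i ∈ s, K i) := by
    intro s
    induction s using Finset.induction_on with
    | empty => simpa using ⟨hU, hUc⟩
    | insert i s _ ih =>
      have : U \ ⋃ j ∈ insert i s, K j = (U \ ⋃ j ∈ s, K j) \ K i := by
        rw [Finset.set_biUnion_insert, union_comm, sdiff_sdiff]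
      rw [this]
      exact ⟨ih.1.sdiff (hK i).closed, (hK i).isPreconnected_diff ih.1 ih.2⟩
  simpa using (h Finset.univ).2

/-- An open set whose boundary inside a connected open set `U` is contained in finitely many thin
sets is dense in `U`, unless it is disjoint from `U`. -/
lemma subset_closure_of_frontier_subset {ι : Type*} [Finite ι] {p ν : ι → Eu N}
    {K : ι → Set (Eu N)} (hK : ∀ i, IsThin (p i) (ν i) (K i)) {U E : Set (Eu N)} (hU : IsOpen U)
    (hUc : IsPreconnected U) (hE : IsOpen E) (hfr : frontier E ∩ U ⊆ ⋃ i, K i)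
    (hne : (U ∩ E).Nonempty) : U ⊆ closure E := by
  have hd := dense_compl_iUnion (fun i => (hK i).closed) fun i => (hK i).dense_compl
  have h1 : U \ ⋃ i, K i ⊆ E := by
    refine subset_of_disjoint_frontier (isPreconnected_diff_iUnion hK hU hUc)
      (fun x hx hx' => hx.2 (hfr ⟨hx', hx.1⟩)) ?_
    obtain ⟨y, hy1, hy2⟩ := hd.inter_open_nonempty _ (hU.inter hE) hne
    exact ⟨y, ⟨hy1.1, hy2⟩, hy1.2⟩
  exact (hd.open_subset_closure_inter hU).trans (closure_mono h1)

end PolyScat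

namespace PolyScat

variable {N M L L₁ n m : ℕ}

/-! ### The regular part of a polyhedral boundary -/

/-- The exceptional part of the boundary: the points of a cell that are not interior to it relative
to its hyperplane, and the intersections of different hyperplanes of cells. The index set consists
of the cells and of the pairs of cells with different hyperplanes. -/
def skeleton (C : Fin m → Cell N) :
    Fin m ⊕ {q : Fin m × Fin m // ¬ (C q.1).plane ⊆ (C q.2).plane} → Set (Eu N)
  | Sum.inl a => (C a).carrier \ (C a).relInterior
  | Sum.inr q => (C q.1.1).plane ∩ (C q.1.2).plane

/-- The cell in whose hyperplane a piece of the skeleton lies. -/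
def skeletonCell (C : Fin m → Cell N) :
    Fin m ⊕ {q : Fin m × Fin m // ¬ (C q.1).plane ⊆ (C q.2).plane} → Cell N
  | Sum.inl a => C a
  | Sum.inr q => C q.1.1

lemma Cell.carrier_subset_plane (C : Cell N) : C.carrier ⊆ C.plane :=
  closure_minimal inter_subset_right (isClosed_hyperplane _ _)

lemma mem_relInterior_of_mem_ball {C : Cell N} {z y : Eu N} {ρ : ℝ}
    (h : Metric.ball z ρ ∩ C.plane ⊆ C.carrier) (hy : y ∈ Metric.ball z ρ) (hyp : y ∈ C.plane) :
    y ∈ C.relInterior := by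
  refine ⟨hyp, ρ - dist y z, sub_pos.2 hy, fun w hw => h ⟨?_, hw.2⟩⟩
  exact Metric.ball_subset_ball' (by linarith) hw.1

lemma isThin_skeleton (C : Fin m → Cell N) (k) :
    IsThin (skeletonCell C k).point (skeletonCell C k).normal (skeleton C k) := by
  rcases k with a | ⟨⟨a, b⟩, hab⟩
  · refine ⟨(C a).norm_normal, ?_, fun y hy => (C a).carrier_subset_plane hy.1, ?_⟩
    · refine isClosed_of_closure_subset fun y hy => ?_
      have hyc : y ∈ (C a).carrier := closure_minimal sdiff_subset isClosed_closure hy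
      refine ⟨hyc, fun hyr => ?_⟩
      obtain ⟨-, ρ, hρ, hsub⟩ := hyr
      obtain ⟨w, hw1, hw2⟩ := mem_closure_iff.1 hy _ Metric.isOpen_ball (Metric.mem_ball_self hρ)
      exact hw2.2 (mem_relInterior_of_mem_ball hsub hw1 ((C a).carrier_subset_plane hw2.1))
    · intro y hy U hU hyU
      by_contra! hcon
      obtain ⟨ρ, hρ, hρU⟩ := Metric.isOpen_iff.1 hU y hyU
      exact (hcon y ⟨hyU, hy⟩).2 ⟨hy, ρ, hρ, fun w hw => (hcon w ⟨hρU hw.1, hw.2⟩).1⟩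
  · exact isThin_inter (C a).norm_normal hab

/-- Near a point of the boundary off the skeleton, the boundary is a piece of one hyperplane and
lies in the relative interior of one cell. -/
lemma exists_cell_of_notMem_skeleton {S : Set (Eu N)} {C : Fin m → Cell N}
    (hC : IsBoundaryDecomposition S C) {z : Eu N} (hz : z ∈ frontier S)
    (hzs : z ∉ ⋃ k, skeleton C k) :
    ∃ a, z ∈ (C a).carrier ∧ ∃ ρ > 0, Metric.ball z ρ ∩ (C a).plane ⊆ (C a).relInterior ∧
      frontier S ∩ Metric.ball z ρ ⊆ (C a).plane := by
  rw [mem_iUnion, not_exists] at hzs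
  have hz' := hz
  rw [hC, mem_iUnion] at hz'
  obtain ⟨a, ha⟩ := hz'
  have har : z ∈ (C a).relInterior := by
    by_contra h; exact hzs (Sum.inl a) ⟨ha, h⟩
  obtain ⟨-, ρ₁, hρ₁, hsub⟩ := har
  set F : Set (Eu N) := ⋃ b ∈ {b : Fin m | z ∉ (C b).carrier}, (C b).carrier with hF
  have hFc : IsClosed F := (Set.toFinite _).isClosed_biUnion fun b _ => isClosed_closure
  have hzF : z ∉ F := by
    rw [hF, mem_iUnion₂]; rintro ⟨b, hb, hb'⟩; exact hb hb'
  obtain ⟨ρ₂, hρ₂, hsub₂⟩ := Metric.isOpen_iff.1 hFc.isOpen_compl z hzF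
  refine ⟨a, ha, min ρ₁ ρ₂, lt_min hρ₁ hρ₂, ?_, ?_⟩
  · intro y hy
    exact mem_relInterior_of_mem_ball hsub (Metric.ball_subset_ball (min_le_left _ _) hy.1) hy.2
  · rintro y ⟨hy, hyb⟩
    rw [hC, mem_iUnion] at hy
    obtain ⟨b, hb⟩ := hy
    by_cases hzb : z ∈ (C b).carrier
    · by_contra hya
      have hba : ¬ (C b).plane ⊆ (C a).plane := fun h => hya (h ((C b).carrier_subset_plane hb))
      exact hzs (Sum.inr ⟨(b, a), hba⟩)
        ⟨(C b).carrier_subset_plane hzb, (C a).carrier_subset_plane ha⟩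
    · exact absurd (mem_iUnion₂.2 ⟨b, hzb, hb⟩)
        (hsub₂ (Metric.ball_subset_ball (min_le_right _ _) hyb))

/-! ### Flat points and mirror domains -/

/-- The boundary condition `B i` holds in the exterior of `S` on the hyperplane through `x` with
unit normal `ν`, near `x`. -/
def FlatAt (B : Fin n → BdryOp N M L₁) (S : Set (Eu N)) (u : Eu N → Fin M → ℂ) (i : Fin n)
    (x ν : Eu N) : Prop :=
  ‖ν‖ = 1 ∧ ∃ r > 0, Metric.ball x r ⊆ Sᶜ ∧
    ∀ y ∈ Metric.ball x r ∩ hyperplane x ν, (B i).ZeroAt ν u y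

lemma FlatAt.notMem {B : Fin n → BdryOp N M L₁} {S : Set (Eu N)} {u : Eu N → Fin M → ℂ} {i : Fin n}
    {x ν : Eu N} (h : FlatAt B S u i x ν) : x ∉ S := by
  obtain ⟨-, r, hr, hsub, -⟩ := h
  exact hsub (Metric.mem_ball_self hr)

/-- The points of the half-space with exterior normal `ν` at `x` that lie outside `S` together with
their mirror images. -/
def mirrorRegion (S : Set (Eu N)) (x ν : Eu N) : Set (Eu N) :=
  {y | y ∈ halfSpace x ν ∧ y ∉ S ∧ hrefl x ν y ∉ S}

lemma isOpen_mirrorRegion {S : Set (Eu N)} (hS : IsClosed S) (x ν : Eu N) :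
    IsOpen (mirrorRegion S x ν) :=
  (isOpen_halfSpace x ν).inter
    (hS.isOpen_compl.inter (hS.isOpen_compl.preimage (continuous_hrefl x ν)))

/-- `E` is the connected component of the mirror region that is adjacent to `x`. -/
structure IsMirrorDomain (S : Set (Eu N)) (x ν : Eu N) (E : Set (Eu N)) : Prop where
  norm : ‖ν‖ = 1
  isOpen : IsOpen E
  conn : IsPreconnected E
  sub : E ⊆ mirrorRegion S x ν
  maximal : ∀ K, IsPreconnected K → K ⊆ mirrorRegion S x ν → (K ∩ E).Nonempty → K ⊆ E
  adjacent : x ∈ closure E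

lemma ball_inter_halfSpace_subset_mirrorRegion {S : Set (Eu N)} {x ν y : Eu N} {r : ℝ}
    (hν : ‖ν‖ = 1) (hy : y ∈ hyperplane x ν) (hr : Metric.ball y r ⊆ Sᶜ) :
    Metric.ball y r ∩ halfSpace x ν ⊆ mirrorRegion S x ν := by
  intro z hz
  refine ⟨hz.2, hr hz.1, hr ?_⟩
  rw [← hrefl_of_mem hy, hrefl_mem_ball hν]
  exact hz.1

lemma exists_isMirrorDomain {S : Set (Eu N)} (hS : IsClosed S) {x ν : Eu N} (hν : ‖ν‖ = 1)
    (hx : x ∉ S) : ∃ E, IsMirrorDomain S x ν E := by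
  obtain ⟨r, hr, hrS⟩ := Metric.isOpen_iff.1 hS.isOpen_compl x hx
  have hx1 := self_mem_hyperplane x ν
  have hcl := mem_closure_inter_halfSpace hν hx1 Metric.isOpen_ball (Metric.mem_ball_self hr)
  obtain ⟨z, hz⟩ := closure_nonempty_iff.1 ⟨x, hcl⟩
  have hsub := ball_inter_halfSpace_subset_mirrorRegion hν hx1 hrS
  have hpre := ((convex_ball x r).inter (convex_halfSpace x ν)).isPreconnected
  refine ⟨connectedComponentIn (mirrorRegion S x ν) z, hν,
    (isOpen_mirrorRegion hS x ν).connectedComponentIn, isPreconnected_connectedComponentIn,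
    connectedComponentIn_subset _ _, ?_, ?_⟩
  · rintro K hK hKsub ⟨w, hwK, hw⟩
    rw [connectedComponentIn_eq hw]
    exact hK.subset_connectedComponentIn hwK hKsub
  · exact closure_mono (hpre.subset_connectedComponentIn hz hsub) hcl

namespace IsMirrorDomain

variable {S : Set (Eu N)} {x ν : Eu N} {E : Set (Eu N)}

lemma neg (hE : IsMirrorDomain S x ν E) : IsMirrorDomain S x (-ν) (hrefl x ν ⁻¹' E) := by
  have hν := hE.norm
  have hreg : mirrorRegion S x (-ν) = hrefl x ν ⁻¹' mirrorRegion S x ν := by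
    ext y
    simp only [mirrorRegion, mem_ofPred_eq, mem_preimage, hrefl_hrefl hν, hrefl_neg,
      hrefl_mem_halfSpace hν, and_comm (a := y ∉ S)]
  refine ⟨by rw [norm_neg, hν], hE.isOpen.preimage (continuous_hrefl x ν),
    isPreconnected_hrefl_preimage hν hE.conn, ?_, ?_, ?_⟩
  · rw [hreg]; exact preimage_mono hE.sub
  · intro K hK hKs ⟨w, hwK, hw⟩
    rw [hreg] at hKs
    have := hE.maximal (hrefl x ν '' K) (hK.image _ (continuous_hrefl x ν).continuousOn)
      (image_subset_iff.2 hKs) ⟨_, mem_image_of_mem _ hwK, hw⟩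
    exact image_subset_iff.1 this
  · rw [← hrefl_preimage_closure hν, mem_preimage, hrefl_self]; exact hE.adjacent

lemma subset_compl (hE : IsMirrorDomain S x ν E) : E ⊆ Sᶜ := fun _ hy => (hE.sub hy).2.1

lemma subset_halfSpace (hE : IsMirrorDomain S x ν E) : E ⊆ halfSpace x ν := fun _ hy => (hE.sub hy).1

lemma ball_inter_subset (hE : IsMirrorDomain S x ν E) {y : Eu N} {r : ℝ}
    (hy : y ∈ hyperplane x ν) (hyE : y ∈ closure E) (hr : 0 < r) (hrS : Metric.ball y r ⊆ Sᶜ) :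
    Metric.ball y r ∩ halfSpace x ν ⊆ E := by
  obtain ⟨w, hw1, hw2⟩ := mem_closure_iff.1 hyE _ Metric.isOpen_ball (Metric.mem_ball_self hr)
  exact hE.maximal _ ((convex_ball y r).inter (convex_halfSpace x ν)).isPreconnected
    (ball_inter_halfSpace_subset_mirrorRegion hE.norm hy hrS) ⟨w, ⟨hw1, hE.subset_halfSpace hw2⟩, hw2⟩

end IsMirrorDomain

section Symmetry

variable {A : DiffSystem N M L} {B : Fin n → BdryOp N M L₁} {S : Set (Eu N)}
  {u : Eu N → Fin M → ℂ} (hAB : Admissible A B) (hS : IsClosed S) (hu : IsSol A Sᶜ u)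
include hAB hS hu

/-- At a flat point the solution is symmetric: in the mirror image of a mirror domain it agrees with
the reflected solution. -/
lemma exists_isReflOp_eqOn {i : Fin n} {x ν : Eu N} (hf : FlatAt B S u i x ν) {E : Set (Eu N)}
    (hE : IsMirrorDomain S x ν E) :
    ∃ T, IsReflOp A B i x ν T ∧ EqOn (T (u ∘ hrefl x ν)) u (hrefl x ν ⁻¹' E) := by
  obtain ⟨hν, r, hr, hrS, hz⟩ := hf
  obtain ⟨T, hT⟩ := hAB.reflection i x ν hν
  refine ⟨T, hT, ?_⟩
  have hxp := self_mem_hyperplane x ν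
  have hsub := hE.ball_inter_subset hxp hE.adjacent hr hrS
  have hsub' := hE.neg.ball_inter_subset (self_mem_hyperplane _ _) hE.neg.adjacent hr hrS
  have huE := hu.mono hE.subset_compl
  obtain ⟨-, w, hw, hw1, hw2⟩ := hT.extend E hE.isOpen hE.subset_halfSpace u huE x hxp r hr hsub
    fun y hy => hAB.zeroFrom_of_zeroAt hS.isOpen_compl hu (hrS hy.1) (hz y hy)
  have hwu : EqOn w u (Metric.ball x r) :=
    hAB.eqOn_of_eqOn Metric.isOpen_ball (convex_ball x r).isPreconnected hw (hu.mono hrS)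
      inter_subset_left (Metric.isOpen_ball.inter (isOpen_halfSpace x ν))
      (closure_nonempty_iff.1 ⟨x, mem_closure_inter_halfSpace hν hxp Metric.isOpen_ball
        (Metric.mem_ball_self hr)⟩) hw1
  have hsol := hT.sol E hE.isOpen hE.subset_halfSpace u huE
  rw [hrefl_image hν] at hsol
  have hνn : ‖-ν‖ = 1 := by rw [norm_neg, hν]
  refine hAB.eqOn_of_eqOn hE.neg.isOpen hE.neg.conn hsol (hu.mono hE.neg.subset_compl) hsub'
    (Metric.isOpen_ball.inter (isOpen_halfSpace x (-ν)))
    (closure_nonempty_iff.1 ⟨x, mem_closure_inter_halfSpace hνn (self_mem_hyperplane _ _)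
      Metric.isOpen_ball (Metric.mem_ball_self hr)⟩) fun y hy => ?_
  rw [← hw2 hy, hwu hy.1]

/-- The boundary condition at a flat point propagates along the hyperplane, as long as this borders
the mirror domain. -/
lemma zeroAt_of_mem_closure {i : Fin n} {x ν : Eu N} (hf : FlatAt B S u i x ν) {E : Set (Eu N)}
    (hE : IsMirrorDomain S x ν E) {y : Eu N} (hy : y ∈ hyperplane x ν) (hyS : y ∉ S)
    (hyE : y ∈ closure E) : ∃ r > 0, Metric.ball y r ⊆ Sᶜ ∧ ∀ z ∈ Metric.ball y r ∩ hyperplane x ν,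
      (B i).ZeroAt ν u z ∧ (B i).ZeroAt (-ν) u z := by
  obtain ⟨T, hT, hTu⟩ := exists_isReflOp_eqOn hAB hS hu hf hE
  obtain ⟨r, hr, hrS⟩ := Metric.isOpen_iff.1 hS.isOpen_compl y hyS
  refine ⟨r, hr, hrS, hT.zero y hy r hr u (hu.mono hrS) fun z hz => (hTu ?_).symm⟩
  refine hE.neg.ball_inter_subset (by rwa [hyperplane_neg]) ?_ hr hrS hz
  rw [← hrefl_preimage_closure hE.norm, mem_preimage, hrefl_of_mem hy]
  exact hyE

lemma FlatAt.neg {i : Fin n} {x ν : Eu N} (hf : FlatAt B S u i x ν) : FlatAt B S u i x (-ν) := by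
  obtain ⟨E, hE⟩ := exists_isMirrorDomain hS hf.1 hf.notMem
  obtain ⟨r, hr, hrS, h⟩ := zeroAt_of_mem_closure hAB hS hu hf hE (self_mem_hyperplane x ν)
    hf.notMem hE.adjacent
  refine ⟨by rw [norm_neg, hf.1], r, hr, hrS, fun y hy => (h y ?_).2⟩
  rwa [hyperplane_neg] at hy

/-- Boundary conditions on one side of a hyperplane inside a mirror domain are carried over to the
mirror image; at points of the exterior they hold there pointwise. -/
lemma flatAt_hrefl {i : Fin n} {x ν : Eu N} (hf : FlatAt B S u i x ν) {E : Set (Eu N)}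
    (hE : IsMirrorDomain S x ν E) {z σ : Eu N} (hσ : ‖σ‖ = 1) {r : ℝ} (hr : 0 < r)
    (hsub : Metric.ball z r ∩ halfSpace z σ ⊆ E)
    (hrS : Metric.ball (hrefl x ν z) r ⊆ Sᶜ) {j : Fin n}
    (hz : ∀ y ∈ Metric.ball z r ∩ hyperplane z σ, (B j).ZeroFrom σ u y) :
    FlatAt B S u j (hrefl x ν z) (hrefl 0 ν σ) := by
  have hν := hE.norm
  obtain ⟨T, hT, hTu⟩ := exists_isReflOp_eqOn hAB hS hu hf hE
  have hc := hT.carry E hE.isOpen hE.subset_halfSpace u (hu.mono hE.subset_compl) z σ hσ r hr hsub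
    j hz
  have hσ' : ‖hrefl 0 ν σ‖ = 1 := by rw [norm_hrefl_zero hν, hσ]
  refine ⟨hσ', r, hr, hrS, fun y' hy' => ?_⟩
  obtain ⟨y, rfl⟩ : ∃ y, hrefl x ν y = y' := ⟨_, hrefl_hrefl hν y'⟩
  have hy : y ∈ Metric.ball z r ∩ hyperplane z σ :=
    ⟨(hrefl_mem_ball hν).1 hy'.1, (hrefl_mem_hyperplane_hrefl hν).1 hy'.2⟩
  refine hAB.zeroAt_of_zeroFrom hS.isOpen_compl hu hσ' (hrS hy'.1) hE.neg.isOpen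
    (sub_pos.2 hy.1) ?_ hTu (hc y hy)
  rintro w' ⟨hw1, hw2⟩
  obtain ⟨w, rfl⟩ : ∃ w, hrefl x ν w = w' := ⟨_, hrefl_hrefl hν w'⟩
  rw [mem_preimage, hrefl_hrefl hν]
  rw [hrefl_mem_ball hν] at hw1
  rw [hrefl_mem_halfSpace_hrefl hν, halfSpace_eq_of_mem hy.2] at hw2
  exact hsub ⟨Metric.ball_subset_ball' (by linarith) hw1, hw2⟩

/-- The mirror image of a regular boundary point on the boundary of a mirror domain is a flat point
if it lies in the exterior; the flat hyperplane is the mirror image of that of the cell. -/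
lemma exists_flatAt_hrefl {C : Fin m → Cell N} (hC : IsBoundaryDecomposition S C)
    (hBC : MixedBC B S C u) {i : Fin n} {x ν : Eu N} (hf : FlatAt B S u i x ν) {E : Set (Eu N)}
    (hE : IsMirrorDomain S x ν E) {z : Eu N} (hz : z ∈ frontier S) (hzs : z ∉ ⋃ k, skeleton C k)
    (hzE : z ∈ closure E) (hzν : z ∈ halfSpace x ν) (hzS : hrefl x ν z ∉ S) :
    ∃ a j, z ∈ (C a).carrier ∧ FlatAt B S u j (hrefl x ν z) (hrefl 0 ν (C a).normal) := by
  have hν := hE.norm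
  obtain ⟨a, hza, ρ, hρ, hrel, hfr⟩ := exists_cell_of_notMem_skeleton hC hz hzs
  have hzp := (C a).carrier_subset_plane hza
  have hplane : (C a).plane = hyperplane z (C a).normal := (hyperplane_eq_of_mem hzp).symm
  obtain ⟨r₁, hr₁, hr₁ν⟩ := Metric.isOpen_iff.1 (isOpen_halfSpace x ν) z hzν
  obtain ⟨r₂, hr₂, hr₂S⟩ := Metric.isOpen_iff.1 hS.isOpen_compl _ hzS
  set r := min ρ (min r₁ r₂)
  have hr : 0 < r := lt_min hρ (lt_min hr₁ hr₂)
  have hrρ : Metric.ball z r ⊆ Metric.ball z ρ := Metric.ball_subset_ball (min_le_left _ _)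
  have hrν : Metric.ball z r ⊆ halfSpace x ν :=
    (Metric.ball_subset_ball ((min_le_right _ _).trans (min_le_left _ _))).trans hr₁ν
  have hrS : Metric.ball (hrefl x ν z) r ⊆ Sᶜ :=
    (Metric.ball_subset_ball ((min_le_right _ _).trans (min_le_right _ _))).trans hr₂S
  -- the half-ball at `z` that meets `E` is contained in `E`
  have hside : ∃ σ, (σ = (C a).normal ∨ σ = -(C a).normal) ∧
      (Metric.ball z r ∩ halfSpace z σ ∩ E).Nonempty := by
    obtain ⟨w, hw1, hw2⟩ := mem_closure_iff.1 hzE _ Metric.isOpen_ball (Metric.mem_ball_self hr)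
    obtain ⟨w, ⟨hw1, hw2⟩, hw3⟩ := (dense_compl_hyperplane (p := z) (C a).norm_normal
      ).inter_open_nonempty _ (Metric.isOpen_ball.inter hE.isOpen) ⟨w, hw1, hw2⟩
    rcases mem_trichotomy z (C a).normal w with h | h | h
    · exact ⟨_, Or.inl rfl, w, ⟨hw1, h⟩, hw2⟩
    · exact absurd h hw3
    · exact ⟨_, Or.inr rfl, w, ⟨hw1, h⟩, hw2⟩
  obtain ⟨σ, hσ, hne⟩ := hside
  have hσ1 : ‖σ‖ = 1 := by
    rcases hσ with rfl | rfl
    · exact (C a).norm_normal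
    · rw [norm_neg, (C a).norm_normal]
  have hσp : hyperplane z σ = (C a).plane := by
    rcases hσ with rfl | rfl
    · exact hplane.symm
    · rw [hyperplane_neg, hplane]
  have hpre := ((convex_ball z r).inter (convex_halfSpace z σ)).isPreconnected
  have hout : Metric.ball z r ∩ halfSpace z σ ⊆ Sᶜ := by
    refine subset_of_disjoint_frontier hpre (fun y hy hyf => ?_)
      (hne.mono (inter_subset_inter_right _ hE.subset_compl))
    rw [frontier_compl] at hyf
    have : y ∈ hyperplane z σ := by rw [hσp]; exact hfr ⟨hyf, hrρ hy.1⟩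
    exact (mem_halfSpace.1 hy.2).ne this
  have hsub : Metric.ball z r ∩ halfSpace z σ ⊆ E := by
    refine hE.maximal _ hpre (fun y hy => ⟨hrν hy.1, hout hy, hrS ?_⟩) hne
    rw [hrefl_mem_ball hν]; exact hy.1
  obtain ⟨j, hj⟩ := hBC a σ hσ
  have hflat := flatAt_hrefl hAB hS hu hf hE hσ1 hr hsub hrS (j := j) fun y hy => by
    refine hj y (hrel ⟨hrρ hy.1, hσp ▸ hy.2⟩) ⟨r - dist y z, sub_pos.2 hy.1, ?_⟩
    rw [halfSpace_eq_of_mem hy.2]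
    exact fun w hw => hout ⟨Metric.ball_subset_ball' (by linarith) hw.1, hw.2⟩
  refine ⟨a, j, hza, ?_⟩
  rcases hσ with rfl | rfl
  · exact hflat
  · have := hflat.neg hAB hS hu
    rwa [hrefl_zero_neg, neg_neg] at this

end Symmetry

end PolyScat

namespace PolyScat

variable {N M L L₁ n m : ℕ}

lemma exists_unit_orthogonal (hN : 2 ≤ N) {ν : Eu N} (hν : ‖ν‖ = 1) (x : Eu N) :
    ∃ w : Eu N, ‖w‖ = 1 ∧ (inner ℝ w ν : ℝ) = 0 ∧ 0 ≤ (inner ℝ x w : ℝ) := by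
  have hlt : Module.finrank ℝ (ℝ ∙ ν) < Module.finrank ℝ (Eu N) := by
    rw [finrank_euclideanSpace_fin, finrank_span_singleton (norm_ne_zero_iff.1 (by simp [hν]))]
    omega
  obtain ⟨w, hw, hw0⟩ : ∃ w ∈ (ℝ ∙ ν)ᗮ, w ≠ 0 := by
    refine Submodule.exists_mem_ne_zero_of_ne_bot fun h => ?_
    have := Submodule.finrank_add_finrank_orthogonal (ℝ ∙ ν)
    rw [h, finrank_bot] at this
    omega
  have hwν : (inner ℝ w ν : ℝ) = 0 := by
    rw [real_inner_comm]; exact Submodule.mem_orthogonal_singleton_iff_inner_right.1 hw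
  have hn : ‖‖w‖⁻¹ • w‖ = 1 := by
    rw [norm_smul, norm_inv, norm_norm, inv_mul_cancel₀ (norm_ne_zero_iff.2 hw0)]
  rcases le_total 0 (inner ℝ x (‖w‖⁻¹ • w) : ℝ) with h | h
  · exact ⟨_, hn, by rw [inner_smul_left, hwν, mul_zero], h⟩
  · refine ⟨-(‖w‖⁻¹ • w), by rw [norm_neg, hn], ?_, ?_⟩
    · rw [inner_neg_left, inner_smul_left, hwν, mul_zero, neg_zero]
    · rw [inner_neg_right]; linarith

lemma hrefl_mem_closedBall_self {x ν y : Eu N} (hν : ‖ν‖ = 1) {r : ℝ} :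
    hrefl x ν y ∈ Metric.closedBall x r ↔ y ∈ Metric.closedBall x r := by
  have h := dist_hrefl (p := x) hν y x
  rw [hrefl_self] at h
  rw [Metric.mem_closedBall, Metric.mem_closedBall, h]

/-! ### The symmetric hull of a mirror domain -/

/-- The union of a mirror domain, its mirror image, and the part of the mirror hyperplane in the
exterior of `S` that borders them. -/
def mirrorHull (S : Set (Eu N)) (x ν : Eu N) (E : Set (Eu N)) : Set (Eu N) :=
  E ∪ hrefl x ν ⁻¹' E ∪ (hyperplane x ν ∩ Sᶜ ∩ closure E)

namespace IsMirrorDomain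

variable {S : Set (Eu N)} {x ν : Eu N} {E : Set (Eu N)}

lemma ball_subset_mirrorHull (hE : IsMirrorDomain S x ν E) {y : Eu N} {r : ℝ}
    (hy : y ∈ hyperplane x ν) (hyE : y ∈ closure E) (hr : 0 < r) (hrS : Metric.ball y r ⊆ Sᶜ) :
    Metric.ball y r ⊆ mirrorHull S x ν E := by
  have hν := hE.norm
  have h1 := hE.ball_inter_subset hy hyE hr hrS
  intro w hw
  rcases mem_trichotomy x ν w with h | h | h
  · exact Or.inl (Or.inl (h1 ⟨hw, h⟩))
  · exact Or.inr ⟨⟨h, hrS hw⟩, closure_mono h1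
      (mem_closure_inter_halfSpace hν h Metric.isOpen_ball hw)⟩
  · refine Or.inl (Or.inr (h1 ⟨?_, (hrefl_mem_halfSpace hν).2 h⟩))
    rw [← hrefl_of_mem hy, hrefl_mem_ball hν]; exact hw

lemma isOpen_mirrorHull (hE : IsMirrorDomain S x ν E) (hS : IsClosed S) :
    IsOpen (mirrorHull S x ν E) := by
  rw [isOpen_iff_mem_nhds]
  rintro y ((hy | hy) | hy)
  · exact mem_of_superset (hE.isOpen.mem_nhds hy) fun w hw => Or.inl (Or.inl hw)
  · exact mem_of_superset ((hE.isOpen.preimage (continuous_hrefl x ν)).mem_nhds hy)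
      fun w hw => Or.inl (Or.inr hw)
  · obtain ⟨r, hr, hrS⟩ := Metric.isOpen_iff.1 hS.isOpen_compl y hy.1.2
    exact mem_of_superset (Metric.ball_mem_nhds y hr)
      (hE.ball_subset_mirrorHull hy.1.1 hy.2 hr hrS)

lemma hrefl_preimage_mirrorHull (hE : IsMirrorDomain S x ν E) :
    hrefl x ν ⁻¹' mirrorHull S x ν E = mirrorHull S x ν E := by
  have hν := hE.norm
  have h3 : hrefl x ν ⁻¹' (hyperplane x ν ∩ Sᶜ ∩ closure E) = hyperplane x ν ∩ Sᶜ ∩ closure E := by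
    ext y
    simp only [mem_preimage, mem_inter_iff, hrefl_mem_hyperplane hν, and_assoc]
    refine and_congr_right fun hy => ?_
    rw [hrefl_of_mem hy]
  have h2 : hrefl x ν ⁻¹' (hrefl x ν ⁻¹' E) = E := by
    ext y; rw [mem_preimage, mem_preimage, hrefl_hrefl hν]
  rw [mirrorHull, preimage_union, preimage_union, h2, h3, union_comm E]

lemma mirrorHull_subset_compl (hE : IsMirrorDomain S x ν E) : mirrorHull S x ν E ⊆ Sᶜ := by
  rintro y ((hy | hy) | hy)
  · exact hE.subset_compl hy
  · exact hE.neg.subset_compl hy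
  · exact hy.1.2

/-- A boundary point of the symmetric hull that lies outside `S` is the mirror image of a boundary
point of `S`, off the mirror hyperplane. -/
lemma hrefl_mem_frontier (hE : IsMirrorDomain S x ν E) (hS : IsClosed S) {y : Eu N} (hyS : y ∉ S)
    (hy : y ∈ frontier (mirrorHull S x ν E)) : hrefl x ν y ∈ frontier S ∧
      (hrefl x ν y ∈ closure (hrefl x ν ⁻¹' E) ∧ hrefl x ν y ∈ halfSpace x (-ν) ∨
        hrefl x ν y ∈ closure E ∧ hrefl x ν y ∈ halfSpace x ν) := by
  have hν := hE.norm
  rw [(hE.isOpen_mirrorHull hS).frontier_eq] at hy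
  obtain ⟨hyc, hyn⟩ := hy
  have hcases : y ∈ closure E ∨ y ∈ closure (hrefl x ν ⁻¹' E) := by
    rw [mirrorHull, closure_union, closure_union] at hyc
    rcases hyc with (h | h) | h
    · exact Or.inl h
    · exact Or.inr h
    · exact Or.inl (closure_minimal inter_subset_right isClosed_closure h)
  have hfr : hrefl x ν y ∈ S → hrefl x ν y ∈ closure Sᶜ → hrefl x ν y ∈ frontier S :=
    fun h1 h2 => by
      rw [frontier_eq_closure_inter_closure]; exact ⟨subset_closure h1, h2⟩
  have hplane : y ∈ hyperplane x ν → y ∉ closure E := fun h1 h2 => hyn (Or.inr ⟨⟨h1, hyS⟩, h2⟩)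
  -- `y` is not on the mirror hyperplane, and its mirror image is not in the exterior
  have key : ∀ w, w ∈ closure E → w ∈ halfSpace x ν → w ∉ S → hrefl x ν w ∉ S → w ∈ E := by
    intro w hw1 hw2 hw3 hw4
    obtain ⟨r, hr, hrsub⟩ := Metric.isOpen_iff.1 (isOpen_mirrorRegion hS x ν) w ⟨hw2, hw3, hw4⟩
    obtain ⟨v, hv1, hv2⟩ := mem_closure_iff.1 hw1 _ Metric.isOpen_ball (Metric.mem_ball_self hr)
    exact hE.maximal _ (convex_ball w r).isPreconnected hrsub ⟨v, hv1, hv2⟩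
      (Metric.mem_ball_self hr)
  rcases hcases with h | h
  · have hyH : y ∈ halfSpace x ν :=
      (closure_halfSpace_subset (closure_mono hE.subset_halfSpace h)).resolve_right
        fun hp => hplane hp h
    have hRc : hrefl x ν y ∈ closure (hrefl x ν ⁻¹' E) := by
      rw [← hrefl_preimage_closure hν, mem_preimage, hrefl_hrefl hν]; exact h
    refine ⟨hfr (by_contra fun hn => hyn (Or.inl (Or.inl (key y h hyH hyS hn))))
      (closure_mono hE.neg.subset_compl hRc),
      Or.inl ⟨hRc, (hrefl_mem_halfSpace_neg hν).2 hyH⟩⟩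
  · rw [← hrefl_preimage_closure hν, mem_preimage] at h
    have hyH : hrefl x ν y ∈ halfSpace x ν :=
      (closure_halfSpace_subset (closure_mono hE.subset_halfSpace h)).resolve_right fun hp => by
        have hp' := (hrefl_mem_hyperplane hν).1 hp
        rw [hrefl_of_mem hp'] at h
        exact hplane hp' h
    refine ⟨hfr (by_contra fun hn => hyn (Or.inl (Or.inr (key _ h hyH hn ?_))))
      (closure_mono hE.subset_compl h), Or.inr ⟨h, hyH⟩⟩
    rwa [hrefl_hrefl hν]

/-- If a mirror domain reaches beyond a ball around `x` that contains `S` and its mirror image, then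
it contains all of its half-space outside the ball. -/
lemma halfSpace_diff_subset (hE : IsMirrorDomain S x ν E) {R₀ : ℝ}
    (hR : S ⊆ Metric.closedBall 0 R₀) (hR₀ : 0 ≤ R₀)
    (hne : ¬ E ⊆ Metric.closedBall x (R₀ + ‖x‖)) :
    halfSpace x ν \ Metric.closedBall x (R₀ + ‖x‖) ⊆ E := by
  have hν := hE.norm
  have hνν : (inner ℝ ν ν : ℝ) = 1 := by rw [real_inner_self_eq_norm_sq, hν]; norm_num
  set ρ := R₀ + ‖x‖ with hρ
  have hρ0 : 0 ≤ ρ := by positivity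
  have hSx : S ⊆ Metric.closedBall x ρ := by
    refine hR.trans (Metric.closedBall_subset_closedBall' ?_)
    rw [dist_zero_left]
  have hreg : halfSpace x ν \ Metric.closedBall x ρ ⊆ mirrorRegion S x ν := by
    rintro y ⟨hy1, hy2⟩
    refine ⟨hy1, fun h => hy2 (hSx h), fun h => hy2 ?_⟩
    have := hSx h
    rwa [hrefl_mem_closedBall_self hν] at this
  -- vertical rays and a distant half-space connect any two points outside the ball
  have hray : ∀ y ∈ halfSpace x ν \ Metric.closedBall x ρ,
      (fun s : ℝ => y - s • ν) '' Ici 0 ⊆ halfSpace x ν \ Metric.closedBall x ρ := by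
    rintro y ⟨hy1, hy2⟩ _ ⟨s, hs, rfl⟩
    have hs' : (0 : ℝ) ≤ s := hs
    rw [mem_halfSpace] at hy1
    have hi : (inner ℝ (y - s • ν - x) ν : ℝ) = inner ℝ (y - x) ν - s := by
      rw [sub_right_comm, inner_sub_left, inner_smul_left, hνν]; simp
    refine ⟨?_, fun h => hy2 ?_⟩
    · rw [mem_halfSpace, hi]; linarith
    · rw [Metric.mem_closedBall, dist_eq_norm] at h ⊢
      refine le_trans (le_of_sq_le_sq ?_ (norm_nonneg _)) h
      rw [sub_right_comm, norm_sub_sq_real (y - x), inner_smul_right, norm_smul, hν, mul_one,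
        Real.norm_eq_abs, sq_abs]
      nlinarith
  have hraypre : ∀ y : Eu N, IsPreconnected ((fun s : ℝ => y - s • ν) '' Ici 0) := fun y =>
    isPreconnected_Ici.image _ (by fun_prop)
  have hymem : ∀ y : Eu N, y ∈ (fun s : ℝ => y - s • ν) '' Ici 0 := fun y =>
    ⟨0, by simp, by simp⟩
  have hFsub : halfSpace (x - ρ • ν) ν ⊆ halfSpace x ν \ Metric.closedBall x ρ := by
    intro y hy
    have hy' : (inner ℝ (y - x) ν : ℝ) < -ρ := by
      rw [mem_halfSpace, ← sub_add, inner_add_left, inner_smul_left, hνν] at hy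
      simp only [conj_trivial] at hy
      linarith
    refine ⟨by rw [mem_halfSpace]; linarith, fun h => ?_⟩
    rw [Metric.mem_closedBall, dist_eq_norm] at h
    have := abs_real_inner_le_norm (y - x) ν
    rw [hν, mul_one] at this
    linarith [neg_abs_le (inner ℝ (y - x) ν : ℝ)]
  have hmeet : ∀ y ∈ halfSpace x ν,
      ((fun s : ℝ => y - s • ν) '' Ici 0 ∩ halfSpace (x - ρ • ν) ν).Nonempty := by
    intro y hy
    rw [mem_halfSpace] at hy
    refine ⟨y - ρ • ν, ⟨ρ, hρ0, rfl⟩, ?_⟩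
    rw [mem_halfSpace, sub_sub_sub_cancel_right]; exact hy
  obtain ⟨y₀, hy₀E, hy₀⟩ := not_subset.1 hne
  have hy₀' : y₀ ∈ halfSpace x ν \ Metric.closedBall x ρ := ⟨hE.subset_halfSpace hy₀E, hy₀⟩
  have h1 := hE.maximal _ (hraypre y₀) ((hray y₀ hy₀').trans hreg) ⟨y₀, hymem y₀, hy₀E⟩
  obtain ⟨w, hw1, hw2⟩ := hmeet y₀ hy₀'.1
  have h2 := hE.maximal _ (convex_halfSpace (x - ρ • ν) ν).isPreconnected (hFsub.trans hreg)
    ⟨w, hw2, h1 hw1⟩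
  intro y hy
  obtain ⟨v, hv1, hv2⟩ := hmeet y hy.1
  exact hE.maximal _ (hraypre y) ((hray y hy).trans hreg) ⟨v, hv1, h2 hv2⟩ (hymem y)

/-- A mirror domain adjacent to a point outside a ball around the origin that contains `S` is
unbounded. -/
lemma not_subset_closedBall (hN : 2 ≤ N) (hE : IsMirrorDomain S x ν E) {R₀ : ℝ}
    (hR : S ⊆ Metric.closedBall 0 R₀) (hx : R₀ < ‖x‖) (ρ : ℝ) :
    ¬ E ⊆ Metric.closedBall x ρ := by
  have hν := hE.norm
  have hνν : (inner ℝ ν ν : ℝ) = 1 := by rw [real_inner_self_eq_norm_sq, hν]; norm_num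
  obtain ⟨w, hw1, hwν, hwx⟩ := exists_unit_orthogonal hN hν x
  have hxS : x ∉ S := fun h => by
    have := hR h
    rw [mem_closedBall_zero_iff] at this
    linarith
  obtain ⟨r, hr, hrS⟩ : ∃ r > 0, Metric.ball x r ⊆ Sᶜ := by
    refine ⟨‖x‖ - R₀, sub_pos.2 hx, fun y hy hyS => ?_⟩
    have h1 := mem_closedBall_zero_iff.1 (hR hyS)
    rw [Metric.mem_ball, dist_eq_norm] at hy
    have h2 := norm_sub_norm_le x y
    rw [norm_sub_rev] at h2
    linarith
  obtain ⟨ε, ⟨⟨h1, h2⟩, h3⟩, hε⟩ : ∃ ε : ℝ, ((R₀ < ‖x - ε • ν‖ ∧ R₀ < ‖x + ε • ν‖) ∧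
      x - ε • ν ∈ Metric.ball x r) ∧ 0 < ε := by
    have c1 : ContinuousAt (fun ε : ℝ => ‖x - ε • ν‖) 0 := by fun_prop
    have c2 : ContinuousAt (fun ε : ℝ => ‖x + ε • ν‖) 0 := by fun_prop
    have c3 : ContinuousAt (fun ε : ℝ => x - ε • ν) 0 := by fun_prop
    have e1 := c1.eventually (lt_mem_nhds (show R₀ < ‖x - (0 : ℝ) • ν‖ by simpa using hx))
    have e2 := c2.eventually (lt_mem_nhds (show R₀ < ‖x + (0 : ℝ) • ν‖ by simpa using hx))
    have e3 := c3.eventually (Metric.isOpen_ball.mem_nhds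
      (show x - (0 : ℝ) • ν ∈ Metric.ball x r by simpa using hr))
    exact ((((e1.and e2).and e3).filter_mono (nhdsWithin_le_nhds (s := Ioi 0))).and
      self_mem_nhdsWithin).exists
  have hgrow : ∀ v : Eu N, 0 ≤ (inner ℝ v w : ℝ) → ∀ s : ℝ, 0 ≤ s → ‖v‖ ≤ ‖v + s • w‖ := by
    intro v hv s hs
    refine le_of_sq_le_sq ?_ (norm_nonneg _)
    rw [norm_add_sq_real, inner_smul_right, norm_smul, hw1, mul_one, Real.norm_eq_abs, sq_abs]
    nlinarith [mul_nonneg hs hv]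
  have hνw : (inner ℝ ν w : ℝ) = 0 := by rw [real_inner_comm]; exact hwν
  have hside : ∀ s : ℝ, (inner ℝ (x - ε • ν + s • w - x) ν : ℝ) = -ε := by
    intro s
    rw [show x - ε • ν + s • w - x = s • w - ε • ν by abel, inner_sub_left, inner_smul_left,
      inner_smul_left, hwν, hνν]
    simp
  have hK : (fun s : ℝ => x - ε • ν + s • w) '' Ici 0 ⊆ E := by
    refine hE.maximal _ (isPreconnected_Ici.image _ (by fun_prop)) ?_
      ⟨x - ε • ν, ⟨0, by simp, by simp⟩, hE.ball_inter_subset (self_mem_hyperplane x ν)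
        hE.adjacent hr hrS ⟨h3, ?_⟩⟩
    · rintro _ ⟨s, hs, rfl⟩
      have hs' : (0 : ℝ) ≤ s := hs
      refine ⟨?_, fun h => ?_, fun h => ?_⟩
      · rw [mem_halfSpace, hside]; linarith
      · have h4 := mem_closedBall_zero_iff.1 (hR h)
        have h5 := hgrow (x - ε • ν) (by rw [inner_sub_left, inner_smul_left, hνw]; simpa) s hs'
        linarith
      · have h4 := mem_closedBall_zero_iff.1 (hR h)
        have h6 : hrefl x ν (x - ε • ν + s • w) = x + ε • ν + s • w := by
          rw [hrefl_eq, hside]; module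
        have h5 := hgrow (x + ε • ν) (by rw [inner_add_left, inner_smul_left, hνw]; simpa) s hs'
        rw [h6] at h4
        linarith
    · have := hside 0
      rw [zero_smul, add_zero] at this
      rw [mem_halfSpace, this]; linarith
  intro hsub
  have h7 := hsub (hK ⟨|ρ| + ε + 1, by simp only [mem_Ici]; positivity, rfl⟩)
  rw [Metric.mem_closedBall, dist_eq_norm] at h7
  have h8 : ‖(|ρ| + ε + 1) • w‖ - ‖ε • ν‖ ≤ ‖(|ρ| + ε + 1) • w - ε • ν‖ := norm_sub_norm_le _ _
  rw [norm_smul, norm_smul, hw1, hν, Real.norm_eq_abs, Real.norm_eq_abs, abs_of_pos hε,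
    abs_of_pos (by positivity)] at h8
  have h9 : x - ε • ν + (|ρ| + ε + 1) • w - x = (|ρ| + ε + 1) • w - ε • ν := by abel
  rw [h9] at h7
  linarith [le_abs_self ρ]

end IsMirrorDomain

/-! ### Propagation of flat points to infinity -/

lemma isPreconnected_thickening {K : Set (Eu N)} (hK : IsPreconnected K) (δ : ℝ) :
    IsPreconnected (Metric.thickening δ K) := by
  have : Metric.thickening δ K = (fun q : Eu N × Eu N => q.1 + q.2) '' (K ×ˢ Metric.ball 0 δ) := by
    ext y
    rw [Metric.mem_thickening_iff]
    constructor
    · rintro ⟨k, hk, hd⟩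
      exact ⟨(k, y - k), ⟨hk, by rwa [mem_ball_zero_iff, ← dist_eq_norm]⟩, by simp⟩
    · rintro ⟨⟨k, v⟩, ⟨hk, hv⟩, rfl⟩
      exact ⟨k, hk, by rw [dist_eq_norm]; simpa using hv⟩
  rw [this]
  exact (hK.prod (convex_ball 0 δ).isPreconnected).image _ (by fun_prop)

section Propagation

variable {A : DiffSystem N M L} {B : Fin n → BdryOp N M L₁} {S : Set (Eu N)}
  {u : Eu N → Fin M → ℂ} (hAB : Admissible A B) (hS : IsClosed S) (hu : IsSol A Sᶜ u)
include hAB hS hu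

lemma isReflectionHyperplane_of_not_subset {R₀ : ℝ} (hR : S ⊆ Metric.closedBall 0 R₀)
    (hR₀ : 0 ≤ R₀) {i : Fin n} {x ν : Eu N} (hf : FlatAt B S u i x ν) {E : Set (Eu N)}
    (hE : IsMirrorDomain S x ν E) (hne : ¬ E ⊆ Metric.closedBall x (R₀ + ‖x‖)) :
    IsReflectionHyperplane B Sᶜ u x ν := by
  refine ⟨hf.1, i, R₀ + 2 * ‖x‖ + 1, by positivity, ?_⟩
  rintro y ⟨hy, hyR⟩
  rw [mem_closedBall_zero_iff, not_le] at hyR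
  have hyx : y ∉ Metric.closedBall x (R₀ + ‖x‖) := fun h => by
    rw [Metric.mem_closedBall, dist_eq_norm] at h
    linarith [norm_sub_norm_le y x]
  have hyS : y ∉ S := fun h => by
    have := mem_closedBall_zero_iff.1 (hR h)
    linarith [norm_nonneg x]
  have hyE : y ∈ closure E := by
    refine closure_mono (hE.halfSpace_diff_subset hR hR₀ hne) ?_
    rw [sdiff_eq, inter_comm]
    exact mem_closure_inter_halfSpace hf.1 hy Metric.isClosed_closedBall.isOpen_compl hyx
  obtain ⟨r, hr, -, h⟩ := zeroAt_of_mem_closure hAB hS hu hf hE hy hyS hyE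
  exact ⟨hyS, h y ⟨Metric.mem_ball_self hr, hy⟩⟩

/-- A flat point far away lies on a reflection hyperplane. -/
lemma FlatAt.isReflectionHyperplane (hN : 2 ≤ N) {R₀ : ℝ} (hR : S ⊆ Metric.closedBall 0 R₀)
    (hR₀ : 0 ≤ R₀) {i : Fin n} {x ν : Eu N} (hf : FlatAt B S u i x ν) (hx : R₀ < ‖x‖) :
    IsReflectionHyperplane B Sᶜ u x ν := by
  obtain ⟨E, hE⟩ := exists_isMirrorDomain hS hf.1 hf.notMem
  exact isReflectionHyperplane_of_not_subset hAB hS hu hR hR₀ hf hE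
    (hE.not_subset_closedBall hN hR hx _)

/-- The symmetric hull at a flat point is bounded, with a uniform bound, unless the flat hyperplane
is a reflection hyperplane. -/
lemma mirrorHull_subset_closedBall (hN : 2 ≤ N) {R₀ : ℝ} (hR : S ⊆ Metric.closedBall 0 R₀)
    (hR₀ : 0 ≤ R₀) {i : Fin n} {x ν : Eu N} (hf : FlatAt B S u i x ν) {E : Set (Eu N)}
    (hE : IsMirrorDomain S x ν E) (hnot : ¬ IsReflectionHyperplane B Sᶜ u x ν) :
    mirrorHull S x ν E ⊆ Metric.closedBall 0 (3 * R₀) := by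
  have hν := hE.norm
  have hx : ‖x‖ ≤ R₀ := by
    by_contra h
    exact hnot (hf.isReflectionHyperplane hAB hS hu hN hR hR₀ (not_le.1 h))
  have hEb : E ⊆ Metric.closedBall x (R₀ + ‖x‖) := by
    by_contra h
    exact hnot (isReflectionHyperplane_of_not_subset hAB hS hu hR hR₀ hf hE h)
  have hsub : Metric.closedBall x (R₀ + ‖x‖) ⊆ Metric.closedBall 0 (3 * R₀) := by
    refine Metric.closedBall_subset_closedBall' ?_
    rw [dist_zero_right]; linarith
  refine Subset.trans ?_ hsub
  rintro y ((hy | hy) | hy)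
  · exact hEb hy
  · have := hEb hy
    rwa [hrefl_mem_closedBall_self hν] at this
  · exact closure_minimal hEb Metric.isClosed_closedBall hy.2

variable {C : Fin m → Cell N} (hC : IsBoundaryDecomposition S C) (hBC : MixedBC B S C u)
include hC hBC

/-- A boundary point of the symmetric hull outside `S` is a flat point, provided that its mirror
image is a regular boundary point of `S`. -/
lemma exists_flatAt_of_mem_frontier {i : Fin n} {x ν : Eu N} (hf : FlatAt B S u i x ν)
    {E : Set (Eu N)} (hE : IsMirrorDomain S x ν E) {y : Eu N}
    (hy : y ∈ frontier (mirrorHull S x ν E)) (hyS : y ∉ S)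
    (hys : hrefl x ν y ∉ ⋃ k, skeleton C k) :
    ∃ a j, hrefl x ν y ∈ (C a).carrier ∧ FlatAt B S u j y (hrefl 0 ν (C a).normal) := by
  have hν := hE.norm
  obtain ⟨hfr, h | h⟩ := hE.hrefl_mem_frontier hS hyS hy
  · have := exists_flatAt_hrefl hAB hS hu hC hBC (hf.neg hAB hS hu) hE.neg hfr hys h.1 h.2
    simp only [hrefl_neg, hrefl_hrefl hν] at this
    exact this hyS
  · have := exists_flatAt_hrefl hAB hS hu hC hBC hf hE hfr hys h.1 h.2
    simp only [hrefl_hrefl hν] at this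
    exact this hyS

/-- A connected open set in the exterior that meets the symmetric hull and is not contained in its
closure contains a flat boundary point of the hull. -/
lemma exists_flatAt_of_not_subset_closure {i : Fin n} {x ν : Eu N} (hf : FlatAt B S u i x ν)
    {E : Set (Eu N)} (hE : IsMirrorDomain S x ν E) {U : Set (Eu N)} (hU : IsOpen U)
    (hUc : IsPreconnected U) (hUS : U ⊆ Sᶜ) (hne : (U ∩ mirrorHull S x ν E).Nonempty)
    (hsub : ¬ U ⊆ closure (mirrorHull S x ν E)) :
    ∃ y ∈ U ∩ frontier (mirrorHull S x ν E), ∃ j μ, FlatAt B S u j y μ := by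
  have hν := hE.norm
  have hsym := hE.hrefl_preimage_mirrorHull
  by_contra! hcon
  refine hsub ?_
  have h1 : hrefl x ν ⁻¹' U ⊆ closure (mirrorHull S x ν E) := by
    refine subset_closure_of_frontier_subset (isThin_skeleton C)
      (hU.preimage (continuous_hrefl x ν)) (isPreconnected_hrefl_preimage hν hUc)
      (hE.isOpen_mirrorHull hS) ?_ ?_
    · rintro y ⟨hy1, hy2⟩
      by_contra hys
      have hy3 : hrefl x ν y ∈ frontier (mirrorHull S x ν E) := by
        rwa [← mem_preimage, hrefl_preimage_frontier hν, hsym]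
      obtain ⟨a, j, -, h⟩ := exists_flatAt_of_mem_frontier hAB hS hu hC hBC hf hE hy3 (hUS hy2)
        (by rwa [hrefl_hrefl hν])
      exact hcon _ ⟨hy2, hy3⟩ _ _ h
    · obtain ⟨w, hw1, hw2⟩ := hne
      refine ⟨hrefl x ν w, by rwa [mem_preimage, hrefl_hrefl hν], ?_⟩
      rwa [← mem_preimage, hsym]
  intro y hy
  have h2 : hrefl x ν y ∈ closure (mirrorHull S x ν E) := h1 (by rwa [mem_preimage, hrefl_hrefl hν])
  rwa [← mem_preimage, hrefl_preimage_closure hν, hsym] at h2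

/-- If an unbounded connected open set in the exterior contains a flat point, then it meets a
reflection hyperplane, in a flat point. -/
lemma exists_isReflectionHyperplane (hN : 2 ≤ N) {R₀ : ℝ} (hR : S ⊆ Metric.closedBall 0 R₀)
    (hR₀ : 0 ≤ R₀) {Y : Set (Eu N)} (hY : IsOpen Y) (hYc : IsPreconnected Y) (hYS : Y ⊆ Sᶜ)
    (hYb : ¬ Bornology.IsBounded Y) {i : Fin n} {x ν : Eu N} (hxY : x ∈ Y)
    (hf : FlatAt B S u i x ν) :
    ∃ y ∈ Y, ∃ j μ, FlatAt B S u j y μ ∧ IsReflectionHyperplane B Sᶜ u y μ := by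
  by_contra! hno
  obtain ⟨z, hzY, hz⟩ : ∃ z ∈ Y, z ∉ Metric.closedBall (0 : Eu N) (3 * R₀) :=
    not_subset.1 fun h => hYb (Metric.isBounded_closedBall.subset h)
  obtain ⟨γ, hγ⟩ := ((hY.isConnected_iff_isPathConnected).1 ⟨⟨x, hxY⟩, hYc⟩).joinedIn x hxY z hzY
  set g : ℝ → Eu N := ⇑γ.extend
  have hg : Continuous g := γ.extend.continuous
  have hg0 : g 0 = x := γ.extend_zero
  have hg1 : g 1 = z := γ.extend_one
  have hgY : range g ⊆ Y := by
    rw [show range g = range γ from γ.extend_range]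
    exact range_subset_iff.2 hγ
  have hgc : IsCompact (range g) := by
    rw [show range g = range γ from γ.extend_range]
    exact isCompact_range γ.continuous
  obtain ⟨δ', hδ', hδY'⟩ := hgc.exists_thickening_subset_open hY hgY
  obtain ⟨δ, hδ, hδδ⟩ : ∃ δ > 0, 8 * δ = δ' := ⟨δ' / 8, by positivity, by ring⟩
  have hball : ∀ t, Metric.ball (g t) (8 * δ) ⊆ Y := fun t y hy =>
    hδY' (Metric.mem_thickening_iff.2 ⟨g t, mem_range_self t, hδδ ▸ hy⟩)
  -- the last parameter near which there are flat points
  set P : Set ℝ := {t | t ∈ Icc (0 : ℝ) 1 ∧ ∃ y j μ, FlatAt B S u j y μ ∧ dist y (g t) < δ}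
  have hP0 : (0 : ℝ) ∈ P := ⟨by simp, x, i, ν, hf, by rw [hg0, dist_self]; exact hδ⟩
  have hPb : BddAbove P := ⟨1, fun t ht => ht.1.2⟩
  have ht0 : 0 ≤ sSup P := le_csSup hPb hP0
  have ht1 : sSup P ≤ 1 := csSup_le ⟨0, hP0⟩ fun t ht => ht.1.2
  set T := sSup P
  obtain ⟨t, htP, htd⟩ : ∃ t ∈ P, dist (g t) (g T) < δ := by
    have hcl : T ∈ closure P := csSup_mem_closure ⟨0, hP0⟩ hPb
    obtain ⟨t, ht1, ht2⟩ := mem_closure_iff.1 hcl _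
      (Metric.isOpen_ball.preimage hg) (Metric.mem_ball_self (x := g T) hδ)
    exact ⟨t, ht2, ht1⟩
  obtain ⟨-, y, j, μ, hfy, hyd⟩ := htP
  have hyT : dist y (g T) < 2 * δ := by linarith [dist_triangle y (g t) (g T)]
  have hyball : Metric.ball y (4 * δ) ⊆ Y :=
    (Metric.ball_subset_ball' (by linarith)).trans (hball T)
  obtain ⟨E, hE⟩ := exists_isMirrorDomain hS hfy.1 hfy.notMem
  have hhull : Metric.ball y (4 * δ) ⊆ mirrorHull S y μ E :=
    hE.ball_subset_mirrorHull (self_mem_hyperplane y μ) hE.adjacent (by positivity)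
      (hyball.trans hYS)
  have hbd := mirrorHull_subset_closedBall hAB hS hu hN hR hR₀ hfy hE
    (hno y (hyball (Metric.mem_ball_self (by positivity))) j μ hfy)
  set U := Metric.thickening δ (g '' Icc T 1)
  have hUY : U ⊆ Y := by
    intro w hw
    obtain ⟨_, ⟨s, -, rfl⟩, hs⟩ := Metric.mem_thickening_iff.1 hw
    exact hball s (Metric.ball_subset_ball (by linarith) hs)
  have hgU : ∀ s ∈ Icc T 1, g s ∈ U := fun s hs =>
    Metric.self_subset_thickening hδ _ (mem_image_of_mem g hs)
  obtain ⟨y', ⟨hy'U, hy'f⟩, j', μ', hf'⟩ := exists_flatAt_of_not_subset_closure hAB hS hu hC hBC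
    hfy hE Metric.isOpen_thickening
    (isPreconnected_thickening (isPreconnected_Icc.image g hg.continuousOn) δ) (hUY.trans hYS)
    ⟨g T, hgU T ⟨le_rfl, ht1⟩, hhull (by rw [Metric.mem_ball, dist_comm]; linarith)⟩
    (fun hsub => hz (hg1 ▸ closure_minimal hbd Metric.isClosed_closedBall
      (hsub (hgU 1 ⟨ht1, le_rfl⟩))))
  obtain ⟨_, ⟨s, hs, rfl⟩, hsd⟩ := Metric.mem_thickening_iff.1 hy'U
  have hsT : s = T :=
    le_antisymm (le_csSup hPb ⟨⟨ht0.trans hs.1, hs.2⟩, y', j', μ', hf', hsd⟩) hs.1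
  rw [hsT] at hsd
  rw [(hE.isOpen_mirrorHull hS).frontier_eq] at hy'f
  refine hy'f.2 (hhull ?_)
  rw [Metric.mem_ball]
  linarith [dist_triangle y' (g T) y, dist_comm y (g T)]

end Propagation

end PolyScat

namespace PolyScat

variable {N M L L₁ n m : ℕ}

/-! ### Generic lines and exits along rays -/

/-- A generic line in direction `e` avoids the skeleton and meets only cells transversal to `e`. -/
lemma exists_generic_line (C : Fin m → Cell N) (e : Eu N) {O : Set (Eu N)} (hO : IsOpen O)
    (hne : O.Nonempty) : ∃ x ∈ O, ∀ t : ℝ, x + t • e ∉ ⋃ k, skeleton C k ∧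
      ∀ a, x + t • e ∈ (C a).carrier → (inner ℝ e (C a).normal : ℝ) ≠ 0 := by
  choose Z hZc hZd hZ using fun k => (isThin_skeleton C k).exists_exceptional e
  let Z' : {a : Fin m // (inner ℝ e (C a).normal : ℝ) = 0} → Set (Eu N) := fun a => (C a).plane
  have hd1 := dense_compl_iUnion hZc hZd
  have hd2 := dense_compl_iUnion (K := Z') (fun a => isClosed_hyperplane _ _)
    fun a => dense_compl_hyperplane (C a).norm_normal
  have ho1 : IsOpen (⋃ k, Z k)ᶜ := (isClosed_iUnion_of_finite hZc).isOpen_compl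
  obtain ⟨x, hx1, hx2, hx3⟩ := (hd1.inter_of_isOpen_left hd2 ho1).inter_open_nonempty O hO hne
  refine ⟨x, hx1, fun t => ⟨fun h => ?_, fun a ha h0 => ?_⟩⟩
  · obtain ⟨k, hk⟩ := mem_iUnion.1 h
    exact hZ k x (fun h' => hx2 (mem_iUnion.2 ⟨k, h'⟩)) t hk
  · refine hx3 (mem_iUnion.2 ⟨⟨a, h0⟩, ?_⟩)
    have := add_smul_mem_hyperplane ((C a).carrier_subset_plane ha) h0 (-t)
    rwa [neg_smul, add_neg_cancel_right] at this

lemma isometry_line (x : Eu N) {e : Eu N} (he : ‖e‖ = 1) : Isometry fun t : ℝ => x + t • e := by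
  refine Isometry.of_dist_eq fun s t => ?_
  rw [dist_add_left, dist_eq_norm, ← sub_smul, norm_smul, he, mul_one, dist_eq_norm]

/-- A closed part of a line that avoids a compact set has a uniform distance from it. -/
lemma exists_ball_subset_compl {S : Set (Eu N)} (hS : IsCompact S) {x e : Eu N} (he : ‖e‖ = 1)
    {I : Set ℝ} (hI : IsClosed I) (h : ∀ t ∈ I, x + t • e ∉ S) :
    ∃ δ > 0, ∀ t ∈ I, Metric.ball (x + t • e) δ ⊆ Sᶜ := by
  have hcl := (isometry_line x he).isClosedEmbedding.isClosedMap I hI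
  have hdisj : Disjoint S ((fun t : ℝ => x + t • e) '' I) :=
    disjoint_left.2 fun y hy ⟨t, ht, hty⟩ => h t ht (by subst hty; exact hy)
  obtain ⟨δ, hδ, hd⟩ := hdisj.exists_thickenings hS hcl
  refine ⟨δ, hδ, fun t ht y hy hyS => disjoint_left.1 hd (Metric.self_subset_thickening hδ _ hyS) ?_⟩
  exact Metric.mem_thickening_iff.2 ⟨_, mem_image_of_mem _ ht, hy⟩

section Rays

variable {A : DiffSystem N M L} {B : Fin n → BdryOp N M L₁} {S : Set (Eu N)}
  {u : Eu N → Fin M → ℂ} (hAB : Admissible A B) (hS : IsCompact S) (hu : IsSol A Sᶜ u)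
  {C : Fin m → Cell N} (hC : IsBoundaryDecomposition S C) (hBC : MixedBC B S C u)
include hAB hS hu hC hBC

/-- If all reflection hyperplanes are parallel to `e`, then so is every flat hyperplane at a point
from which one can escape to infinity in direction `e`, and it is a reflection hyperplane. The ray
would otherwise leave the bounded symmetric hull through the mirror image of a cell, at a flat point
of the same kind, and the process could be repeated along the ray. -/
lemma FlatAt.isReflectionHyperplane_of_ray (hN : 2 ≤ N) {e : Eu N} (he : ‖e‖ = 1)
    (hpar : ∀ p ν, IsReflectionHyperplane B Sᶜ u p ν → (inner ℝ ν e : ℝ) = 0)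
    {i : Fin n} {x ν : Eu N} (hf : FlatAt B S u i x ν) (hray : ∀ t : ℝ, 0 ≤ t → x + t • e ∉ S) :
    IsReflectionHyperplane B Sᶜ u x ν := by
  by_contra hnot
  have hSc := hS.isClosed
  obtain ⟨R₀, hR₀, hR⟩ : ∃ R₀ : ℝ, 0 ≤ R₀ ∧ S ⊆ Metric.closedBall 0 R₀ := by
    obtain ⟨r, hr⟩ := hS.isBounded.subset_closedBall 0
    exact ⟨max r 0, le_max_right _ _, hr.trans (Metric.closedBall_subset_closedBall (le_max_left _ _))⟩
  obtain ⟨δ', hδ', htube'⟩ := exists_ball_subset_compl hS he isClosed_Ici hray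
  obtain ⟨δ, hδ, rfl⟩ : ∃ δ > 0, 2 * δ = δ' := ⟨δ' / 2, by positivity, by ring⟩
  have htube : ∀ t : ℝ, 0 ≤ t → Metric.ball (x + t • e) (2 * δ) ⊆ Sᶜ := htube'
  set P : Set ℝ := {t | 0 ≤ t ∧ ∃ y j μ, FlatAt B S u j y μ ∧
    ¬ IsReflectionHyperplane B Sᶜ u y μ ∧ dist y (x + t • e) < δ} with hP
  have hP0 : (0 : ℝ) ∈ P := ⟨le_rfl, x, i, ν, hf, hnot, by simpa using hδ⟩
  have hPb : BddAbove P := by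
    refine ⟨R₀ + ‖x‖ + δ, ?_⟩
    rintro t ⟨ht, y, j, μ, hfy, hny, hd⟩
    have h1 : ‖y‖ ≤ R₀ := by
      by_contra h
      exact hny (hfy.isReflectionHyperplane hAB hSc hu hN hR hR₀ (not_le.1 h))
    have h2 : ‖t • e‖ = t := by rw [norm_smul, he, mul_one, Real.norm_of_nonneg ht]
    rw [dist_comm, dist_eq_norm] at hd
    have h3 : ‖t • e‖ ≤ ‖x + t • e - y‖ + ‖y - x‖ := by
      refine le_trans (le_of_eq ?_) (norm_add_le _ _)
      congr 1; abel
    linarith [norm_sub_le y x]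
  obtain ⟨s, ⟨hs0, y, j, μ, hfy, hny, hd⟩, hs⟩ :=
    exists_lt_of_lt_csSup ⟨0, hP0⟩ (show sSup P - δ / 2 < sSup P by linarith)
  have hyball : Metric.ball y δ ⊆ Sᶜ :=
    (Metric.ball_subset_ball' (by linarith)).trans (htube s hs0)
  obtain ⟨E, hE⟩ := exists_isMirrorDomain hSc hfy.1 hfy.notMem
  have hμ := hE.norm
  have hhull : Metric.ball y δ ⊆ mirrorHull S y μ E :=
    hE.ball_subset_mirrorHull (self_mem_hyperplane y μ) hE.adjacent hδ hyball
  have hbd := mirrorHull_subset_closedBall hAB hSc hu hN hR hR₀ hfy hE hny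
  set η := min (δ / 2) (δ - dist y (x + s • e))
  have hη : 0 < η := lt_min (by positivity) (sub_pos.2 hd)
  have hη1 : η ≤ δ / 2 := min_le_left _ _
  have hη2 : η ≤ δ - dist y (x + s • e) := min_le_right _ _
  obtain ⟨w, hw, hgen⟩ := exists_generic_line C (hrefl 0 μ e)
    (Metric.isOpen_ball.preimage (continuous_hrefl y μ) : IsOpen (hrefl y μ ⁻¹' Metric.ball y η))
    ⟨y, by rw [mem_preimage, hrefl_self]; exact Metric.mem_ball_self hη⟩
  set y' := hrefl y μ w
  have hy' : dist y' y < η := hw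
  have hline : ∀ t : ℝ, hrefl y μ (y' + t • e) = w + t • hrefl 0 μ e := fun t => by
    rw [hrefl_add, hrefl_hrefl hμ, hrefl_zero_smul]
  obtain ⟨t, ht, htf⟩ : ∃ t : ℝ, 0 ≤ t ∧ y' + t • e ∈ frontier (mirrorHull S y μ E) := by
    by_contra! hcon
    have hsub : (fun t : ℝ => y' + t • e) '' Ici 0 ⊆ mirrorHull S y μ E := by
      refine subset_of_disjoint_frontier (isPreconnected_Ici.image _ (by fun_prop)) ?_
        ⟨y', ⟨0, by simp, by simp⟩, hhull (by rw [Metric.mem_ball]; linarith)⟩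
      rintro _ ⟨t, ht, rfl⟩
      exact hcon t ht
    have h0 : (0 : ℝ) ≤ 3 * R₀ + ‖y'‖ + 1 := by positivity
    have h1 := mem_closedBall_zero_iff.1 (hbd (hsub ⟨3 * R₀ + ‖y'‖ + 1, h0, rfl⟩))
    have h2 : ‖(3 * R₀ + ‖y'‖ + 1) • e‖ = 3 * R₀ + ‖y'‖ + 1 := by
      rw [norm_smul, he, mul_one, Real.norm_of_nonneg h0]
    have h3 := norm_sub_le (y' + (3 * R₀ + ‖y'‖ + 1) • e) y'
    rw [add_sub_cancel_left, h2] at h3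
    linarith
  have hte : ‖t • e‖ = t := by rw [norm_smul, he, mul_one, Real.norm_of_nonneg ht]
  have htδ : δ / 2 ≤ t := by
    by_contra! hlt
    rw [(hE.isOpen_mirrorHull hSc).frontier_eq] at htf
    refine htf.2 (hhull ?_)
    have := dist_triangle (y' + t • e) y' y
    rw [dist_self_add_left, hte] at this
    rw [Metric.mem_ball]; linarith
  have hdist : dist (y' + t • e) (x + (s + t) • e) < δ := by
    rw [add_smul, ← add_assoc, dist_add_right]
    linarith [dist_triangle y' y (x + s • e)]
  have hst : 0 ≤ s + t := by linarith
  have hyS : y' + t • e ∉ S := htube (s + t) hst (by rw [Metric.mem_ball]; linarith)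
  obtain ⟨a, j', ha, hf'⟩ := exists_flatAt_of_mem_frontier hAB hSc hu hC hBC hfy hE htf hyS
    (by rw [hline]; exact (hgen t).1)
  rw [hline] at ha
  have hn' : ¬ IsReflectionHyperplane B Sᶜ u (y' + t • e) (hrefl 0 μ (C a).normal) := fun h => by
    refine (hgen t).2 a ha ?_
    rw [← inner_hrefl_zero hμ, hrefl_hrefl hμ, real_inner_comm]
    exact hpar _ _ h
  have := le_csSup hPb (show s + t ∈ P from ⟨hst, _, j', _, hf', hn', hdist⟩)
  linarith

omit hS hu hC hBC hAB in
lemma IsReflectionHyperplane.neg {p ν : Eu N} (h : IsReflectionHyperplane B Sᶜ u p ν) :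
    IsReflectionHyperplane B Sᶜ u p (-ν) := by
  obtain ⟨hν, i, R, hR, h⟩ := h
  refine ⟨by rw [norm_neg, hν], i, R, hR, fun y hy => ?_⟩
  rw [hyperplane_neg] at hy
  obtain ⟨h1, h2, h3⟩ := h y hy
  exact ⟨h1, h3, by rwa [neg_neg]⟩

omit hS hu hC hBC hAB in
lemma exists_mem_hyperplane_norm_gt (hN : 2 ≤ N) {p ν : Eu N} (hν : ‖ν‖ = 1) (R : ℝ) :
    ∃ y ∈ hyperplane p ν, R < ‖y‖ := by
  obtain ⟨w, hw, hwν, -⟩ := exists_unit_orthogonal hN hν 0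
  refine ⟨p + (|R| + ‖p‖ + 1) • w, add_smul_mem_hyperplane (self_mem_hyperplane p ν) hwν _, ?_⟩
  have h2 : ‖(|R| + ‖p‖ + 1) • w‖ = |R| + ‖p‖ + 1 := by
    rw [norm_smul, hw, mul_one, Real.norm_of_nonneg (by positivity)]
  have h3 := norm_sub_le (p + (|R| + ‖p‖ + 1) • w) p
  rw [add_sub_cancel_left, h2] at h3
  linarith [le_abs_self R]

omit hS hu hC hBC hAB in
/-- The distant points of a reflection hyperplane are flat. -/
lemma IsReflectionHyperplane.flatAt {p ν : Eu N} (h : IsReflectionHyperplane B Sᶜ u p ν)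
    (hS : IsClosed S) : ∃ i, ∃ R : ℝ, ∀ y ∈ hyperplane p ν, R < ‖y‖ → FlatAt B S u i y ν := by
  obtain ⟨hν, i, R, hR, h⟩ := h
  refine ⟨i, R, fun y hy hyR => ?_⟩
  have hyR' : y ∉ Metric.closedBall (0 : Eu N) R := by
    rwa [mem_closedBall_zero_iff, not_le]
  obtain ⟨r, hr, hrs⟩ := Metric.isOpen_iff.1
    (hS.isOpen_compl.inter (Metric.isClosed_closedBall (x := (0 : Eu N)) (ε := R)).isOpen_compl) y
    ⟨(h y ⟨hy, hyR'⟩).1, hyR'⟩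
  refine ⟨hν, r, hr, fun z hz => (hrs hz).1, fun z hz => (h z ⟨?_, (hrs hz.1).2⟩).2.1⟩
  rw [← hyperplane_eq_of_mem hy]; exact hz.2

omit hAB hu hC hBC in
/-- The mirror domain of a reflection hyperplane at a distant point contains all distant points of
the half-space. -/
lemma IsReflectionHyperplane.exists_isMirrorDomain (hN : 2 ≤ N) {p ν : Eu N}
    (h : IsReflectionHyperplane B Sᶜ u p ν) : ∃ x i E, ∃ ρ : ℝ, x ∈ hyperplane p ν ∧
      FlatAt B S u i x ν ∧ IsMirrorDomain S x ν E ∧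
      halfSpace p ν \ Metric.closedBall 0 ρ ⊆ E := by
  obtain ⟨r, hr⟩ := hS.isBounded.subset_closedBall 0
  have hR : S ⊆ Metric.closedBall 0 (max r 0) :=
    hr.trans (Metric.closedBall_subset_closedBall (le_max_left _ _))
  obtain ⟨i, R, hflat⟩ := h.flatAt hS.isClosed
  obtain ⟨x, hx, hxn⟩ := exists_mem_hyperplane_norm_gt hN h.1 (p := p) (max R (max r 0))
  have hf := hflat x hx (lt_of_le_of_lt (le_max_left _ _) hxn)
  obtain ⟨E, hE⟩ := PolyScat.exists_isMirrorDomain hS.isClosed h.1 hf.notMem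
  refine ⟨x, i, E, max r 0 + ‖x‖ + ‖x‖, hx, hf, hE, ?_⟩
  have := hE.halfSpace_diff_subset hR (le_max_right _ _) (hE.not_subset_closedBall hN hR
    (lt_of_le_of_lt (le_max_right _ _) hxn) _)
  rw [halfSpace_eq_of_mem hx] at this
  refine Subset.trans (sdiff_subset_sdiff_right ?_) this
  refine Metric.closedBall_subset_closedBall' ?_
  rw [dist_zero_right]

/-! ### Symmetry of the shadow of the scatterer -/

/-- If all reflection hyperplanes are parallel to `e`, then a regular boundary point of `S` that is
highest in direction `e`, on a cell transversal to `e`, has no mirror image in a reflection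
hyperplane whose whole line in direction `e` avoids `S`. -/
lemma not_line_subset_compl (hN : 2 ≤ N) {e : Eu N} (he : ‖e‖ = 1)
    (hpar : ∀ p ν, IsReflectionHyperplane B Sᶜ u p ν → (inner ℝ ν e : ℝ) = 0) {p ν : Eu N}
    (h : IsReflectionHyperplane B Sᶜ u p ν) {y : Eu N} (hy : y ∈ frontier S)
    (hys : y ∉ ⋃ k, skeleton C k)
    (hya : ∀ a, y ∈ (C a).carrier → (inner ℝ e (C a).normal : ℝ) ≠ 0) (hyν : y ∈ halfSpace p ν)
    (hyray : ∀ t : ℝ, 0 < t → y + t • e ∉ S) (hyline : ∀ t : ℝ, hrefl p ν y + t • e ∉ S) :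
    False := by
  have hν := h.1
  have hνe := hpar p ν h
  have heν : (inner ℝ e ν : ℝ) = 0 := by rw [real_inner_comm]; exact hνe
  have he0 := hrefl_zero_of_inner_eq_zero heν
  obtain ⟨x, i, E, ρ, hx, hf, hE, hρ⟩ := h.exists_isMirrorDomain hS hN
  rw [← hrefl_eq_of_mem hx] at hyline
  have hside : ∀ t : ℝ, y + t • e ∈ halfSpace p ν := fun t => by
    rw [mem_halfSpace] at hyν ⊢
    rw [add_sub_right_comm, inner_add_left, inner_smul_left, heν, mul_zero, add_zero]
    exact hyν
  have hK : (fun t : ℝ => y + t • e) '' Ioi 0 ⊆ E := by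
    refine hE.maximal _ (isPreconnected_Ioi.image _ (by fun_prop)) ?_ ?_
    · rintro _ ⟨t, ht, rfl⟩
      refine ⟨?_, hyray t ht, ?_⟩
      · rw [halfSpace_eq_of_mem hx]; exact hside t
      · simp only [hrefl_add, hrefl_zero_smul, he0]
        exact hyline t
    · have h0 : (0 : ℝ) < |ρ| + ‖y‖ + 1 := by positivity
      refine ⟨_, mem_image_of_mem _ (mem_Ioi.2 h0), hρ ⟨hside _, fun hb => ?_⟩⟩
      have h1 := mem_closedBall_zero_iff.1 hb
      have h3 := norm_sub_le (y + (|ρ| + ‖y‖ + 1) • e) y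
      rw [add_sub_cancel_left, norm_smul, he, mul_one, Real.norm_of_nonneg h0.le] at h3
      linarith [le_abs_self ρ]
  have hyE : y ∈ closure E := by
    refine closure_mono hK ?_
    have hc : Tendsto (fun t : ℝ => y + t • e) (𝓝[>] 0) (𝓝 y) := by
      have : Continuous fun t : ℝ => y + t • e := by fun_prop
      have := this.tendsto 0
      simp only [zero_smul, add_zero] at this
      exact this.mono_left nhdsWithin_le_nhds
    refine mem_closure_of_tendsto hc ?_
    filter_upwards [self_mem_nhdsWithin] with t ht using mem_image_of_mem _ ht
  obtain ⟨a, j, ha, hfa⟩ := exists_flatAt_hrefl hAB hS.isClosed hu hC hBC hf hE hy hys hyE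
    (by rw [halfSpace_eq_of_mem hx]; exact hyν) (by simpa using hyline 0)
  have := hpar _ _ (hfa.isReflectionHyperplane_of_ray hAB hS hu hC hBC hN he hpar
    fun t _ => hyline t)
  refine hya a ha ?_
  rw [← inner_hrefl_zero hν, he0, real_inner_comm]
  exact this

/-- If all reflection hyperplanes are parallel to `e`, then reflections in them preserve the shadow
of the interior of `S` in direction `e`. -/
lemma exists_hrefl_add_smul_mem (hN : 2 ≤ N) {e : Eu N} (he : ‖e‖ = 1)
    (hpar : ∀ p ν, IsReflectionHyperplane B Sᶜ u p ν → (inner ℝ ν e : ℝ) = 0) {p ν : Eu N}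
    (h : IsReflectionHyperplane B Sᶜ u p ν) {x : Eu N} (hx : x ∈ interior S) :
    ∃ t : ℝ, hrefl p ν x + t • e ∈ S := by
  by_contra! hcon
  have hν := h.1
  have heν : (inner ℝ e ν : ℝ) = 0 := by rw [real_inner_comm]; exact hpar p ν h
  have he0 := hrefl_zero_of_inner_eq_zero heν
  obtain ⟨δ, hδ, htube⟩ := exists_ball_subset_compl hS he isClosed_univ fun t _ => hcon t
  have hO : IsOpen (interior S ∩ Metric.ball x δ ∩ (hyperplane p ν)ᶜ) :=
    (isOpen_interior.inter Metric.isOpen_ball).inter (isClosed_hyperplane p ν).isOpen_compl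
  obtain ⟨x', ⟨⟨hx'S, hx'x⟩, hx'p⟩, hgen⟩ := exists_generic_line C e hO
    ((dense_compl_hyperplane hν).inter_open_nonempty _ (isOpen_interior.inter Metric.isOpen_ball)
      ⟨x, hx, Metric.mem_ball_self hδ⟩)
  -- the highest point of `S` on the line through `x'`
  have hcomp : IsCompact ((fun t : ℝ => x' + t • e) ⁻¹' S) :=
    (isometry_line x' he).isClosedEmbedding.isCompact_preimage hS
  obtain ⟨T, hT, hmax⟩ := hcomp.exists_isMaxOn ⟨0, by simpa using interior_subset hx'S⟩
    continuousOn_id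
  have hTS : x' + T • e ∈ S := hT
  have hray : ∀ t : ℝ, 0 < t → x' + T • e + t • e ∉ S := fun t ht hS' => by
    have h1 : T + t ∈ (fun t : ℝ => x' + t • e) ⁻¹' S := by
      rw [mem_preimage, add_smul, ← add_assoc]; exact hS'
    have h2 : T + t ≤ T := hmax h1
    linarith
  have hfr : x' + T • e ∈ frontier S := by
    rw [frontier_eq_closure_inter_closure]
    refine ⟨subset_closure hTS, ?_⟩
    have hc : Tendsto (fun t : ℝ => x' + T • e + t • e) (𝓝[>] 0) (𝓝 (x' + T • e)) := by
      have : Continuous fun t : ℝ => x' + T • e + t • e := by fun_prop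
      have := this.tendsto 0
      simp only [zero_smul, add_zero] at this
      exact this.mono_left nhdsWithin_le_nhds
    refine mem_closure_of_tendsto hc ?_
    filter_upwards [self_mem_nhdsWithin] with t ht using hray t ht
  have hline : ∀ t : ℝ, hrefl p ν (x' + T • e) + t • e ∉ S := fun t => by
    rw [hrefl_add, hrefl_zero_smul, he0, add_assoc, ← add_smul]
    refine htube (T + t) (mem_univ _) ?_
    rw [Metric.mem_ball, dist_add_right, dist_hrefl hν]
    exact hx'x
  have hside : (inner ℝ (x' + T • e - p) ν : ℝ) = inner ℝ (x' - p) ν := by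
    rw [add_sub_right_comm, inner_add_left, inner_smul_left, heν, mul_zero, add_zero]
  rcases mem_trichotomy p ν x' with hs | hs | hs
  · exact not_line_subset_compl hAB hS hu hC hBC hN he hpar h hfr (hgen T).1 (hgen T).2
      (by rw [mem_halfSpace, hside]; exact hs) hray hline
  · exact hx'p hs
  · refine not_line_subset_compl hAB hS hu hC hBC hN he hpar h.neg hfr (hgen T).1 (hgen T).2
      ?_ hray (by rwa [hrefl_neg])
    rw [mem_halfSpace_neg, hside]; exact mem_halfSpace_neg.1 hs

end Rays

end PolyScat

namespace PolyScat

variable {N m : ℕ}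

/-! ### Polyhedral bodies have finitely many mirror symmetries -/

lemma dense_compl_planes (C : Fin m → Cell N) : Dense (⋃ a, (C a).plane)ᶜ :=
  dense_compl_iUnion (fun _ => isClosed_hyperplane _ _)
    fun a => dense_compl_hyperplane (C a).norm_normal

/-- A set that is the closure of its interior, and whose boundary lies in finitely many hyperplanes,
coincides near each point `z` with a cone with vertex `z`. -/
lemma exists_conic {S : Set (Eu N)} (hS : S = closure (interior S)) {C : Fin m → Cell N}
    (hC : IsBoundaryDecomposition S C) (z : Eu N) :
    ∃ r > 0, ∀ x ∈ S ∩ Metric.ball z r, ∀ s : ℝ, 0 < s → z + s • (x - z) ∈ Metric.ball z r →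
      z + s • (x - z) ∈ S := by
  have hSc : IsClosed S := by rw [hS]; exact isClosed_closure
  set F : Set (Eu N) := ⋃ b ∈ {b : Fin m | z ∉ (C b).plane}, (C b).plane with hF
  have hFc : IsClosed F := (Set.toFinite _).isClosed_biUnion fun b _ => isClosed_hyperplane _ _
  have hzF : z ∉ F := by
    rw [hF, mem_iUnion₂]; rintro ⟨b, hb, hb'⟩; exact hb hb'
  obtain ⟨r, hr, hrF⟩ := Metric.isOpen_iff.1 hFc.isOpen_compl z hzF
  refine ⟨r, hr, ?_⟩
  -- off the hyperplanes the segment in question does not meet the boundary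
  have main : ∀ x ∈ interior S, x ∈ Metric.ball z r → x ∉ ⋃ a, (C a).plane → ∀ s : ℝ, 0 < s →
      z + s • (x - z) ∈ Metric.ball z r → z + s • (x - z) ∈ S := by
    intro x hxS hxb hxp s hs hsb
    have hnorm : ∀ t : ℝ, 0 < t → (z + t • (x - z) ∈ Metric.ball z r ↔ t * ‖x - z‖ < r) := by
      intro t ht
      rw [Metric.mem_ball, dist_eq_norm, add_sub_cancel_left, norm_smul, Real.norm_of_nonneg ht.le]
    set I : Set ℝ := {t | 0 < t ∧ t * ‖x - z‖ < r}
    have hI : I.OrdConnected := ⟨fun a ha b hb c hc => ⟨ha.1.trans_le hc.1,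
      lt_of_le_of_lt (mul_le_mul_of_nonneg_right hc.2 (norm_nonneg _)) hb.2⟩⟩
    have hsub : (fun t : ℝ => z + t • (x - z)) '' I ⊆ S := by
      refine subset_of_disjoint_frontier (hI.isPreconnected.image _ (by fun_prop)) ?_ ?_
      · rintro _ ⟨t, ht, rfl⟩ hfr
        rw [hC, mem_iUnion] at hfr
        obtain ⟨a, ha⟩ := hfr
        have ha' := (C a).carrier_subset_plane ha
        by_cases hza : z ∈ (C a).plane
        · have h1 : (inner ℝ (z + t • (x - z) - (C a).point) (C a).normal : ℝ) = 0 := ha'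
          rw [← inner_sub_eq_of_mem hza, add_sub_cancel_left, inner_smul_left] at h1
          rcases mul_eq_zero.1 h1 with h2 | h2
          · exact ht.1.ne' (by simpa using h2)
          · rw [inner_sub_eq_of_mem hza] at h2
            exact hxp (mem_iUnion.2 ⟨a, h2⟩)
        · exact hrF ((hnorm t ht.1).2 ht.2) (mem_iUnion₂.2 ⟨a, hza, ha'⟩)
      · refine ⟨x, ⟨1, ⟨one_pos, ?_⟩, by simp⟩, interior_subset hxS⟩
        rw [one_mul, ← dist_eq_norm]; exact hxb
    exact hsub ⟨s, ⟨hs, (hnorm s hs).1 hsb⟩, rfl⟩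
  rintro x ⟨hxS, hxb⟩ s hs hsb
  have hcont : Continuous fun y : Eu N => z + s • (y - z) := by fun_prop
  set O : Set (Eu N) := Metric.ball z r ∩ (fun y : Eu N => z + s • (y - z)) ⁻¹' Metric.ball z r
  have hO : IsOpen O := Metric.isOpen_ball.inter (Metric.isOpen_ball.preimage hcont)
  have hxcl : x ∈ closure (interior S ∩ O ∩ (⋃ a, (C a).plane)ᶜ) := by
    rw [hS] at hxS
    have h1 : x ∈ closure (interior S ∩ O) := by
      rw [inter_comm]
      exact hO.inter_closure ⟨⟨hxb, hsb⟩, hxS⟩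
    exact closure_minimal ((dense_compl_planes C).open_subset_closure_inter
      (isOpen_interior.inter hO)) isClosed_closure h1
  have := map_mem_closure hcont hxcl (t := S)
    fun y hy => main y hy.1.1 hy.1.2.1 hy.2 s hs hy.1.2.2
  rwa [hSc.closure_eq] at this

/-- The orthogonal projection along the unit vector `e`. -/
noncomputable def projAlong (e x : Eu N) : Eu N := x - (inner ℝ x e : ℝ) • e

@[fun_prop]
lemma continuous_projAlong (e : Eu N) : Continuous (projAlong e) := by
  unfold projAlong; fun_prop

lemma projAlong_add_smul {e : Eu N} (he : ‖e‖ = 1) (x : Eu N) (t : ℝ) :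
    projAlong e (x + t • e) = projAlong e x := by
  have h : (inner ℝ e e : ℝ) = 1 := by rw [real_inner_self_eq_norm_sq, he]; norm_num
  rw [projAlong, projAlong, inner_add_left, inner_smul_left, h]
  simp only [conj_trivial]
  module

lemma projAlong_line (e z v : Eu N) (s : ℝ) :
    projAlong e (z + s • v) = projAlong e z + s • projAlong e v := by
  simp only [projAlong, inner_add_left, inner_smul_left, conj_trivial]
  module

lemma projAlong_hrefl {e p ν : Eu N} (h : (inner ℝ ν e : ℝ) = 0) (x : Eu N) :
    projAlong e (hrefl p ν x) = hrefl p ν (projAlong e x) := by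
  have h' : (inner ℝ e ν : ℝ) = 0 := by rw [real_inner_comm]; exact h
  simp only [projAlong, hrefl_eq, inner_sub_left, inner_smul_left, conj_trivial, h, h']
  module

/-- The shadow of a polyhedral body has finitely many extreme points. -/
lemma finite_extremePoints_shadow {S : Set (Eu N)} (hSc : IsCompact S)
    (hS : S = closure (interior S)) {C : Fin m → Cell N} (hC : IsBoundaryDecomposition S C)
    (e : Eu N) : ((projAlong e '' S).extremePoints ℝ).Finite := by
  choose r hr hcon using exists_conic hS hC
  obtain ⟨t, -, ht⟩ := hSc.elim_nhds_subcover (fun z => Metric.ball z (r z))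
    fun z _ => Metric.ball_mem_nhds z (hr z)
  refine (t.finite_toSet.image (projAlong e)).subset ?_
  intro w hw
  obtain ⟨⟨x, hx, rfl⟩, hext⟩ := hw
  obtain ⟨z, hz, hxz⟩ := mem_iUnion₂.1 (ht hx)
  refine ⟨z, hz, ?_⟩
  -- `x` lies between two points of `S` on the ray from `z`, unless its shadow is that of `z`
  obtain ⟨s, hs, hsb⟩ : ∃ s : ℝ, z + (1 + s) • (x - z) ∈ Metric.ball z (r z) ∧ 0 < s := by
    have hc : ContinuousAt (fun s : ℝ => z + (1 + s) • (x - z)) 0 := by fun_prop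
    have h0 : z + (1 + (0 : ℝ)) • (x - z) ∈ Metric.ball z (r z) := by simpa using hxz
    exact (((hc.eventually (Metric.isOpen_ball.mem_nhds h0)).filter_mono
      (nhdsWithin_le_nhds (s := Ioi 0))).and self_mem_nhdsWithin).exists
  have h1 := hcon z x ⟨hx, hxz⟩ (1 + s) (by linarith) hs
  have h2 := hcon z x ⟨hx, hxz⟩ (1 / 2) (by norm_num) (by
    rw [Metric.mem_ball, dist_eq_norm] at hxz ⊢
    rw [add_sub_cancel_left, norm_smul]
    norm_num
    linarith [norm_nonneg (x - z)])
  have hlin : ∀ t : ℝ, projAlong e (z + t • (x - z)) =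
      projAlong e z + t • (projAlong e x - projAlong e z) := by
    intro t
    rw [projAlong_line]
    congr 2
    simp only [projAlong, inner_sub_left]; module
  have h3 := hext (mem_image_of_mem _ h2) (mem_image_of_mem _ h1) (by
    have hpos : 0 < 1 / 2 + s := by linarith
    refine ⟨s / (1 / 2 + s), (1 / 2) / (1 / 2 + s), by positivity, by positivity, by field_simp; ring, ?_⟩
    rw [hlin, hlin]
    have : (s / (1 / 2 + s)) + ((1 / 2) / (1 / 2 + s)) = 1 := by field_simp; ring
    have h4 : (s / (1 / 2 + s)) * (1 / 2) + ((1 / 2) / (1 / 2 + s)) * (1 + s) = 1 := by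
      field_simp; ring
    calc _ = ((s / (1 / 2 + s)) + ((1 / 2) / (1 / 2 + s))) • projAlong e z +
          ((s / (1 / 2 + s)) * (1 / 2) + ((1 / 2) / (1 / 2 + s)) * (1 + s)) •
            (projAlong e x - projAlong e z) := by module
      _ = projAlong e x := by rw [this, h4]; module)
  rw [hlin] at h3
  have h5 : (1 / 2 : ℝ) • (projAlong e z - projAlong e x) = 0 := by
    have := sub_eq_zero.2 h3
    rw [← this]; module
  exact sub_eq_zero.1 ((smul_eq_zero.1 h5).resolve_left (by norm_num))

/-- The Krein-Milman theorem for compact sets that need not be convex. -/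
lemma subset_closure_convexHull_extremePoints {s : Set (Eu N)} (hs : IsCompact s) :
    s ⊆ closure (convexHull ℝ (s.extremePoints ℝ)) := by
  intro x hx
  by_contra hxt
  obtain ⟨l, r, hlr, hrx⟩ := geometric_hahn_banach_closed_point
    (convex_convexHull ℝ (s.extremePoints ℝ)).closure isClosed_closure hxt
  have h : IsExposed ℝ s {y ∈ s | ∀ z ∈ s, l z ≤ l y} := fun _ => ⟨l, rfl⟩
  obtain ⟨z, hz, hmax⟩ := hs.exists_isMaxOn ⟨x, hx⟩ l.continuous.continuousOn
  obtain ⟨y, hy⟩ := (h.isCompact hs).extremePoints_nonempty ⟨z, hz, fun w hw => hmax hw⟩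
  have h1 := hlr y (subset_closure (subset_convexHull ℝ _
    (h.isExtreme.extremePoints_subset_extremePoints hy)))
  have h2 := hy.1.2 x hx
  linarith

lemma hrefl_combo (p ν x y : Eu N) {a b : ℝ} (hab : a + b = 1) :
    hrefl p ν (a • x + b • y) = a • hrefl p ν x + b • hrefl p ν y := by
  have h : a • x + b • y - p = a • (x - p) + b • (y - p) := by
    have : p = (a + b) • p := by rw [hab, one_smul]
    nth_rewrite 1 [this]
    module
  simp only [hrefl_eq, h, inner_add_left, inner_smul_left, conj_trivial]
  module

lemma mem_hyperplane_iff_hrefl_eq {p ν x : Eu N} (hν : ‖ν‖ = 1) :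
    x ∈ hyperplane p ν ↔ hrefl p ν x = x := by
  refine ⟨hrefl_of_mem, fun h => ?_⟩
  rw [hrefl_eq, sub_eq_self, smul_eq_zero] at h
  rcases h with h | h
  · exact (mul_eq_zero.1 h).resolve_left (by norm_num)
  · rw [h, norm_zero] at hν; norm_num at hν

/-- Two reflections parallel to `e` that agree on the extreme points of the shadow of a compact set
with nonempty interior have the same hyperplane. -/
lemma hyperplane_eq_of_eqOn_extremePoints {S : Set (Eu N)} (hSc : IsCompact S)
    (hSi : (interior S).Nonempty) {e p ν q μ : Eu N} (hν : ‖ν‖ = 1)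
    (hμ : ‖μ‖ = 1) (hνe : (inner ℝ ν e : ℝ) = 0) (hμe : (inner ℝ μ e : ℝ) = 0)
    (h : EqOn (hrefl p ν) (hrefl q μ) ((projAlong e '' S).extremePoints ℝ)) :
    hyperplane p ν = hyperplane q μ := by
  set F : Set (Eu N) := {x | hrefl p ν x = hrefl q μ x}
  have hFc : IsClosed F := isClosed_eq (continuous_hrefl p ν) (continuous_hrefl q μ)
  have hFconv : Convex ℝ F := by
    intro x hx y hy a b _ _ hab
    have hx' : hrefl p ν x = hrefl q μ x := hx
    have hy' : hrefl p ν y = hrefl q μ y := hy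
    change hrefl p ν _ = hrefl q μ _
    rw [hrefl_combo p ν x y hab, hrefl_combo q μ x y hab, hx', hy']
  have hsub : projAlong e '' S ⊆ F :=
    (subset_closure_convexHull_extremePoints (hSc.image (continuous_projAlong e))).trans
      (closure_minimal (convexHull_min h hFconv) hFc)
  have hSF : S ⊆ F := by
    intro x hx
    have h1 : hrefl p ν (projAlong e x) = hrefl q μ (projAlong e x) :=
      hsub (mem_image_of_mem _ hx)
    have h2 : x = projAlong e x + (inner ℝ x e : ℝ) • e := by simp [projAlong]
    have h3 : ∀ p ν : Eu N, (inner ℝ ν e : ℝ) = 0 →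
        hrefl p ν x = hrefl p ν (projAlong e x) + (inner ℝ x e : ℝ) • e := by
      intro p ν hνe
      nth_rewrite 1 [h2]
      rw [hrefl_add, hrefl_zero_smul, hrefl_zero_of_inner_eq_zero
        (by rw [real_inner_comm]; exact hνe)]
    change hrefl p ν x = hrefl q μ x
    rw [h3 p ν hνe, h3 q μ hμe, h1]
  obtain ⟨x₀, hx₀⟩ := hSi
  have hall : ∀ x, hrefl p ν x = hrefl q μ x := by
    intro x
    have hc : ContinuousAt (fun t : ℝ => x₀ + t • (x - x₀)) 0 := by fun_prop
    have h0 : x₀ + (0 : ℝ) • (x - x₀) ∈ interior S := by simpa using hx₀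
    obtain ⟨t, ht1, ht2⟩ := (((hc.eventually (isOpen_interior.mem_nhds h0)).filter_mono
      (nhdsWithin_le_nhds (s := {0}ᶜ))).and self_mem_nhdsWithin).exists
    have h1 : hrefl p ν (x₀ + t • (x - x₀)) = hrefl q μ (x₀ + t • (x - x₀)) :=
      hSF (interior_subset ht1)
    have h2 : hrefl p ν x₀ = hrefl q μ x₀ := hSF (interior_subset hx₀)
    rw [hrefl_add, hrefl_add, h2, add_right_inj, hrefl_zero_smul, hrefl_zero_smul] at h1
    have h3 := smul_right_injective _ ht2 h1
    have h4 : x = x₀ + (x - x₀) := by abel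
    rw [h4, hrefl_add, hrefl_add, h2, h3]
  ext x
  rw [mem_hyperplane_iff_hrefl_eq hν, mem_hyperplane_iff_hrefl_eq hμ, hall]

/-- Only finitely many reflections parallel to `e` preserve the shadow of a polyhedral body: they
permute its finitely many extreme points. -/
lemma finite_hyperplanes {S : Set (Eu N)} (hSc : IsCompact S) (hSi : (interior S).Nonempty)
    (hS : S = closure (interior S)) {C : Fin m → Cell N} (hC : IsBoundaryDecomposition S C)
    {e : Eu N} (he : ‖e‖ = 1) {Q : Eu N → Eu N → Prop} (hQ : ∀ p ν, Q p ν → ‖ν‖ = 1)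
    (hQe : ∀ p ν, Q p ν → (inner ℝ ν e : ℝ) = 0)
    (hQS : ∀ p ν, Q p ν → ∀ x ∈ interior S, ∃ t : ℝ, hrefl p ν x + t • e ∈ S) :
    {H : Set (Eu N) | ∃ p ν, Q p ν ∧ H = hyperplane p ν}.Finite := by
  set Sh := projAlong e '' S with hSh
  have hShc : IsCompact Sh := hSc.image (continuous_projAlong e)
  have hinv : ∀ p ν, Q p ν → ∀ w ∈ Sh, hrefl p ν w ∈ Sh := by
    intro p ν hq
    have h1 : interior S ⊆ (fun x => hrefl p ν (projAlong e x)) ⁻¹' Sh := by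
      intro x hx
      obtain ⟨t, ht⟩ := hQS p ν hq x hx
      refine ⟨_, ht, ?_⟩
      rw [projAlong_add_smul he, projAlong_hrefl (hQe p ν hq)]
    have h2 : S ⊆ (fun x => hrefl p ν (projAlong e x)) ⁻¹' Sh := by
      rw [hS]
      exact closure_minimal h1 (hShc.isClosed.preimage (by fun_prop))
    rintro _ ⟨x, hx, rfl⟩
    exact h2 hx
  set X := Sh.extremePoints ℝ with hX
  have hXfin : X.Finite := finite_extremePoints_shadow hSc hS hC e
  have hXinv : ∀ p ν, Q p ν → ∀ w ∈ X, hrefl p ν w ∈ X := by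
    intro p ν hq w hw
    have hν := hQ p ν hq
    refine ⟨hinv p ν hq w hw.1, ?_⟩
    rintro x₁ hx₁ x₂ hx₂ ⟨a, b, ha, hb, hab, hw'⟩
    have := hw.2 (hinv p ν hq x₁ hx₁) (hinv p ν hq x₂ hx₂)
      ⟨a, b, ha, hb, hab, by rw [← hrefl_combo _ _ _ _ hab, hw', hrefl_hrefl hν]⟩
    rw [← this, hrefl_hrefl hν]
  have : Finite X := hXfin
  choose p ν hq hH using fun H : {H : Set (Eu N) | ∃ p ν, Q p ν ∧ H = hyperplane p ν} => H.2
  refine Finite.of_injective (fun H (w : X) => (⟨hrefl (p H) (ν H) w, hXinv _ _ (hq H) w w.2⟩ : X))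
    fun H H' hHH' => ?_
  have h := hyperplane_eq_of_eqOn_extremePoints hSc hSi (hQ _ _ (hq H)) (hQ _ _ (hq H'))
    (hQe _ _ (hq H)) (hQe _ _ (hq H')) fun w hw =>
      congrArg Subtype.val (congrFun hHH' ⟨w, hw⟩)
  exact Subtype.ext ((hH H).trans (h.trans (hH H').symm))

end PolyScat

namespace PolyScat

variable {N M L L₁ n m : ℕ}

/-! ### The system of all reflection hyperplanes -/

lemma norm_le_norm_hrefl_add {p ν : Eu N} (hν : ‖ν‖ = 1) (x : Eu N) :
    ‖x‖ ≤ ‖hrefl p ν x‖ + 2 * ‖p‖ := by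
  have h := dist_hrefl (p := p) hν x p
  rw [hrefl_self, dist_eq_norm, dist_eq_norm] at h
  have h1 := norm_sub_le (hrefl p ν x) p
  have h2 := norm_sub_norm_le x p
  linarith

lemma isPreconnected_compl_closedBall (hN : 2 ≤ N) {R : ℝ} (hR : 0 ≤ R) :
    IsPreconnected (Metric.closedBall (0 : Eu N) R)ᶜ := by
  have hrank : 1 < Module.rank ℝ (Eu N) := by
    rw [← Module.finrank_eq_rank, finrank_euclideanSpace_fin]
    exact_mod_cast hN
  have h0 := (isConnected_compl_singleton_of_one_lt_rank hrank (0 : Eu N)).isPreconnected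
  have himg : (Metric.closedBall (0 : Eu N) R)ᶜ =
      (fun x : Eu N => (1 + R * ‖x‖⁻¹) • x) '' {0}ᶜ := by
    ext y
    rw [mem_compl_iff, mem_closedBall_zero_iff, not_le]
    constructor
    · intro hy
      have hy0 : 0 < ‖y‖ := hR.trans_lt hy
      have hc : 0 < 1 - R * ‖y‖⁻¹ := by
        rw [sub_pos, ← div_eq_mul_inv, div_lt_one hy0]; exact hy
      have hn : ‖(1 - R * ‖y‖⁻¹) • y‖ = ‖y‖ - R := by
        rw [norm_smul, Real.norm_of_nonneg hc.le]; field_simp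
      refine ⟨(1 - R * ‖y‖⁻¹) • y, fun h => ?_, ?_⟩
      · rw [mem_singleton_iff] at h
        rw [h, norm_zero] at hn; linarith
      · have hne : ‖y‖ - R ≠ 0 := by linarith
        simp only [hn, smul_smul]
        have : (1 + R * (‖y‖ - R)⁻¹) * (1 - R * ‖y‖⁻¹) = 1 := by field_simp; ring
        rw [this, one_smul]
    · rintro ⟨x, hx, rfl⟩
      have hx0 : 0 < ‖x‖ := norm_pos_iff.2 hx
      have hc : 0 < 1 + R * ‖x‖⁻¹ := by positivity
      have hn : ‖(1 + R * ‖x‖⁻¹) • x‖ = ‖x‖ + R := by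
        rw [norm_smul, Real.norm_of_nonneg hc.le]; field_simp
      show R < ‖(1 + R * ‖x‖⁻¹) • x‖
      rw [hn]; linarith
  rw [himg]
  refine h0.image _ (ContinuousOn.smul (continuousOn_const.add (continuousOn_const.mul
    (continuousOn_id.norm.inv₀ fun x hx => norm_ne_zero_iff.2 hx))) continuousOn_id)

lemma exists_mem_hyperplane_notMem (hN : 2 ≤ N) {p ν q μ : Eu N} (hμ : ‖μ‖ = 1)
    (h : ¬ hyperplane q μ ⊆ hyperplane p ν) (R : ℝ) :
    ∃ y ∈ hyperplane q μ, y ∉ hyperplane p ν ∧ R < ‖y‖ := by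
  obtain ⟨y₀, hy₀, hy₀p⟩ := not_subset.1 h
  obtain ⟨w, hw, hwμ, -⟩ := exists_unit_orthogonal hN hμ 0
  set c : ℝ := inner ℝ (y₀ - p) ν
  set d : ℝ := inner ℝ w ν
  set s : ℝ := |R| + ‖y₀‖ + |c / d| + 1
  have hs : 0 < s := by positivity
  refine ⟨y₀ + s • w, add_smul_mem_hyperplane hy₀ hwμ s, fun hmem => ?_, ?_⟩
  · have h1 : c + s * d = 0 := by
      rw [mem_hyperplane, add_sub_right_comm, inner_add_left, inner_smul_left] at hmem
      exact hmem
    have hd : d ≠ 0 := fun hd => hy₀p (by rw [hd, mul_zero, add_zero] at h1; exact h1)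
    have h2 : s = -(c / d) := by field_simp; linarith
    have h3 : |c / d| = s := by rw [← abs_neg, ← h2, abs_of_pos hs]
    have : s = |R| + ‖y₀‖ + |c / d| + 1 := rfl
    linarith [abs_nonneg R, norm_nonneg y₀]
  · have h3 := norm_sub_le (y₀ + s • w) y₀
    rw [add_sub_cancel_left, norm_smul, hw, mul_one, Real.norm_of_nonneg hs.le] at h3
    have : s = |R| + ‖y₀‖ + |c / d| + 1 := rfl
    linarith [le_abs_self R, abs_nonneg (c / d)]

/-- The union of all reflection hyperplanes. -/
def reflUnion (B : Fin n → BdryOp N M L₁) (S : Set (Eu N)) (u : Eu N → Fin M → ℂ) : Set (Eu N) :=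
  {x | ∃ p ν, IsReflectionHyperplane B Sᶜ u p ν ∧ x ∈ hyperplane p ν}

/-- The union of the unbounded components of the exterior of `S` with all reflection hyperplanes
removed. -/
def outerRegion (B : Fin n → BdryOp N M L₁) (S : Set (Eu N)) (u : Eu N → Fin M → ℂ) :
    Set (Eu N) :=
  {x | x ∈ Sᶜ \ reflUnion B S u ∧
    ¬ Bornology.IsBounded (connectedComponentIn (Sᶜ \ reflUnion B S u) x)}

section System

variable {B : Fin n → BdryOp N M L₁} {S : Set (Eu N)} {u : Eu N → Fin M → ℂ}

lemma subset_outerRegion {K : Set (Eu N)} (hK : IsPreconnected K) (hsub : K ⊆ Sᶜ \ reflUnion B S u)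
    (hne : (K ∩ outerRegion B S u).Nonempty) : K ⊆ outerRegion B S u := by
  obtain ⟨w, hwK, hw⟩ := hne
  intro x hx
  refine ⟨hsub hx, ?_⟩
  rw [← connectedComponentIn_eq (hK.subset_connectedComponentIn hwK hsub hx)]
  exact hw.2

lemma subset_outerRegion_of_unbounded {K : Set (Eu N)} (hK : IsPreconnected K)
    (hsub : K ⊆ Sᶜ \ reflUnion B S u) (hb : ¬ Bornology.IsBounded K) : K ⊆ outerRegion B S u :=
  fun _ hx => ⟨hsub hx, fun h => hb (h.subset (hK.subset_connectedComponentIn hx hsub))⟩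

lemma connectedComponentIn_subset_outerRegion {x : Eu N} (hx : x ∈ outerRegion B S u) :
    connectedComponentIn (Sᶜ \ reflUnion B S u) x ⊆ outerRegion B S u :=
  subset_outerRegion_of_unbounded isPreconnected_connectedComponentIn
    (connectedComponentIn_subset _ _) hx.2

variable {A : DiffSystem N M L} (hAB : Admissible A B) (hS : IsCompact S) (hu : IsSol A Sᶜ u)
include hAB hS hu

/-- The mirror image of a reflection hyperplane in another one is a reflection hyperplane. -/
lemma IsReflectionHyperplane.exists_hrefl (hN : 2 ≤ N) {p ν q μ : Eu N}
    (h : IsReflectionHyperplane B Sᶜ u p ν) (h' : IsReflectionHyperplane B Sᶜ u q μ)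
    (hne : ¬ hyperplane q μ ⊆ hyperplane p ν) :
    ∃ y ∈ hyperplane q μ, IsReflectionHyperplane B Sᶜ u (hrefl p ν y) (hrefl 0 ν μ) := by
  have hSc := hS.isClosed
  obtain ⟨r₀, hr₀⟩ := hS.isBounded.subset_closedBall 0
  have hR : S ⊆ Metric.closedBall 0 (max r₀ 0) :=
    hr₀.trans (Metric.closedBall_subset_closedBall (le_max_left _ _))
  obtain ⟨j, R, hflat⟩ := h'.flatAt hSc
  have key : ∀ ν', IsReflectionHyperplane B Sᶜ u p ν' → ∃ ρ : ℝ, ∀ y ∈ hyperplane q μ,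
      y ∈ halfSpace p ν' → ρ < ‖y‖ →
      IsReflectionHyperplane B Sᶜ u (hrefl p ν' y) (hrefl 0 ν' μ) := by
    intro ν' hν'
    obtain ⟨x, i, E, ρ, hx, hf, hE, hρ⟩ := hν'.exists_isMirrorDomain hS hN
    refine ⟨max (max ρ R) (max r₀ 0 + 2 * ‖p‖), fun y hy hyν hyn => ?_⟩
    rw [max_lt_iff, max_lt_iff] at hyn
    obtain ⟨⟨hy1, hy2⟩, hy3⟩ := hyn
    have hyE : y ∈ E := hρ ⟨hyν, by rw [mem_closedBall_zero_iff, not_le]; exact hy1⟩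
    obtain ⟨-, r, hr, hrS, hz⟩ := hflat y hy hy2
    obtain ⟨r₁, hr₁, hr₁E⟩ := Metric.isOpen_iff.1 hE.isOpen y hyE
    have hsub : Metric.ball y (min r r₁) ⊆ E :=
      (Metric.ball_subset_ball (min_le_right _ _)).trans hr₁E
    have hfl := flatAt_hrefl hAB hSc hu hf hE h'.1 (lt_min hr hr₁)
      (inter_subset_left.trans hsub) (j := j) (fun w hw => by
        obtain ⟨v, rfl⟩ : ∃ v, hrefl x ν' v = w := ⟨_, hrefl_hrefl hE.norm w⟩
        rw [hrefl_mem_ball hE.norm] at hw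
        exact (hE.sub (hsub hw)).2.2)
      fun w hw => by
        have hwr := Metric.ball_subset_ball (min_le_left r r₁) hw.1
        exact hAB.zeroFrom_of_zeroAt hSc.isOpen_compl hu (hrS hwr) (hz w ⟨hwr, hw.2⟩)
    rw [hrefl_eq_of_mem hx] at hfl
    refine hfl.isReflectionHyperplane hAB hSc hu hN hR (le_max_right _ _) ?_
    linarith [norm_le_norm_hrefl_add (p := p) hν'.1 y]
  obtain ⟨ρ₁, h1⟩ := key ν h
  obtain ⟨ρ₂, h2⟩ := key (-ν) h.neg
  obtain ⟨y, hyq, hyp, hyn⟩ := exists_mem_hyperplane_notMem hN h'.1 hne (max ρ₁ ρ₂)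
  refine ⟨y, hyq, ?_⟩
  rcases mem_trichotomy p ν y with hs | hs | hs
  · exact h1 y hyq hs ((le_max_left _ _).trans_lt hyn)
  · exact absurd hs hyp
  · have := h2 y hyq hs ((le_max_right _ _).trans_lt hyn)
    rwa [hrefl_neg, hrefl_neg] at this

lemma hrefl_mem_reflUnion (hN : 2 ≤ N) {p ν x : Eu N} (h : IsReflectionHyperplane B Sᶜ u p ν)
    (hx : x ∈ reflUnion B S u) : hrefl p ν x ∈ reflUnion B S u := by
  obtain ⟨q, μ, h', hxq⟩ := hx
  by_cases hsub : hyperplane q μ ⊆ hyperplane p ν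
  · rw [hrefl_of_mem (hsub hxq)]; exact ⟨q, μ, h', hxq⟩
  · obtain ⟨y, hy, hr⟩ := h.exists_hrefl hAB hS hu hN h' hsub
    refine ⟨_, _, hr, ?_⟩
    rw [hrefl_mem_hyperplane_hrefl h.1, hyperplane_eq_of_mem hy]; exact hxq

variable {C : Fin m → Cell N} (hC : IsBoundaryDecomposition S C) (hBC : MixedBC B S C u)
  (hclosed : IsClosed (reflUnion B S u))
include hC hBC hclosed

/-- The outer region contains no flat points: an escape to infinity would have to cross a
reflection hyperplane. -/
lemma not_flatAt_of_mem_outerRegion (hN : 2 ≤ N) {x : Eu N} (hx : x ∈ outerRegion B S u) {i : Fin n}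
    {ν : Eu N} : ¬ FlatAt B S u i x ν := by
  intro hf
  obtain ⟨r₀, hr₀⟩ := hS.isBounded.subset_closedBall 0
  obtain ⟨y, hy, j, μ, -, h⟩ := exists_isReflectionHyperplane hAB hS.isClosed hu hC hBC hN
    (hr₀.trans (Metric.closedBall_subset_closedBall (le_max_left r₀ 0))) (le_max_right _ _)
    (hS.isClosed.isOpen_compl.sdiff hclosed).connectedComponentIn
    isPreconnected_connectedComponentIn
    ((connectedComponentIn_subset _ _).trans sdiff_subset) hx.2 (mem_connectedComponentIn hx.1) hf
  exact (connectedComponentIn_subset _ _ hy).2 ⟨y, μ, h, self_mem_hyperplane y μ⟩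

/-- The outer region is symmetric in each reflection hyperplane, if `S` is the closure of its
interior. -/
lemma mem_outerRegion_of_hrefl_mem (hN : 2 ≤ N) (hSi : S = closure (interior S)) {p ν y : Eu N}
    (h : IsReflectionHyperplane B Sᶜ u p ν) (hy : hrefl p ν y ∈ outerRegion B S u) :
    y ∈ outerRegion B S u := by
  have hν := h.1
  obtain ⟨x, i, E, ρ, hx, hf, hE, hρ⟩ := h.exists_isMirrorDomain hS hN
  have hx' := hrefl_eq_of_mem hx
  have hsym := hE.hrefl_preimage_mirrorHull
  have hhull : (halfSpace p ν \ Metric.closedBall 0 ρ) ⊆ mirrorHull S x ν E :=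
    fun w hw => Or.inl (Or.inl (hρ hw))
  set Y := connectedComponentIn (Sᶜ \ reflUnion B S u) (hrefl p ν y)
  have hYO : Y ⊆ Sᶜ \ reflUnion B S u := connectedComponentIn_subset _ _
  have hYopen : IsOpen Y := (hS.isClosed.isOpen_compl.sdiff hclosed).connectedComponentIn
  have hyY : hrefl p ν y ∈ Y := mem_connectedComponentIn hy.1
  have hYout := connectedComponentIn_subset_outerRegion hy
  have hYb : ¬ Bornology.IsBounded Y := hy.2
  obtain ⟨z, hzY, hz⟩ : ∃ z ∈ Y, z ∉ Metric.closedBall (0 : Eu N) (|ρ| + 2 * ‖p‖) :=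
    not_subset.1 fun hb => hYb (Metric.isBounded_closedBall.subset hb)
  rw [mem_closedBall_zero_iff, not_le] at hz
  have hzhull : z ∈ mirrorHull S x ν E := by
    rcases mem_trichotomy p ν z with hs | hs | hs
    · refine hhull ⟨hs, ?_⟩
      rw [mem_closedBall_zero_iff, not_le]
      linarith [le_abs_self ρ, norm_nonneg p]
    · exact absurd ⟨p, ν, h, hs⟩ (hYO hzY).2
    · rw [← hsym, mem_preimage, hx']
      refine hhull ⟨(hrefl_mem_halfSpace hν).2 hs, ?_⟩
      rw [mem_closedBall_zero_iff, not_le]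
      linarith [le_abs_self ρ, norm_le_norm_hrefl_add (p := p) hν z]
  have hYcl : Y ⊆ closure (mirrorHull S x ν E) := by
    by_contra hnot
    obtain ⟨w, hw, j, μ, hfl⟩ := exists_flatAt_of_not_subset_closure hAB hS.isClosed hu hC hBC hf hE
      hYopen isPreconnected_connectedComponentIn (hYO.trans sdiff_subset) ⟨z, hzY, hzhull⟩ hnot
    exact not_flatAt_of_mem_outerRegion hAB hS hu hC hBC hclosed hN (hYout hw.1) hfl
  have hsub : hrefl p ν ⁻¹' Y ⊆ Sᶜ \ reflUnion B S u := by
    refine fun w hw => ⟨fun hwS => ?_, fun hwN => ?_⟩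
    · rw [hSi] at hwS
      obtain ⟨v, hv1, hv2⟩ := mem_closure_iff.1 hwS _ (hYopen.preimage (continuous_hrefl p ν)) hw
      have hv3 : v ∈ closure (mirrorHull S x ν E) := by
        have := hYcl hv1
        rwa [← hx', ← mem_preimage, hrefl_preimage_closure hν, hsym] at this
      obtain ⟨v', hv4, hv5⟩ := mem_closure_iff.1 hv3 _ isOpen_interior hv2
      exact hE.mirrorHull_subset_compl hv5 (interior_subset hv4)
    · exact (hYO hw).2 (hrefl_mem_reflUnion hAB hS hu hN h hwN)
  refine subset_outerRegion_of_unbounded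
    (isPreconnected_hrefl_preimage hν isPreconnected_connectedComponentIn) hsub (fun hb => hYb ?_) hyY
  obtain ⟨r, hr⟩ := hb.subset_closedBall 0
  refine Metric.isBounded_closedBall.subset (t := Metric.closedBall 0 (r + 2 * ‖p‖)) fun w hw => ?_
  have hw' : hrefl p ν w ∈ hrefl p ν ⁻¹' Y := by rwa [mem_preimage, hrefl_hrefl hν]
  have h1 := mem_closedBall_zero_iff.1 (hr hw')
  rw [mem_closedBall_zero_iff]
  linarith [norm_le_norm_hrefl_add (p := p) hν w]

omit hC hBC hclosed hAB hu in
/-- If all reflection hyperplanes are parallel to `e`, the distant points off these hyperplanes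
belong to the outer region. -/
lemma outerRegion_nonempty {e : Eu N} (he : ‖e‖ = 1)
    (hpar : ∀ p ν, IsReflectionHyperplane B Sᶜ u p ν → (inner ℝ ν e : ℝ) = 0)
    (hdense : Dense (reflUnion B S u)ᶜ) : (outerRegion B S u).Nonempty := by
  obtain ⟨r₀, hr₀⟩ := hS.isBounded.subset_closedBall 0
  have hfar : ((Metric.closedBall (0 : Eu N) r₀)ᶜ).Nonempty := by
    refine ⟨(|r₀| + 1) • e, ?_⟩
    rw [mem_compl_iff, mem_closedBall_zero_iff, norm_smul, he, mul_one,
      Real.norm_of_nonneg (by positivity)]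
    linarith [le_abs_self r₀]
  obtain ⟨z, hz1, hz2⟩ :=
    hdense.inter_open_nonempty _ Metric.isClosed_closedBall.isOpen_compl hfar
  rw [mem_compl_iff, mem_closedBall_zero_iff, not_le] at hz1
  obtain ⟨e', he', hpar', hze⟩ : ∃ e' : Eu N, ‖e'‖ = 1 ∧
      (∀ p ν, IsReflectionHyperplane B Sᶜ u p ν → (inner ℝ ν e' : ℝ) = 0) ∧
      0 ≤ (inner ℝ z e' : ℝ) := by
    rcases le_total 0 (inner ℝ z e : ℝ) with h | h
    · exact ⟨e, he, hpar, h⟩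
    · refine ⟨-e, by rw [norm_neg, he], fun p ν hp => ?_, ?_⟩
      · rw [inner_neg_right, hpar p ν hp, neg_zero]
      · rw [inner_neg_right]; linarith
  refine ⟨z, subset_outerRegion_of_unbounded (K := (fun t : ℝ => z + t • e') '' Ici 0)
    (isPreconnected_Ici.image _ (by fun_prop)) ?_ (fun hb => ?_) ⟨0, by simp, by simp⟩⟩
  · rintro _ ⟨t, ht, rfl⟩
    have ht' : (0 : ℝ) ≤ t := ht
    refine ⟨fun hS' => ?_, ?_⟩
    · have h1 := mem_closedBall_zero_iff.1 (hr₀ hS')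
      have h2 : ‖z‖ ≤ ‖z + t • e'‖ := by
        refine le_of_sq_le_sq ?_ (norm_nonneg _)
        rw [norm_add_sq_real, inner_smul_right]
        nlinarith [mul_nonneg ht' hze, sq_nonneg ‖t • e'‖]
      linarith
    · rintro ⟨p, ν, hp, hmem⟩
      have := add_smul_mem_hyperplane hmem (by rw [real_inner_comm]; exact hpar' p ν hp) (-t)
      rw [neg_smul, add_neg_cancel_right] at this
      exact hz2 ⟨p, ν, hp, this⟩
  · obtain ⟨r, hr⟩ := hb.subset_closedBall 0
    have h0 : (0 : ℝ) ≤ |r| + ‖z‖ + 1 := by positivity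
    have h1 := mem_closedBall_zero_iff.1 (hr ⟨|r| + ‖z‖ + 1, h0, rfl⟩)
    have h3 := norm_sub_le (z + (|r| + ‖z‖ + 1) • e') z
    rw [add_sub_cancel_left, norm_smul, he', mul_one, Real.norm_of_nonneg h0] at h3
    linarith [le_abs_self r]

end System

end PolyScat

namespace PolyScat

variable {N M L L₁ n m : ℕ}

/-! ### Finitely many reflection hyperplanes: the outer region is dense -/

section Finite

variable {B : Fin n → BdryOp N M L₁} {S : Set (Eu N)} {u : Eu N → Fin M → ℂ}

/-- The set of all reflection hyperplanes. -/
def reflPlanes (B : Fin n → BdryOp N M L₁) (S : Set (Eu N)) (u : Eu N → Fin M → ℂ) :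
    Set (Set (Eu N)) :=
  {H | ∃ p ν, IsReflectionHyperplane B Sᶜ u p ν ∧ H = hyperplane p ν}

lemma mem_reflUnion_iff {x : Eu N} : x ∈ reflUnion B S u ↔ ∃ H ∈ reflPlanes B S u, x ∈ H :=
  ⟨fun ⟨p, ν, h, hx⟩ => ⟨_, ⟨p, ν, h, rfl⟩, hx⟩, fun ⟨_, ⟨p, ν, h, hH⟩, hx⟩ => ⟨p, ν, h, hH ▸ hx⟩⟩

lemma isClosed_of_mem_reflPlanes {H : Set (Eu N)} (hH : H ∈ reflPlanes B S u) : IsClosed H := by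
  obtain ⟨p, ν, -, rfl⟩ := hH
  exact isClosed_hyperplane p ν

lemma isClosed_reflUnion (hfin : (reflPlanes B S u).Finite) : IsClosed (reflUnion B S u) := by
  have : reflUnion B S u = ⋃ H ∈ reflPlanes B S u, H := by
    ext x; rw [mem_reflUnion_iff, mem_iUnion₂]; simp only [exists_prop]
  rw [this]
  exact hfin.isClosed_biUnion fun H hH => isClosed_of_mem_reflPlanes hH

lemma dense_compl_reflUnion (hfin : (reflPlanes B S u).Finite) : Dense (reflUnion B S u)ᶜ := by
  have : Finite (reflPlanes B S u) := hfin
  have h := dense_compl_iUnion (K := fun H : reflPlanes B S u => (H : Set (Eu N)))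
    (fun H => isClosed_of_mem_reflPlanes H.2) fun H => by
      obtain ⟨H, p, ν, h, rfl⟩ := H
      exact dense_compl_hyperplane h.1
  refine h.mono (compl_subset_compl.2 fun x hx => ?_)
  obtain ⟨H, hH, hxH⟩ := mem_reflUnion_iff.1 hx
  exact mem_iUnion.2 ⟨⟨H, hH⟩, hxH⟩

variable {A : DiffSystem N M L} (hAB : Admissible A B) (hS : IsCompact S) (hu : IsSol A Sᶜ u)
  {C : Fin m → Cell N} (hC : IsBoundaryDecomposition S C) (hBC : MixedBC B S C u)
include hAB hS hu hC hBC

/-- Near a point of the exterior that lies on at most one reflection hyperplane, the outer region is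
dense as soon as it comes close to the point. -/
lemma ball_subset_closure_outerRegion (hN : 2 ≤ N) (hSi : S = closure (interior S))
    (hfin : (reflPlanes B S u).Finite) {z : Eu N} (hzS : z ∉ S)
    (hz : ∀ H ∈ reflPlanes B S u, ∀ H' ∈ reflPlanes B S u, z ∈ H → z ∈ H' → H ⊆ H')
    (hzc : z ∈ closure (outerRegion B S u)) :
    ∃ r > 0, Metric.ball z r ⊆ closure (outerRegion B S u) := by
  have hclosed := isClosed_reflUnion hfin
  set F : Set (Eu N) := ⋃ H ∈ {H | H ∈ reflPlanes B S u ∧ z ∉ H}, H with hF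
  have hFc : IsClosed F := (hfin.subset (sep_subset _ _)).isClosed_biUnion
    fun H hH => isClosed_of_mem_reflPlanes hH.1
  have hzF : z ∉ F := by
    rw [hF, mem_iUnion₂]; rintro ⟨b, hb, hb'⟩; exact hb.2 hb'
  obtain ⟨r, hr, hrs⟩ := Metric.isOpen_iff.1 (hS.isClosed.isOpen_compl.inter hFc.isOpen_compl) z
    ⟨hzS, hzF⟩
  refine ⟨r, hr, ?_⟩
  obtain ⟨w, hwb, hw⟩ := mem_closure_iff.1 hzc _ Metric.isOpen_ball (Metric.mem_ball_self hr)
  have hmeet : ∀ y ∈ Metric.ball z r, y ∈ reflUnion B S u →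
      ∃ H ∈ reflPlanes B S u, y ∈ H ∧ z ∈ H := by
    intro y hy hyN
    obtain ⟨H, hH, hyH⟩ := mem_reflUnion_iff.1 hyN
    refine ⟨H, hH, hyH, by_contra fun hzH => (hrs hy).2 (mem_iUnion₂.2 ⟨H, ⟨hH, hzH⟩, hyH⟩)⟩
  by_cases hex : ∃ H ∈ reflPlanes B S u, z ∈ H
  · obtain ⟨_, ⟨p, ν, h, rfl⟩, hzH⟩ := hex
    have hν := h.1
    have hN' : ∀ y ∈ Metric.ball z r, y ∈ reflUnion B S u → y ∈ hyperplane p ν := by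
      intro y hy hyN
      obtain ⟨H, hH, hyH, hzH'⟩ := hmeet y hy hyN
      exact hz H hH _ ⟨p, ν, h, rfl⟩ hzH' hzH hyH
    have half : ∀ σ, (σ = ν ∨ σ = -ν) → w ∈ halfSpace p σ →
        Metric.ball z r ∩ halfSpace p σ ⊆ outerRegion B S u := by
      intro σ hσ hwσ
      refine subset_outerRegion ((convex_ball z r).inter (convex_halfSpace p σ)).isPreconnected
        (fun y hy => ⟨(hrs hy.1).1, fun hyN => ?_⟩) ⟨w, ⟨hwb, hwσ⟩, hw⟩
      have h0 : (inner ℝ (y - p) ν : ℝ) = 0 := hN' y hy.1 hyN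
      rcases hσ with rfl | rfl
      · exact (mem_halfSpace.1 hy.2).ne h0
      · exact (mem_halfSpace_neg.1 hy.2).ne' h0
    have hrefb : ∀ y ∈ Metric.ball z r, hrefl p ν y ∈ Metric.ball z r := by
      intro y hy
      rw [← hrefl_of_mem hzH, hrefl_mem_ball hν]; exact hy
    have hsymm := fun y => mem_outerRegion_of_hrefl_mem hAB hS hu hC hBC hclosed hN hSi h (y := y)
    have both : Metric.ball z r ∩ halfSpace p ν ⊆ outerRegion B S u ∧
        Metric.ball z r ∩ halfSpace p (-ν) ⊆ outerRegion B S u := by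
      rcases mem_trichotomy p ν w with hs | hs | hs
      · have h1 := half ν (Or.inl rfl) hs
        exact ⟨h1, fun y hy => hsymm y (h1 ⟨hrefb y hy.1, (hrefl_mem_halfSpace hν).2 hy.2⟩)⟩
      · exact absurd ⟨p, ν, h, hs⟩ hw.1.2
      · have h1 := half (-ν) (Or.inr rfl) hs
        exact ⟨fun y hy => hsymm y (h1 ⟨hrefb y hy.1, (hrefl_mem_halfSpace_neg hν).2 hy.2⟩), h1⟩
    intro y hy
    rcases mem_trichotomy p ν y with hs | hs | hs
    · exact subset_closure (both.1 ⟨hy, hs⟩)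
    · exact closure_mono both.1 (mem_closure_inter_halfSpace hν hs Metric.isOpen_ball hy)
    · exact subset_closure (both.2 ⟨hy, hs⟩)
  · refine (subset_outerRegion (convex_ball z r).isPreconnected (fun y hy => ⟨(hrs hy).1, fun hyN => ?_⟩)
      ⟨w, hwb, hw⟩).trans subset_closure
    obtain ⟨H, hH, -, hzH⟩ := hmeet y hy hyN
    exact hex ⟨H, hH, hzH⟩

/-- If there are only finitely many reflection hyperplanes, all parallel to `e`, then the outer
region is dense in the exterior. -/
lemma compl_subset_closure_outerRegion (hN : 2 ≤ N) (hconn : IsPreconnected Sᶜ)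
    (hSi : S = closure (interior S)) (hfin : (reflPlanes B S u).Finite) {e : Eu N} (he : ‖e‖ = 1)
    (hpar : ∀ p ν, IsReflectionHyperplane B Sᶜ u p ν → (inner ℝ ν e : ℝ) = 0) :
    Sᶜ ⊆ closure (outerRegion B S u) := by
  have hclosed := isClosed_reflUnion hfin
  have hdense := dense_compl_reflUnion hfin
  have hSo := hS.isClosed.isOpen_compl
  have hOopen : IsOpen (outerRegion B S u) := by
    rw [isOpen_iff_mem_nhds]
    intro x hx
    exact mem_of_superset ((hSo.sdiff hclosed).connectedComponentIn.mem_nhds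
      (mem_connectedComponentIn hx.1)) (connectedComponentIn_subset_outerRegion hx)
  -- the intersections of different reflection hyperplanes do not separate the exterior
  let ι := {q : reflPlanes B S u × reflPlanes B S u // ¬ (q.1 : Set (Eu N)) ⊆ q.2}
  have : Finite (reflPlanes B S u) := hfin
  choose p ν hp hH using fun H : reflPlanes B S u => H.2
  let K : ι → Set (Eu N) := fun q => hyperplane (p q.1.1) (ν q.1.1) ∩ hyperplane (p q.1.2) (ν q.1.2)
  have hK : ∀ q : ι, IsThin (p q.1.1) (ν q.1.1) (K q) := fun q =>
    isThin_inter (hp _).1 (by rw [← hH, ← hH]; exact q.2)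
  have hW := isPreconnected_diff_iUnion hK hSo hconn
  have hWd := dense_compl_iUnion (fun q => (hK q).closed) fun q => (hK q).dense_compl
  have hsub : Sᶜ \ ⋃ q, K q ⊆ interior (closure (outerRegion B S u)) := by
    refine hW.subset_of_closure_inter_subset isOpen_interior ?_ ?_
    · obtain ⟨w, hw⟩ := outerRegion_nonempty hS he hpar hdense
      refine ⟨w, ⟨hw.1.1, fun hwK => ?_⟩, interior_maximal subset_closure hOopen hw⟩
      obtain ⟨q, hq⟩ := mem_iUnion.1 hwK
      exact hw.1.2 ⟨_, _, hp q.1.1, hq.1⟩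
    · rintro z ⟨hzc, hzS, hzK⟩
      have hzc' := closure_minimal interior_subset isClosed_closure hzc
      obtain ⟨r, hr, hrsub⟩ := ball_subset_closure_outerRegion hAB hS hu hC hBC hN hSi hfin hzS
        (fun H hH1 H' hH2 hz1 hz2 => by
          by_contra hn
          refine hzK (mem_iUnion.2 ⟨⟨(⟨H, hH1⟩, ⟨H', hH2⟩), hn⟩, ?_, ?_⟩)
          · rw [← hH ⟨H, hH1⟩]; exact hz1
          · rw [← hH ⟨H', hH2⟩]; exact hz2) hzc'
      exact mem_interior.2 ⟨_, hrsub, Metric.isOpen_ball, Metric.mem_ball_self hr⟩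
  exact (hWd.open_subset_closure_inter hSo).trans
    (closure_minimal (hsub.trans interior_subset) isClosed_closure)

end Finite

/-! ### Directions of the reflection hyperplanes -/

lemma isFlatPoint_iff {B : Fin n → BdryOp N M L₁} {S : Set (Eu N)} {u : Eu N → Fin M → ℂ}
    {x : Eu N} : IsFlatPoint B Sᶜ u x ↔ ∃ i ν, FlatAt B S u i x ν :=
  ⟨fun ⟨_, ν, i, h⟩ => ⟨i, ν, h⟩, fun ⟨i, ν, h⟩ => ⟨h.notMem, ν, i, h⟩⟩

lemma IsFiniteUnionOfPolyhedra.isBounded {S : Set (Eu N)} (h : IsFiniteUnionOfPolyhedra S) :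
    Bornology.IsBounded S := by
  obtain ⟨k, F, -, rfl⟩ := h
  refine (Bornology.isBounded_iUnion).2 fun a => ?_
  exact (isBounded_convexHull).2 (F a).finite_toSet.isBounded

lemma IsFiniteUnionOfPolyhedra.subset_closure_interior {S : Set (Eu N)}
    (h : IsFiniteUnionOfPolyhedra S) : S ⊆ closure (interior S) := by
  obtain ⟨k, F, hF, rfl⟩ := h
  refine iUnion_subset fun a => ?_
  refine subset_closure.trans ?_
  rw [← (convex_convexHull ℝ (F a : Set (Eu N))).closure_interior_eq_closure_of_nonempty_interior
    (hF a)]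
  exact closure_mono (interior_mono (subset_iUnion (fun a => convexHull ℝ (F a : Set (Eu N))) a))

section Directions

variable {B : Fin n → BdryOp N M L₁} {S : Set (Eu N)} {u : Eu N → Fin M → ℂ}
  {A : DiffSystem N M L} (hAB : Admissible A B) (hS : IsCompact S) (hu : IsSol A Sᶜ u)
  {C : Fin m → Cell N} (hC : IsBoundaryDecomposition S C) (hBC : MixedBC B S C u)
include hAB hS hu hC hBC

/-- If `S` is a nonempty obstacle and the part in the exterior of the boundary of the unbounded
component of the complement of `S ∪ S'` is flat, then no direction is parallel to all reflection
hyperplanes. -/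
lemma not_all_reflectionHyperplanes_parallel (hN : 2 ≤ N) (hconn : IsPreconnected Sᶜ)
    (hSi : S = closure (interior S)) (hSne : S.Nonempty) {S' : Set (Eu N)}
    (hS' : IsFiniteUnionOfPolyhedra S') (hne : (S' \ S).Nonempty) {Gt : Set (Eu N)}
    (hGt : IsUnboundedComponent (S ∪ S')ᶜ Gt)
    (hflat : ∀ x ∈ frontier Gt ∩ Sᶜ, IsFlatPoint B Sᶜ u x) {e : Eu N} (he : ‖e‖ = 1)
    (hpar : ∀ p ν, IsReflectionHyperplane B Sᶜ u p ν → (inner ℝ ν e : ℝ) = 0) : False := by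
  have hint : (interior S).Nonempty := by
    rw [hSi] at hSne; exact closure_nonempty_iff.1 hSne
  have hfin : (reflPlanes B S u).Finite := finite_hyperplanes hS hint hSi hC he
    (fun p ν h => h.1) hpar fun p ν h x hx =>
      exists_hrefl_add_smul_mem hAB hS hu hC hBC hN he hpar h hx
  have hclosed := isClosed_reflUnion hfin
  have hdense := compl_subset_closure_outerRegion hAB hS hu hC hBC hN hconn hSi hfin he hpar
  obtain ⟨⟨x₀, -, rfl⟩, hGb⟩ := hGt
  -- the outer region contains no boundary points of the unbounded component
  have hsub : outerRegion B S u ⊆ connectedComponentIn (S ∪ S')ᶜ x₀ := by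
    intro x hx
    refine subset_of_disjoint_frontier isPreconnected_connectedComponentIn (fun y hy hyf => ?_) ?_
      (mem_connectedComponentIn hx.1)
    · obtain ⟨i, ν, h⟩ := isFlatPoint_iff.1
        (hflat y ⟨hyf, (connectedComponentIn_subset _ _ hy).1⟩)
      exact not_flatAt_of_mem_outerRegion hAB hS hu hC hBC hclosed hN
        (connectedComponentIn_subset_outerRegion hx hy) h
    · obtain ⟨r, hr⟩ := (hS.isBounded.union hS'.isBounded).subset_closedBall 0
      obtain ⟨z, hzY, hz⟩ := not_subset.1 fun hb =>
        hx.2 ((Metric.isBounded_closedBall (x := (0 : Eu N)) (r := max r 0)).subset hb)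
      obtain ⟨w, hwG, hw⟩ := not_subset.1 fun hb =>
        hGb ((Metric.isBounded_closedBall (x := (0 : Eu N)) (r := max r 0)).subset hb)
      refine ⟨z, hzY, ?_⟩
      rw [connectedComponentIn_eq hwG]
      refine (isPreconnected_compl_closedBall hN (le_max_right r 0)).subset_connectedComponentIn hw
        (compl_subset_compl.2 (hr.trans ?_)) hz
      exact Metric.closedBall_subset_closedBall (le_max_left _ _)
  obtain ⟨y, hyS', hyS⟩ := hne
  obtain ⟨w, hwS, hwS'⟩ := mem_closure_iff.1 (hS'.subset_closure_interior hyS') _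
    hS.isClosed.isOpen_compl hyS
  obtain ⟨v, hv, hvO⟩ := mem_closure_iff.1 (hdense hwS) _ isOpen_interior hwS'
  exact connectedComponentIn_subset _ _ (hsub hvO) (Or.inr (interior_subset hv))

end Directions

end PolyScat

theorem theorem2p3 {N M L L₁ n m : ℕ} (hN : 2 ≤ N)
    (A : DiffSystem N M L) (B : Fin n → BdryOp N M L₁) (hAB : Admissible A B)
    (S : Set (Eu N)) (hS : IsScatterer S)
    (C : Fin m → Cell N) (hC : IsBoundaryDecomposition S C)
    (u : Eu N → Fin M → ℂ) (hu : IsSol A Sᶜ u) (hBC : MixedBC B S C u) :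
    ((∃ x, IsFlatPoint B Sᶜ u x) → ∃ p ν, IsReflectionHyperplane B Sᶜ u p ν) ∧
    (IsObstacle S → S.Nonempty →
      ∀ S' : Set (Eu N), IsFiniteUnionOfPolyhedra S' → (S' \ S).Nonempty →
      ∀ Gt : Set (Eu N), IsUnboundedComponent (S ∪ S')ᶜ Gt →
      (∀ x ∈ frontier Gt ∩ Sᶜ, IsFlatPoint B Sᶜ u x) →
      ∃ p ν : Fin N → Eu N,
        (∀ a, IsReflectionHyperplane B Sᶜ u (p a) (ν a)) ∧ LinearIndependent ℝ ν) := by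
  have hSc : IsCompact S := Metric.isCompact_of_isClosed_isBounded hS.closed hS.bounded
  constructor
  · rintro ⟨x, hx⟩
    obtain ⟨i, ν, hf⟩ := isFlatPoint_iff.1 hx
    obtain ⟨r, hr⟩ := hS.bounded.subset_closedBall 0
    have hunb : ¬ Bornology.IsBounded Sᶜ := fun hb => by
      obtain ⟨r', hr'⟩ := (hS.bounded.union hb).subset_closedBall 0
      obtain ⟨y, -, hy⟩ := exists_mem_hyperplane_norm_gt hN hf.1 (p := x) r'
      have := mem_closedBall_zero_iff.1 (hr' (union_compl_self S ▸ mem_univ y))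
      linarith
    obtain ⟨y, -, -, μ, -, h⟩ := exists_isReflectionHyperplane hAB hS.closed hu hC hBC hN
      (hr.trans (Metric.closedBall_subset_closedBall (le_max_left r 0))) (le_max_right _ _)
      hS.closed.isOpen_compl hS.connected.isPreconnected subset_rfl hunb hf.notMem hf
    exact ⟨y, μ, h⟩
  · intro hobs hSne S' hS' hne Gt hGt hflat
    set D : Set (Eu N) := {ν | ∃ p, IsReflectionHyperplane B Sᶜ u p ν}
    have hspan : Submodule.span ℝ D = ⊤ := by
      by_contra hspan
      have hperp : (Submodule.span ℝ D)ᗮ ≠ ⊥ := fun h =>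
        hspan (Submodule.orthogonal_eq_bot_iff.1 h)
      obtain ⟨e, heD, he0⟩ := Submodule.exists_mem_ne_zero_of_ne_bot hperp
      refine not_all_reflectionHyperplanes_parallel hAB hSc hu hC hBC hN
        hS.connected.isPreconnected hobs.2 hSne hS' hne hGt hflat (e := ‖e‖⁻¹ • e) ?_ ?_
      · rw [norm_smul, norm_inv, norm_norm, inv_mul_cancel₀ (norm_ne_zero_iff.2 he0)]
      · intro p ν h
        rw [inner_smul_right, (Submodule.mem_orthogonal _ _).1 heD ν
          (Submodule.subset_span ⟨p, h⟩), mul_zero]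
    obtain ⟨f, hf, -, hli⟩ := Submodule.exists_fun_fin_finrank_span_eq ℝ D
    have hrank : Module.finrank ℝ (Submodule.span ℝ D) = N := by
      rw [hspan, finrank_top, finrank_euclideanSpace_fin]
    choose p hp using hf
    exact ⟨fun a => p (Fin.cast hrank.symm a), fun a => f (Fin.cast hrank.symm a),
      fun a => hp _, hli.comp _ (Fin.cast_injective _)⟩
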